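/- **Setting.** Let $n\ge 2$, $1\le d\le n$, and let $\mathbb G_{d,n}$ be the set of $d$-dimensional linear subspaces of $\mathbb R^n$, each identified with its orthogonal projection, with the distance $\|S-T\|$ (operator norm). A $d$-varifold is a Radon measure $V$ on $\mathbb R^n\times\mathbb G_{d,n}$; its mass measure is $\|V\|(A)=V(A\times\mathbb G_{d,n})$. For varifolds of finite mass, $$\Delta(V,W)=\sup\Big\{\Big|\int\phi\,dV-\int\phi\,dW\Big| : \phi:\mathbb R^n\times\mathbb G_{d,n}\to[0,1],\ |\phi(x,S)-\phi(y,T)|\le|x-y|+\|S-T\|\Big\}.$$ For $f:\mathbb R^n\to\mathbb R^n$ a $C^1$ diffeomorphism, $f_\#V$ is defined by $\int\phi\,d(f_\#V)=\int\phi(f(x),Df(x)(S))\,J_Sf(x)\,dV(x,S)$, where $J_Sf(x)=\det(Y^tY)^{1/2}$, $Y=(Df(x)s_1|\cdots|Df(x)s_d)$ for an orthonormal basis $(s_i)$ of $S$. Let $\psi\in C^\infty(\mathbb R^n)$ be radially symmetric with $0\le\psi\le1$, $\psi=1$ for $|x|\le\frac12$, $\psi=0$ for $|x|\ge1$, and $|\nabla\psi|\le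 K$, $\|\nabla^2\psi\|\le K$ everywhere. For $\epsilon\in(0,1)$ let $\hat\Phi_\epsilon(x)=(2\pi\epsilon^2)^{-n/2}e^{-|x|^2/(2\epsilon^2)}$, $\Phi_\epsilon=\big(\int\psi\hat\Phi_\epsilon\big)^{-1}\psi\hat\Phi_\epsilon$, and $$h_\epsilon(\cdot,V)=\Phi_\epsilon*\tilde h_\epsilon(\cdot,V),\qquad \tilde h_\epsilon(y,V)=-\frac{\int S(\nabla\Phi_\epsilon(x-y))\,dV(x,S)}{\int\Phi_\epsilon(x-y)\,d\|V\|(x)+\epsilon}.$$ For a subdivision $\mathcal T:0=t_0<\dots<t_m=1$ with mesh $\delta(\mathcal T)=\max_i(t_i-t_{i-1})$, the time-discrete flow starting from $V_0$ is $V_{\epsilon,\mathcal T}(0)=V_0$ and $V_{\epsilon,\mathcal T}(t)=[\mathrm{id}+(t-t_i)h_\epsilon(\cdot,V_{\epsilon,\mathcal T}(t_i))]_\#V_{\epsilon,\mathcal T}(t_i)$ for $t\in[t_i,t_{i+1}]$ (well defined when $\delta(\mathcal T)$ is small). An *approximate mean curvature flow* starting from $V_0$ is a family $(V_\epsilon(t))_{t\in[0,1]}$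 of varifolds of finite mass such that $\Delta(V_{\epsilon,\mathcal T_j}(t),V_\epsilon(t))\to0$ for every $t\in[0,1]$ and every sequence of subdivisions with $\delta(\mathcal T_j)\to0$. **Proposition.** For every $n\ge2$ and every $K$ there is a constant $c_5>0$, depending only on $n$ and $K$, such that the following holds for all $1\le d\le n$, all $\psi$ as above, all $\epsilon\in(0,1)$ and $M\ge1$. Let $V_0,W_0$ be compactly supported $d$-varifolds in $\mathbb R^n$ with $\|V_0\|(\mathbb R^n)\le M$ and $\|W_0\|(\mathbb R^n)\le M$. Then approximate mean curvature flows $(V_\epsilon(t))_{t\in[0,1]}$, $(W_\epsilon(t))_{t\in[0,1]}$ starting from $V_0$, $W_0$ exist, and any such flows satisfy, for all $t\in[0,1]$, $$\Delta(V_\epsilon(t),W_\epsilon(t))\le\Delta(V_0,W_0)\,\exp\!\big(c_5\,(M+1)^2\,t\,\epsilon^{-n-7}\big).$$ -/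

import Mathlib

open MeasureTheory Set Filter Topology
open scoped ContDiff

noncomputable section

/-- Euclidean space `ℝⁿ`. -/
abbrev Euc (n : ℕ) : Type := EuclideanSpace ℝ (Fin n)

/-- The Grassmannian of `d`-dimensional linear subspaces of `ℝⁿ`, a subspace being identified with
the orthogonal projection onto it. The metric is the one induced by the operator norm. -/
abbrev Grassmannian (d n : ℕ) : Type :=
  {S : Euc n →L[ℝ] Euc n // IsStarProjection S ∧ Module.finrank ℝ S.range = d}

/-- A `d`-varifold in `ℝⁿ` is a Radon measure on `ℝⁿ × G(d,n)`, that is (this space being locally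
compact and second countable) a Borel measure that is finite on compact sets. We work with
measures on `ℝⁿ × G(d,n)` and carry the condition `IsLocallyFiniteMeasure`. -/
abbrev VarifoldMeasure (d n : ℕ) : Type := Measure (Euc n × Grassmannian d n)

variable {d n : ℕ}

/-- The mass measure `‖V‖(A) = V(A × G(d,n))`. -/
def massMeasure (V : VarifoldMeasure d n) : Measure (Euc n) := V.map Prod.fst

/-- The bounded Lipschitz distance `Δ` between finite measures on `ℝⁿ × G(d,n)`. The Lipschitz
constant is taken for the distance `|x - y| + ‖S - T‖` on the product. -/
def bddLipDist (V W : VarifoldMeasure d n) : ℝ :=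
  sSup {r : ℝ | ∃ φ : Euc n × Grassmannian d n → ℝ, Continuous φ ∧
    (∀ p, 0 ≤ φ p ∧ φ p ≤ 1) ∧
    (∀ p q, |φ p - φ q| ≤ ‖p.1 - q.1‖ + ‖p.2.1 - q.2.1‖) ∧
    r = |∫ p, φ p ∂V - ∫ p, φ p ∂W|}

/-- The tangential Jacobian `det (Yᵗ Y)^(1/2)`, `Y = (A s₁ | ⋯ | A s_d)`, of a linear map `A`
along the subspace `S`, where `s₁, …, s_d` is an orthonormal basis of `S`. -/
def tangentialJacobian (A : Euc n →L[ℝ] Euc n) (S : Grassmannian d n) : ℝ :=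
  √(Matrix.gram ℝ fun i => A ((stdOrthonormalBasis ℝ S.1.range i : S.1.range) : Euc n)).det

open scoped Classical in
/-- The image `A(S)` of the `d`-dimensional subspace `S` under the linear map `A`. It is only
meaningful when `A` is injective on `S`; otherwise (where the tangential Jacobian vanishes) it is
`S` by convention. -/
def imagePlane (A : Euc n →L[ℝ] Euc n) (S : Grassmannian d n) : Grassmannian d n :=
  if h : Module.finrank ℝ (S.1.range.map (A : Euc n →ₗ[ℝ] Euc n)) = d then
    ⟨(S.1.range.map (A : Euc n →ₗ[ℝ] Euc n)).starProjection,
      isStarProjection_starProjection, by rw [Submodule.range_starProjection]; exact h⟩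
  else S

/-- The push-forward `f_# V` of a varifold:
`∫ φ d(f_# V) = ∫ φ (f x, Df(x)(S)) J_S f(x) dV(x, S)`. -/
def pushForward (f : Euc n → Euc n) (V : VarifoldMeasure d n) : VarifoldMeasure d n :=
  (V.withDensity fun p => ENNReal.ofReal (tangentialJacobian (fderiv ℝ f p.1) p.2)).map
    fun p => (f p.1, imagePlane (fderiv ℝ f p.1) p.2)

/-- Admissible cutoff functions: smooth, radially symmetric, equal to `1` for `|x| ≤ 1/2` and to
`0` for `|x| ≥ 1`, with values in `[0,1]`, gradient and Hessian bounded by `K`. -/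
structure IsCutoff (K : ℝ) (ψ : Euc n → ℝ) : Prop where
  smooth : ContDiff ℝ ∞ ψ
  radial : ∀ x y, ‖x‖ = ‖y‖ → ψ x = ψ y
  eq_one : ∀ x, ‖x‖ ≤ 1 / 2 → ψ x = 1
  eq_zero : ∀ x, 1 ≤ ‖x‖ → ψ x = 0
  nonneg : ∀ x, 0 ≤ ψ x
  le_one : ∀ x, ψ x ≤ 1
  gradient_le : ∀ x, ‖gradient ψ x‖ ≤ K
  hessian_le : ∀ x, ‖fderiv ℝ (fderiv ℝ ψ) x‖ ≤ K

/-- The Gaussian `(2πε²)^(-n/2) exp(-|x|²/(2ε²))` on `ℝⁿ`. -/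
def gaussKernel (ε : ℝ) (x : Euc n) : ℝ :=
  1 / (2 * Real.pi * ε ^ 2) ^ ((n : ℝ) / 2) * Real.exp (-‖x‖ ^ 2 / (2 * ε ^ 2))

/-- The truncated Gaussian `Φ_ε = c(ε) ψ Φ̂_ε`, normalized to have integral one. -/
def truncKernel (ψ : Euc n → ℝ) (ε : ℝ) (x : Euc n) : ℝ :=
  (1 / ∫ y, ψ y * gaussKernel ε y) * ψ x * gaussKernel ε x

/-- `(Φ_ε ∗ ‖V‖)(x) = ∫ Φ_ε(y - x) d‖V‖(y)`. -/
def smoothedMass (ψ : Euc n → ℝ) (ε : ℝ) (V : VarifoldMeasure d n) (x : Euc n) : ℝ :=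
  ∫ y, truncKernel ψ ε (y - x) ∂(massMeasure V)

/-- `(Φ_ε ∗ δV)(x) = ∫ S(∇Φ_ε(y - x)) dV(y, S)`; its `i`-th component is the first variation
`δV(X) = ∫ tr(S DX) dV` at the vector field `X = Φ_ε(· - x) eᵢ`. -/
def smoothedFirstVariation (ψ : Euc n → ℝ) (ε : ℝ) (V : VarifoldMeasure d n) (x : Euc n) :
    Euc n :=
  ∫ p, p.2.1 (gradient (truncKernel ψ ε) (p.1 - x)) ∂V

/-- `h̃_ε(y, V) = -(δV ∗ Φ_ε)(y) / ((‖V‖ ∗ Φ_ε)(y) + ε)`. -/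
def preMeanCurvature (ψ : Euc n → ℝ) (ε : ℝ) (V : VarifoldMeasure d n) (y : Euc n) : Euc n :=
  -((smoothedMass ψ ε V y + ε)⁻¹ • smoothedFirstVariation ψ ε V y)

/-- The approximate mean curvature `h_ε(·, V) = Φ_ε ∗ h̃_ε(·, V)`. -/
def approxMeanCurvature (ψ : Euc n → ℝ) (ε : ℝ) (V : VarifoldMeasure d n) (x : Euc n) : Euc n :=
  ∫ y, truncKernel ψ ε (x - y) • preMeanCurvature ψ ε V y

/-- One explicit step of size `τ`: the push-forward of `V` by `id + τ h_ε(·, V)`. -/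
def eulerStep (ψ : Euc n → ℝ) (ε τ : ℝ) (V : VarifoldMeasure d n) : VarifoldMeasure d n :=
  pushForward (fun x => x + τ • approxMeanCurvature ψ ε V x) V

/-- A subdivision `0 = t₀ < t₁ < ⋯ < t_m = 1` of `[0,1]` (the values `t i`, `i > m`, are
irrelevant). -/
structure Subdivision where
  m : ℕ
  t : ℕ → ℝ
  zero_eq : t 0 = 0
  last_eq : t m = 1
  strictMonoOn : StrictMonoOn t (Set.Iic m)

/-- The mesh `δ(𝒯) = max_i (t_i - t_{i-1})`. -/
def Subdivision.mesh (T : Subdivision) : ℝ := ⨆ i : Fin T.m, (T.t (i + 1) - T.t i)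

/-- The time-discrete flow at the times `t_i` of the subdivision. -/
def nodeFlow (ψ : Euc n → ℝ) (ε : ℝ) (T : Subdivision) (V₀ : VarifoldMeasure d n) :
    ℕ → VarifoldMeasure d n
  | 0 => V₀
  | i + 1 => eulerStep ψ ε (T.t (i + 1) - T.t i) (nodeFlow ψ ε T V₀ i)

open scoped Classical in
/-- The time-discrete approximate mean curvature flow `V_{ε,𝒯}(t)`, `t ∈ [0,1]`, starting from
`V₀`: for `t ∈ [t_i, t_{i+1}]` it is the push-forward of `V_{ε,𝒯}(t_i)` by
`id + (t - t_i) h_ε(·, V_{ε,𝒯}(t_i))`. Here `i` is the largest index `i ≤ m - 1` with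
`t_i ≤ t`. -/
def discreteFlow (ψ : Euc n → ℝ) (ε : ℝ) (T : Subdivision) (V₀ : VarifoldMeasure d n) (t : ℝ) :
    VarifoldMeasure d n :=
  let i := Nat.findGreatest (fun i => T.t i ≤ t) (T.m - 1)
  eulerStep ψ ε (t - T.t i) (nodeFlow ψ ε T V₀ i)

/-- `(V t)_{t ∈ [0,1]}` is the approximate mean curvature flow starting from `V₀` at scale `ε`: a
family of varifolds of finite mass that is, at every time, the limit of the time-discrete flows
along every sequence of subdivisions whose mesh tends to zero. -/
structure IsApproxMCF (ψ : Euc n → ℝ) (ε : ℝ) (V₀ : VarifoldMeasure d n)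
    (V : unitInterval → VarifoldMeasure d n) : Prop where
  finite : ∀ t, IsFiniteMeasure (V t)
  tendsto : ∀ T : ℕ → Subdivision, Tendsto (fun j => (T j).mesh) atTop (𝓝 0) →
    ∀ t : unitInterval,
      Tendsto (fun j => bddLipDist (discreteFlow ψ ε (T j) V₀ t) (V t)) atTop (𝓝 0)

end

/-! One Euler step acts on varifolds of mass at most `N`. If the velocity field and its derivative
are bounded and Lipschitz with constant `R`, and depend on the varifold in a Lipschitz way with
constant `D` for the distance Δ, then three facts hold; `VelocityLaw` records exactly the properties
of the velocity that they need.

Stability (`VelocityLaw.bddLipDist_eulerStep_le`): a step of size τ expands Δ by at most `1 + τ *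
rate`. Pushing two measures by one map turns a test function into a test function with constant 1 +
O(τR); pushing one measure by two maps costs O(τ D N) times the distance of the varifolds.

Consistency (`VelocityLaw.bddLipDist_eulerStep_add_le`): one step of size a + σ and two steps of
sizes a, σ differ by O(aσ).

Mass (`VelocityLaw.exists_mass_le`): the first variation of V along h_ε is minus the integral of |δV
∗ Φ_ε|² / (‖V‖ ∗ Φ_ε + ε), hence nonpositive, so a small step raises the mass by at most ητ. With `N
= M + 1` and η = 1 the mass stays below `N` on [0,1], which is where the factor (M + 1)² comes from.

By consistency, a discrete flow restarted from any of its states is, to first order in time, an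
Euler step up to an error proportional to the mesh. The distance between two discrete flows, on
unrelated subdivisions, therefore satisfies a right-derivative inequality, and Grönwall's lemma
bounds it (`bddLipDist_discreteFlow_le_gronwallBound`). For equal initial data this is a Cauchy
estimate; the supports stay in a fixed compact set, so limits exist. For different data, letting the
mesh tend to zero leaves exp(`rate` t).

It remains to count powers of ε. The decisive estimate is |∇Φ_ε| ≤ ε⁻² Φ_ε + C with C independent of
ε (`IsCutoff.kernelBounds`): the gradient of ψ lives where the Gaussian is exponentially small. It
bounds h̃_ε by O(N ε⁻²), and then `rate_le` gives N² ε^(-n-7). -/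

noncomputable section

variable {d n : ℕ}

/-! ### Traces, determinants and orthonormal frames. -/

/-- The matrix of an endomorphism of `ℝⁿ` in the standard basis. -/
def stdMatrix (A : Euc n →L[ℝ] Euc n) : Matrix (Fin n) (Fin n) ℝ :=
  Matrix.of fun i j => A (EuclideanSpace.single j 1) i

lemma stdMatrix_apply (A : Euc n →L[ℝ] Euc n) (i j : Fin n) :
    stdMatrix A i j = A (EuclideanSpace.single j 1) i := rfl

lemma stdMatrix_mulVec (A : Euc n →L[ℝ] Euc n) (x : Euc n) :
    (stdMatrix A).mulVec x.ofLp = (A x).ofLp := by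
  have hx : x = ∑ j, x j • EuclideanSpace.single j (1 : ℝ) := by
    ext i
    simp [Pi.single_apply]
  ext i
  conv_rhs => rw [hx, map_sum]
  simp [Matrix.mulVec, dotProduct, stdMatrix_apply, mul_comm]

@[simp] lemma stdMatrix_one : stdMatrix (1 : Euc n →L[ℝ] Euc n) = 1 := by
  ext i j; simp [stdMatrix_apply, Matrix.one_apply]
@[simp] lemma stdMatrix_mul (A B : Euc n →L[ℝ] Euc n) :
    stdMatrix (A * B) = stdMatrix A * stdMatrix B := by
  ext i j
  rw [stdMatrix_apply, mul_apply_eq_comp, ← stdMatrix_mulVec]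
  rfl
@[simp] lemma stdMatrix_zero : stdMatrix (0 : Euc n →L[ℝ] Euc n) = 0 := by
  ext i j; simp [stdMatrix_apply]
@[simp] lemma stdMatrix_add (A B : Euc n →L[ℝ] Euc n) :
    stdMatrix (A + B) = stdMatrix A + stdMatrix B := by
  ext i j; simp [stdMatrix_apply]
@[simp] lemma stdMatrix_sub (A B : Euc n →L[ℝ] Euc n) :
    stdMatrix (A - B) = stdMatrix A - stdMatrix B := by
  ext i j; simp [stdMatrix_apply]
@[simp] lemma stdMatrix_smul (c : ℝ) (A : Euc n →L[ℝ] Euc n) :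
    stdMatrix (c • A) = c • stdMatrix A := by
  ext i j; simp [stdMatrix_apply]
@[simp] lemma stdMatrix_star (A : Euc n →L[ℝ] Euc n) :
    stdMatrix (star A) = (stdMatrix A).transpose := by
  ext i j
  have := ContinuousLinearMap.adjoint_inner_right A (EuclideanSpace.single i (1 : ℝ))
    (EuclideanSpace.single j (1 : ℝ))
  rw [← ContinuousLinearMap.star_eq_adjoint] at this
  simpa [stdMatrix_apply, EuclideanSpace.inner_single_left, EuclideanSpace.inner_single_right]
    using this

/-- The trace of an endomorphism of `ℝⁿ`. -/
def traceCLM (n : ℕ) : (Euc n →L[ℝ] Euc n) →L[ℝ] ℝ :=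
  LinearMap.toContinuousLinearMap
    { toFun := fun A => (stdMatrix A).trace
      map_add' := by simp
      map_smul' := by simp }

lemma traceCLM_apply (A : Euc n →L[ℝ] Euc n) : traceCLM n A = (stdMatrix A).trace := rfl

lemma traceCLM_mul_comm (A B : Euc n →L[ℝ] Euc n) : traceCLM n (A * B) = traceCLM n (B * A) := by
  rw [traceCLM_apply, traceCLM_apply, stdMatrix_mul, stdMatrix_mul, Matrix.trace_mul_comm]

lemma traceCLM_star (A : Euc n →L[ℝ] Euc n) : traceCLM n (star A) = traceCLM n A := by
  simp [traceCLM_apply]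

/-- The function `X ↦ det (1 + X)^(1/2)` on endomorphisms of `ℝⁿ`. -/
def sqrtDet (X : Euc n →L[ℝ] Euc n) : ℝ := √(1 + stdMatrix X).det

lemma contDiff_det_one_add : ContDiff ℝ 1 fun X : Euc n →L[ℝ] Euc n => (1 + stdMatrix X).det := by
  simp only [Matrix.det_apply, Matrix.add_apply, stdMatrix_apply]
  refine ContDiff.sum fun σ _ => ContDiff.const_smul _ (contDiff_prod fun i _ => ?_)
  have h := ((EuclideanSpace.proj (𝕜 := ℝ) (σ i)).comp (ContinuousLinearMap.apply ℝ (Euc n)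
    (EuclideanSpace.single i (1 : ℝ)))).contDiff (n := 1)
  exact contDiff_const.add h

/-- The determinant is polynomial, hence C¹ and strictly differentiable. The derivative is read off
along the lines t ↦ tM, where det(1 + tM) is a polynomial in t with linear coefficient tr M. -/
lemma hasStrictFDerivAt_det_one_add :
    HasStrictFDerivAt (fun X : Euc n →L[ℝ] Euc n => (1 + stdMatrix X).det) (traceCLM n) 0 := by
  have h := (contDiff_det_one_add (n := n)).contDiffAt.hasStrictFDerivAt (x := 0) one_ne_zero
  suffices e : fderiv ℝ (fun X : Euc n →L[ℝ] Euc n => (1 + stdMatrix X).det) 0 = traceCLM n by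
    rwa [e] at h
  refine DFunLike.ext _ _ fun M => ?_
  set p : Polynomial ℝ := Matrix.det (1 + (Polynomial.X : Polynomial ℝ) • (stdMatrix M).map Polynomial.C)
  have h1 : HasDerivAt (fun t : ℝ => (1 + stdMatrix (t • M)).det) ((stdMatrix M).trace) 0 := by
    have := p.hasDerivAt 0
    rw [Matrix.derivative_det_one_add_X_smul] at this
    have e : (fun t : ℝ => (1 + stdMatrix (t • M)).det) = fun t => p.eval t := ?_
    · rw [e]; exact this
    ext t
    rw [← Polynomial.coe_evalRingHom, RingHom.map_det]
    congr 1
    ext i j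
    simp [Matrix.one_apply, apply_ite]
    exact mul_comm _ _
  have h2 : HasDerivAt (fun t : ℝ => (1 + stdMatrix (t • M)).det)
      (fderiv ℝ (fun X : Euc n →L[ℝ] Euc n => (1 + stdMatrix X).det) 0 M) 0 := by
    have hl : HasDerivAt (fun t : ℝ => t • M) M 0 := by
      simpa using (hasDerivAt_id (0 : ℝ)).smul_const M
    have h' := h.hasFDerivAt
    exact HasFDerivAt.comp_hasDerivAt_of_eq (0 : ℝ) h' hl (zero_smul ℝ M).symm
  exact h2.unique h1

lemma hasStrictFDerivAt_sqrtDet :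
    HasStrictFDerivAt (sqrtDet (n := n)) ((1 / 2 : ℝ) • traceCLM n) 0 := by
  have h := (hasStrictFDerivAt_det_one_add (n := n)).sqrt (by simp)
  have e : 1 / (2 * √(1 + stdMatrix (0 : Euc n →L[ℝ] Euc n)).det) = 1 / 2 := by simp
  rw [e] at h
  exact h

lemma continuous_sqrtDet : Continuous (sqrtDet (n := n)) :=
  Real.continuous_sqrt.comp contDiff_det_one_add.continuous

@[simp] lemma sqrtDet_zero : sqrtDet (0 : Euc n →L[ℝ] Euc n) = 1 := by
  simp [sqrtDet]

/-- `A` is the matrix whose columns form an orthonormal basis of the subspace `S`. -/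
structure IsFrame {ι : Type*} [Fintype ι] [DecidableEq ι] (S : Euc n →L[ℝ] Euc n)
    (U : Matrix (Fin n) ι ℝ) : Prop where
  transpose_mul : U.transpose * U = 1
  mul_transpose : U * U.transpose = stdMatrix S

lemma isFrame_stdOrthonormalBasis (S : Grassmannian d n) :
    IsFrame S.1 (Matrix.of fun i j =>
      ((stdOrthonormalBasis ℝ S.1.range j : S.1.range) : Euc n).ofLp i) := by
  set b := stdOrthonormalBasis ℝ S.1.range
  constructor
  · ext i j
    have := orthonormal_iff_ite.1 b.orthonormal i j
    rw [Submodule.coe_inner, PiLp.inner_apply] at this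
    simp only [Matrix.mul_apply, Matrix.transpose_apply, Matrix.of_apply, Matrix.one_apply]
    rw [← this]
    exact Finset.sum_congr rfl fun k _ => by simp [mul_comm]
  · ext i j
    have hS : S.1 = S.1.range.starProjection :=
      isStarProjection_iff_eq_starProjection_range.1 S.2.1 |>.choose_spec
    have h2 := b.starProjection_eq_sum_rankOne
    rw [stdMatrix_apply, congrArg (fun T : Euc n →L[ℝ] Euc n =>
      (T (EuclideanSpace.single j 1)).ofLp i) (hS.trans h2)]
    simp [Matrix.mul_apply, EuclideanSpace.inner_single_right, mul_comm]

/-- Every plane has a frame indexed by `Fin d`. -/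
lemma exists_isFrame (S : Grassmannian d n) :
    ∃ U : Matrix (Fin n) (Fin d) ℝ, IsFrame S.1 U := by
  have h := isFrame_stdOrthonormalBasis S
  revert h
  -- The standard basis is indexed by `Fin` of the rank of `S`; forgetting its origin allows the
  -- rank to be rewritten to `d`.
  generalize (Matrix.of fun i j =>
      ((stdOrthonormalBasis ℝ S.1.range j : S.1.range) : Euc n).ofLp i) = U
  revert U
  rw [S.2.2]
  exact fun U h => ⟨U, h⟩

/-- The expression of the tangential Jacobian in a frame; by the Weinstein-Aronszajn identity it
does not depend on the frame. -/
lemma IsFrame.sqrt_det {ι : Type*} [Fintype ι] [DecidableEq ι] {S : Euc n →L[ℝ] Euc n}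
    {U : Matrix (Fin n) ι ℝ} (h : IsFrame S U) (A : Euc n →L[ℝ] Euc n) :
    √(U.transpose * (stdMatrix A).transpose * stdMatrix A * U).det =
      sqrtDet (S * (star A * A - 1) * S) := by
  rw [sqrtDet]
  congr 1
  set a := stdMatrix A
  have e : stdMatrix (S * (star A * A - 1) * S) =
      U * (U.transpose * (a.transpose * a - 1) * (U * U.transpose)) := by
    simp [h.mul_transpose, ← Matrix.mul_assoc, a]
  rw [e, Matrix.det_one_add_mul_comm]
  congr 1
  have : U.transpose * (a.transpose * a - 1) * (U * U.transpose) * U =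
      U.transpose * (a.transpose * a) * U * (U.transpose * U) - U.transpose * U * (U.transpose * U) := by
    simp only [Matrix.mul_sub, Matrix.sub_mul, Matrix.mul_one, Matrix.mul_assoc]
  rw [this, h.transpose_mul]
  simp [Matrix.mul_assoc]

/-- This removes the choice of a basis, which does not vary continuously with the plane: the
Jacobian becomes a fixed function, smooth near 0, of an expression polynomial in `S.1`, `A` and
`star A`. -/
lemma tangentialJacobian_eq_sqrtDet (A : Euc n →L[ℝ] Euc n) (S : Grassmannian d n) :
    tangentialJacobian A S = sqrtDet (S.1 * (star A * A - 1) * S.1) := by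
  rw [← (isFrame_stdOrthonormalBasis S).sqrt_det A, tangentialJacobian]
  congr 2
  ext i j
  set b := stdOrthonormalBasis ℝ S.1.range
  have key : ∀ j, (fun i => (stdMatrix A * (Matrix.of fun i j => ((b j : S.1.range) : Euc n).ofLp i)) i j) =
      (A (b j : Euc n)).ofLp := fun j => by
    rw [← stdMatrix_mulVec]; rfl
  rw [Matrix.mul_assoc, ← Matrix.transpose_mul, Matrix.mul_apply, Matrix.gram_apply,
    PiLp.inner_apply]
  refine Finset.sum_congr rfl fun k _ => ?_
  have h1 := congrFun (key i) k
  have h2 := congrFun (key j) k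
  simp only [Matrix.transpose_apply] at h1 h2 ⊢
  rw [h1, h2]
  simp [mul_comm]

lemma tangentialJacobian_nonneg (A : Euc n →L[ℝ] Euc n) (S : Grassmannian d n) :
    0 ≤ tangentialJacobian A S := Real.sqrt_nonneg _

/-! ### Planes as projections, image planes, and the chain rule for the Jacobian. -/

lemma Grassmannian.norm_le (S : Grassmannian d n) : ‖S.1‖ ≤ 1 :=
  IsStarProjection.norm_le (S.1) S.2.1

lemma Grassmannian.norm_apply_le (S : Grassmannian d n) (x : Euc n) : ‖S.1 x‖ ≤ ‖x‖ := by
  simpa using S.1.le_of_opNorm_le S.norm_le x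

lemma Grassmannian.mul_self (S : Grassmannian d n) : S.1 * S.1 = S.1 :=
  S.2.1.isIdempotentElem.eq

lemma Grassmannian.apply_apply (S : Grassmannian d n) (x : Euc n) : S.1 (S.1 x) = S.1 x :=
  congrArg (fun T : Euc n →L[ℝ] Euc n => T x) S.mul_self

lemma Grassmannian.inner_apply (S : Grassmannian d n) (x y : Euc n) :
    inner ℝ (S.1 x) y = inner ℝ x (S.1 y) := by
  rw [← ContinuousLinearMap.adjoint_inner_right, ← ContinuousLinearMap.star_eq_adjoint,
    S.2.1.isSelfAdjoint.star_eq]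

lemma Grassmannian.apply_of_mem (S : Grassmannian d n) {x : Euc n} (hx : x ∈ S.1.range) :
    S.1 x = x := by
  obtain ⟨y, rfl⟩ := hx
  exact S.apply_apply y

lemma Grassmannian.ext_range {S T : Grassmannian d n} (h : S.1.range = T.1.range) : S = T := by
  have hS := (isStarProjection_iff_eq_starProjection_range.1 S.2.1).choose_spec
  have hT := (isStarProjection_iff_eq_starProjection_range.1 T.2.1).choose_spec
  apply Subtype.ext
  rw [hS, hT]
  congr 1

lemma Grassmannian.norm_sq_add (S : Grassmannian d n) (x : Euc n) :
    ‖S.1 x‖ ^ 2 + ‖x - S.1 x‖ ^ 2 = ‖x‖ ^ 2 := by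
  have h : inner ℝ (S.1 x) (x - S.1 x) = 0 := by
    rw [S.inner_apply, map_sub, S.apply_apply, sub_self, inner_zero_right]
  have := norm_add_sq_eq_norm_sq_add_norm_sq_of_inner_eq_zero (S.1 x) (x - S.1 x) h
  rw [add_sub_cancel] at this
  nlinarith

/-- Two planes that are close as sets, in the sense of angles, are close as projections. -/
lemma Grassmannian.norm_sub_le {P Q : Grassmannian d n} {κ : ℝ} (hκ : 0 ≤ κ)
    (hP : ∀ v ∈ P.1.range, ‖v - Q.1 v‖ ≤ κ * ‖v‖) (hQ : ∀ v ∈ Q.1.range, ‖v - P.1 v‖ ≤ κ * ‖v‖) :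
    ‖P.1 - Q.1‖ ≤ κ := by
  refine ContinuousLinearMap.opNorm_le_bound _ hκ fun x => ?_
  -- P(1 - Q) is the adjoint of (1 - Q)P, and `hP` bounds the latter by κ.
  have h1 : ∀ y, ‖P.1 (y - Q.1 y)‖ ≤ κ * ‖y‖ := by
    intro y
    have h0 : ‖P.1 (y - Q.1 y)‖ ^ 2 ≤ ‖y‖ * (κ * ‖P.1 (y - Q.1 y)‖) := by
      set w := P.1 (y - Q.1 y) with hw
      have hwP : w ∈ P.1.range := ⟨_, rfl⟩
      calc ‖w‖ ^ 2 = inner ℝ (P.1 (y - Q.1 y)) w := (real_inner_self_eq_norm_sq _).symm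
        _ = inner ℝ (y - Q.1 y) w := by rw [P.inner_apply, P.apply_of_mem hwP]
        _ = inner ℝ y (w - Q.1 w) := by
          rw [inner_sub_left, inner_sub_right, Q.inner_apply]
        _ ≤ ‖y‖ * ‖w - Q.1 w‖ := real_inner_le_norm _ _
        _ ≤ _ := by gcongr; exact hP w hwP
    rcases (norm_nonneg (P.1 (y - Q.1 y))).eq_or_lt with h | h
    · rw [← h]; positivity
    · nlinarith
  -- The two summands P(1 - Q)x and -(1 - P)Qx are orthogonal, so Pythagoras gives the constant κ
  -- and not 2κ. The sharp constant matters: it later gives Lipschitz factors of the form 1 + O(τ).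
  have h2 : (P.1 - Q.1) x = P.1 (x - Q.1 x) + -(Q.1 x - P.1 (Q.1 x)) := by
    simp
  have h3 : inner ℝ (P.1 (x - Q.1 x)) (-(Q.1 x - P.1 (Q.1 x))) = 0 := by
    rw [P.inner_apply]
    simp [P.apply_apply]
  have h4 := norm_add_sq_eq_norm_sq_add_norm_sq_of_inner_eq_zero _ _ h3
  rw [← h2, norm_neg] at h4
  have h5 : ‖P.1 (x - Q.1 x)‖ ≤ κ * ‖x - Q.1 x‖ := by
    have := h1 (x - Q.1 x)
    rwa [map_sub Q.1, Q.apply_apply, sub_self, sub_zero] at this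
  have h6 : ‖Q.1 x - P.1 (Q.1 x)‖ ≤ κ * ‖Q.1 x‖ := hQ _ ⟨x, rfl⟩
  have h7 := Q.norm_sq_add x
  refine le_of_sq_le_sq ?_ (by positivity)
  have h8 := mul_self_le_mul_self (norm_nonneg _) h5
  have h9 := mul_self_le_mul_self (norm_nonneg _) h6
  rw [mul_pow, ← h7]
  nlinarith

lemma finrank_map_range_of_injective {A : Euc n →L[ℝ] Euc n} (hA : Function.Injective A)
    (S : Grassmannian d n) :
    Module.finrank ℝ (S.1.range.map (A : Euc n →ₗ[ℝ] Euc n)) = d :=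
  ((Submodule.equivMapOfInjective (A : Euc n →ₗ[ℝ] Euc n) hA S.1.range).finrank_eq).symm.trans S.2.2

/-- Injectivity keeps the dimension equal to `d`, which rules out the default branch of
`imagePlane`. -/
lemma imagePlane_range {A : Euc n →L[ℝ] Euc n} (hA : Function.Injective A)
    (S : Grassmannian d n) :
    (imagePlane A S).1.range = S.1.range.map (A : Euc n →ₗ[ℝ] Euc n) := by
  rw [imagePlane, dif_pos (finrank_map_range_of_injective hA S)]
  exact Submodule.range_starProjection _

lemma imagePlane_mul {A B : Euc n →L[ℝ] Euc n} (hA : Function.Injective A)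
    (hB : Function.Injective B) (S : Grassmannian d n) :
    imagePlane (B * A) S = imagePlane B (imagePlane A S) := by
  have hBA : Function.Injective (B * A : Euc n →L[ℝ] Euc n) := fun x y h => hA (hB h)
  apply Grassmannian.ext_range
  rw [imagePlane_range hBA, imagePlane_range hB, imagePlane_range hA, ← Submodule.map_comp]
  rfl

@[simp] lemma imagePlane_one (S : Grassmannian d n) : imagePlane 1 S = S := by
  apply Grassmannian.ext_range
  rw [imagePlane_range (fun _ _ h => h)]
  exact Submodule.map_id _

/-- The chain rule for the tangential Jacobian. -/
lemma tangentialJacobian_mul {A : Euc n →L[ℝ] Euc n} (hA : Function.Injective A)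
    (B : Euc n →L[ℝ] Euc n) (S : Grassmannian d n) :
    tangentialJacobian (B * A) S =
      tangentialJacobian B (imagePlane A S) * tangentialJacobian A S := by
  obtain ⟨U, hU⟩ := exists_isFrame S
  obtain ⟨Q, hQ⟩ := exists_isFrame (imagePlane A S)
  simp only [tangentialJacobian_eq_sqrtDet, ← hU.sqrt_det, ← hQ.sqrt_det, stdMatrix_mul]
  set a := stdMatrix A
  set b := stdMatrix B
  have h1 : (imagePlane A S).1 * (A * S.1) = A * S.1 := by
    ext x : 1
    apply (imagePlane A S).apply_of_mem
    rw [imagePlane_range hA]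
    exact ⟨S.1 x, ⟨x, rfl⟩, rfl⟩
  have h2 : Q * Q.transpose * (a * U) = a * U := by
    have := congrArg stdMatrix h1
    simp only [stdMatrix_mul, ← hU.mul_transpose, ← hQ.mul_transpose] at this
    have := congrArg (· * U) this
    simpa only [Matrix.mul_assoc, hU.transpose_mul, Matrix.mul_one] using this
  -- Both frames are indexed by `Fin d`, so `R` is a square matrix. It is the matrix of `A` from `S`
  -- to its image, and its determinant can be split off.
  set R := Q.transpose * (a * U) with hR
  have h3 : a * U = Q * R := by rw [hR, ← Matrix.mul_assoc, h2]
  have h4 : U.transpose * a.transpose = R.transpose * Q.transpose := by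
    rw [← Matrix.transpose_mul, h3, Matrix.transpose_mul]
  have h5 : U.transpose * a.transpose * a * U = R.transpose * R := by
    rw [Matrix.mul_assoc, h3, h4, Matrix.mul_assoc, ← Matrix.mul_assoc Q.transpose,
      hQ.transpose_mul, Matrix.one_mul]
  have h6 : U.transpose * (b * a).transpose * (b * a) * U =
      R.transpose * (Q.transpose * b.transpose * b * Q) * R := by
    have : U.transpose * (b * a).transpose * (b * a) * U =
        (U.transpose * a.transpose) * (b.transpose * b) * (a * U) := by
      simp only [Matrix.transpose_mul, Matrix.mul_assoc]
    rw [this, h4, h3]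
    simp only [Matrix.mul_assoc]
  rw [h5, h6, Matrix.det_mul, Matrix.det_mul, Matrix.det_mul, Matrix.det_transpose,
    mul_comm (R.det), mul_assoc, Real.sqrt_mul]
  rw [Matrix.mul_assoc, ← Matrix.transpose_mul, ← Matrix.conjTranspose_eq_transpose_of_trivial]
  exact (Matrix.posSemidef_conjTranspose_mul_self _).det_nonneg

@[simp] lemma tangentialJacobian_one (S : Grassmannian d n) : tangentialJacobian 1 S = 1 := by
  rw [tangentialJacobian_eq_sqrtDet]
  simp

/-! ### Image planes and tangential Jacobians near the identity. -/

/-- It uses ‖(1 + B)x‖ ≥ (1 - b)‖x‖ and (1 + 2b)(1 - b) ≥ 1 for b = ‖B‖ ≤ 1/2. -/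
lemma norm_le_two_mul_norm_one_add_apply {B : Euc n →L[ℝ] Euc n} (hB : ‖B‖ ≤ 1 / 2) (x : Euc n) :
    ‖x‖ ≤ (1 + 2 * ‖B‖) * ‖(1 + B) x‖ := by
  have h1 : ‖x‖ ≤ ‖(1 + B) x‖ + ‖B x‖ := by
    have : x = (1 + B) x - B x := by simp
    calc ‖x‖ = ‖(1 + B) x - B x‖ := by rw [← this]
      _ ≤ _ := norm_sub_le _ _
  have h2 := B.le_opNorm x
  have h3 : 0 ≤ ‖B‖ * (1 - 2 * ‖B‖) * ‖x‖ :=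
    mul_nonneg (mul_nonneg (norm_nonneg _) (by linarith)) (norm_nonneg _)
  have h4 : 0 ≤ (1 + 2 * ‖B‖) * (‖(1 + B) x‖ - (1 - ‖B‖) * ‖x‖) :=
    mul_nonneg (by positivity) (by linarith)
  linarith

lemma injective_one_add {B : Euc n →L[ℝ] Euc n} (hB : ‖B‖ ≤ 1 / 2) :
    Function.Injective (1 + B : Euc n →L[ℝ] Euc n) := by
  rw [injective_iff_map_eq_zero]
  intro x hx
  have := norm_le_two_mul_norm_one_add_apply hB x
  rw [hx] at this
  simpa using this

/-- Write v = (1 + B')w with w in `T`. The projection onto the image of `S` is at least as close to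
v as the competitor u = (1 + B)(S w), and v - u is explicit. -/
lemma norm_sub_imagePlane_apply_le {B B' : Euc n →L[ℝ] Euc n} {r : ℝ} (hr : r ≤ 1 / 2)
    (hB : ‖B‖ ≤ r) (hB' : ‖B'‖ ≤ r) (S T : Grassmannian d n) {v : Euc n}
    (hv : v ∈ (imagePlane (1 + B') T).1.range) :
    ‖v - (imagePlane (1 + B) S).1 v‖ ≤
      ((1 + 4 * r) * ‖S.1 - T.1‖ + 2 * ‖B - B'‖) * ‖v‖ := by
  have hr0 : 0 ≤ r := (norm_nonneg _).trans hB
  rw [imagePlane_range (injective_one_add (hB'.trans hr))] at hv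
  obtain ⟨w, hwT, hw⟩ := hv
  have hw' : (1 + B') w = v := hw
  set P := imagePlane (1 + B) S
  set u := (1 + B) (S.1 w)
  have huP : P.1 u = u := by
    apply P.apply_of_mem
    rw [imagePlane_range (injective_one_add (hB.trans hr))]
    exact ⟨S.1 w, ⟨w, rfl⟩, rfl⟩
  have h1 : ‖v - P.1 v‖ ≤ ‖v - u‖ := by
    have h := P.norm_sq_add (v - u)
    rw [map_sub, huP] at h
    rw [show v - u - (P.1 v - u) = v - P.1 v by abel] at h
    refine le_of_sq_le_sq ?_ (norm_nonneg _)
    nlinarith [sq_nonneg ‖P.1 v - u‖]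
  have h2 : v - u = (B' - B) w + (1 + B) ((T.1 - S.1) w) := by
    rw [← hw', sub_apply T.1, T.apply_of_mem hwT]
    simp [u]
    abel
  have h3 : ‖v - u‖ ≤ (‖B - B'‖ + (1 + r) * ‖S.1 - T.1‖) * ‖w‖ := by
    rw [h2]
    have a1 := (B' - B).le_opNorm w
    have a2 : ‖(1 + B) ((T.1 - S.1) w)‖ ≤ (1 + r) * (‖T.1 - S.1‖ * ‖w‖) := by
      have b1 : ‖(1 + B : Euc n →L[ℝ] Euc n)‖ ≤ 1 + r :=
        (norm_add_le _ _).trans (add_le_add ContinuousLinearMap.norm_id_le hB)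
      exact ((1 + B).le_opNorm _).trans (mul_le_mul b1 ((T.1 - S.1).le_opNorm w)
        (norm_nonneg _) (by positivity))
    rw [norm_sub_rev B', ] at a1
    rw [norm_sub_rev T.1] at a2
    refine (norm_add_le _ _).trans ?_
    linarith
  have h4 : ‖w‖ ≤ (1 + 2 * r) * ‖v‖ := by
    have := norm_le_two_mul_norm_one_add_apply (hB'.trans hr) w
    rw [hw'] at this
    refine this.trans ?_
    gcongr
  calc ‖v - P.1 v‖ ≤ _ := h1.trans h3
    _ ≤ (‖B - B'‖ + (1 + r) * ‖S.1 - T.1‖) * ((1 + 2 * r) * ‖v‖) := by gcongr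
    _ = (‖B - B'‖ * (1 + 2 * r) + ((1 + r) * (1 + 2 * r)) * ‖S.1 - T.1‖) * ‖v‖ := by ring
    _ ≤ (‖B - B'‖ * 2 + (1 + 4 * r) * ‖S.1 - T.1‖) * ‖v‖ := by
      gcongr
      · linarith
      · nlinarith
    _ = _ := by ring

/-- The image plane depends in a Lipschitz way on the plane and on the linear map. -/
lemma norm_imagePlane_sub_le {B B' : Euc n →L[ℝ] Euc n} {r : ℝ} (hr : r ≤ 1 / 2)
    (hB : ‖B‖ ≤ r) (hB' : ‖B'‖ ≤ r) (S T : Grassmannian d n) :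
    ‖(imagePlane (1 + B) S).1 - (imagePlane (1 + B') T).1‖ ≤
      (1 + 4 * r) * ‖S.1 - T.1‖ + 2 * ‖B - B'‖ := by
  have hr0 : 0 ≤ r := (norm_nonneg _).trans hB
  refine Grassmannian.norm_sub_le (by positivity) (fun v hv => ?_) fun v hv => ?_
  · rw [norm_sub_rev S.1, norm_sub_rev B]
    exact norm_sub_imagePlane_apply_le hr hB' hB T S hv
  · exact norm_sub_imagePlane_apply_le hr hB hB' S T hv

lemma star_add_clm (A B : Euc n →L[ℝ] Euc n) : star (A + B) = star A + star B :=
  map_add ContinuousLinearMap.adjoint A B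

lemma star_sub_clm (A B : Euc n →L[ℝ] Euc n) : star (A - B) = star A - star B :=
  map_sub ContinuousLinearMap.adjoint A B

lemma norm_star_clm (A : Euc n →L[ℝ] Euc n) : ‖star A‖ = ‖A‖ :=
  ContinuousLinearMap.adjoint.norm_map A

/-- The deviation of `Aᵀ A` from the identity, for `A = 1 + B`. -/
def metricDeviation (B : Euc n →L[ℝ] Euc n) : Euc n →L[ℝ] Euc n := star (1 + B) * (1 + B) - 1

lemma metricDeviation_eq (B : Euc n →L[ℝ] Euc n) :
    metricDeviation B = star B + B + star B * B := by
  rw [metricDeviation, star_add_clm, star_one]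
  noncomm_ring

lemma norm_metricDeviation_le {B : Euc n →L[ℝ] Euc n} (hB : ‖B‖ ≤ 1) :
    ‖metricDeviation B‖ ≤ 3 * ‖B‖ := by
  rw [metricDeviation_eq]
  have h1 := norm_add₃_le (a := star B) (b := B) (c := star B * B)
  have h2 := norm_mul_le (star B) B
  rw [norm_star_clm] at h1 h2
  nlinarith [norm_nonneg B]

lemma norm_metricDeviation_sub_le {B B' : Euc n →L[ℝ] Euc n} (hB : ‖B‖ ≤ 1) (hB' : ‖B'‖ ≤ 1) :
    ‖metricDeviation B - metricDeviation B'‖ ≤ 4 * ‖B - B'‖ := by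
  have e : metricDeviation B - metricDeviation B' =
      star (B - B') + (B - B') + (star (B - B') * B + star B' * (B - B')) := by
    rw [metricDeviation_eq, metricDeviation_eq, star_sub_clm]
    simp only [mul_sub, sub_mul]
    abel
  rw [e]
  have h1 := norm_add₃_le (a := star (B - B')) (b := B - B')
    (c := star (B - B') * B + star B' * (B - B'))
  have h2 := norm_add_le (star (B - B') * B) (star B' * (B - B'))
  have h3 := norm_mul_le (star (B - B')) B
  have h4 := norm_mul_le (star B') (B - B')
  rw [norm_star_clm] at h1 h3 h4
  nlinarith [norm_nonneg (B - B')]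

lemma tangentialJacobian_one_add (B : Euc n →L[ℝ] Euc n) (S : Grassmannian d n) :
    tangentialJacobian (1 + B) S = sqrtDet (S.1 * metricDeviation B * S.1) :=
  tangentialJacobian_eq_sqrtDet _ _

lemma Grassmannian.norm_mul_mul_le (S T : Grassmannian d n) (X : Euc n →L[ℝ] Euc n) :
    ‖S.1 * X * T.1‖ ≤ ‖X‖ := by
  calc ‖S.1 * X * T.1‖ ≤ ‖S.1‖ * ‖X‖ * ‖T.1‖ := norm_mul₃_le
    _ ≤ 1 * ‖X‖ * 1 := by
      gcongr
      exacts [S.norm_le, T.norm_le]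
    _ = _ := by ring

/-- Lipschitz dependence of the tangential Jacobian of `1 + B` on the plane and on small `B`. -/
lemma exists_tangentialJacobian_bounds (n : ℕ) :
    ∃ r₀ : ℝ, 0 < r₀ ∧ r₀ ≤ 1 / 2 ∧ ∃ C : ℝ, 1 ≤ C ∧ ∀ (d : ℕ) (S T : Grassmannian d n)
      (B B' : Euc n →L[ℝ] Euc n) (r : ℝ), r ≤ r₀ → ‖B‖ ≤ r → ‖B'‖ ≤ r →
      |tangentialJacobian (1 + B) S - tangentialJacobian (1 + B') T| ≤
        C * (‖B - B'‖ + r * ‖S.1 - T.1‖) ∧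
      |tangentialJacobian (1 + B) S - 1| ≤ C * r := by
  obtain ⟨K, s, hs, hK⟩ := (hasStrictFDerivAt_sqrtDet (n := n)).exists_lipschitzOnWith
  obtain ⟨ρ, hρ, hρs⟩ := Metric.mem_nhds_iff.1 hs
  -- The deviation has norm at most 3r ≤ 3ρ/4, so it stays in the neighbourhood where `sqrtDet` is
  -- Lipschitz.
  refine ⟨min (1 / 2) (ρ / 4), by positivity, min_le_left _ _, 6 * K + 1, by simp, ?_⟩
  intro d S T B B' r hr hB hB'
  have hr0 : 0 ≤ r := (norm_nonneg _).trans hB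
  have hr1 : r ≤ 1 / 2 := hr.trans (min_le_left _ _)
  have hr2 : r ≤ ρ / 4 := hr.trans (min_le_right _ _)
  have mem : ∀ (P : Grassmannian d n) (A : Euc n →L[ℝ] Euc n), ‖A‖ ≤ r →
      P.1 * metricDeviation A * P.1 ∈ s := by
    intro P A hA
    apply hρs
    rw [mem_ball_zero_iff]
    have := (P.norm_mul_mul_le P _).trans (norm_metricDeviation_le (hA.trans (hr1.trans (by norm_num))))
    linarith
  have dl : ∀ X ∈ s, ∀ Y ∈ s, |sqrtDet X - sqrtDet Y| ≤ K * ‖X - Y‖ := by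
    intro X hX Y hY
    simpa [dist_eq_norm] using hK.dist_le_mul X hX Y hY
  constructor
  · rw [tangentialJacobian_one_add, tangentialJacobian_one_add]
    refine (dl _ (mem S B hB) _ (mem T B' hB')).trans ?_
    -- Changing the plane costs ‖S - T‖ times the size of the deviation. This puts the small factor
    -- `r` in front of ‖S - T‖.
    have e : S.1 * metricDeviation B * S.1 - T.1 * metricDeviation B' * T.1 =
        S.1 * (metricDeviation B - metricDeviation B') * S.1 +
          ((S.1 - T.1) * metricDeviation B' * S.1 + T.1 * metricDeviation B' * (S.1 - T.1)) := by
      simp only [mul_sub, sub_mul]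
      abel
    have h1 := (S.norm_mul_mul_le S (metricDeviation B - metricDeviation B')).trans
      (norm_metricDeviation_sub_le (hB.trans (hr1.trans (by norm_num)))
        (hB'.trans (hr1.trans (by norm_num))))
    have h0 : ‖metricDeviation B'‖ ≤ 3 * r :=
      (norm_metricDeviation_le (hB'.trans (hr1.trans (by norm_num)))).trans (by linarith)
    have h2 : ‖(S.1 - T.1) * metricDeviation B' * S.1‖ ≤ ‖S.1 - T.1‖ * (3 * r) * 1 :=
      norm_mul₃_le.trans (by gcongr; exact S.norm_le)
    have h3 : ‖T.1 * metricDeviation B' * (S.1 - T.1)‖ ≤ 1 * (3 * r) * ‖S.1 - T.1‖ :=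
      norm_mul₃_le.trans (by gcongr; exact T.norm_le)
    have h4 : ‖S.1 * metricDeviation B * S.1 - T.1 * metricDeviation B' * T.1‖ ≤
        6 * (‖B - B'‖ + r * ‖S.1 - T.1‖) := by
      rw [e]
      refine (norm_add_le _ _).trans ?_
      have := norm_add_le ((S.1 - T.1) * metricDeviation B' * S.1)
        (T.1 * metricDeviation B' * (S.1 - T.1))
      linarith [norm_nonneg (B - B')]
    calc (K : ℝ) * _ ≤ K * (6 * (‖B - B'‖ + r * ‖S.1 - T.1‖)) := by gcongr
      _ ≤ (6 * K + 1) * (‖B - B'‖ + r * ‖S.1 - T.1‖) := by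
        have : 0 ≤ ‖B - B'‖ + r * ‖S.1 - T.1‖ := by positivity
        linarith
  · have h := dl _ (mem S B hB) _ (mem_of_mem_nhds hs)
    rw [sub_zero, sqrtDet_zero] at h
    rw [tangentialJacobian_one_add]
    refine h.trans ?_
    have := (S.norm_mul_mul_le S _).trans (norm_metricDeviation_le (hB.trans (hr1.trans (by norm_num))))
    calc (K : ℝ) * _ ≤ K * (3 * r) := by gcongr; linarith
      _ ≤ (6 * K + 1) * r := by nlinarith [K.2, mul_nonneg K.2 hr0]

/-- First order expansion of the tangential Jacobian of `1 + B`: the linear term is `tr (S B)`. -/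
lemma exists_tangentialJacobian_le (n : ℕ) {η : ℝ} (hη : 0 < η) :
    ∃ r : ℝ, 0 < r ∧ ∀ (d : ℕ) (S : Grassmannian d n) (B : Euc n →L[ℝ] Euc n), ‖B‖ ≤ r →
      tangentialJacobian (1 + B) S ≤ 1 + traceCLM n (S.1 * B) + η * ‖B‖ := by
  have h := (hasStrictFDerivAt_sqrtDet (n := n)).hasFDerivAt.isLittleO
  -- The error is shared equally: the remainder of `sqrtDet` gives (η/6) · 3‖B‖, and half of the
  -- quadratic term tr(S Bᵗ B) gives η‖B‖/2 once ‖B‖ ≤ η/(t + 1).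
  have h' := h.def (c := η / 6) (by positivity)
  obtain ⟨ρ, hρ, hρs⟩ := Metric.eventually_nhds_iff.1 h'
  set t := ‖traceCLM n‖
  refine ⟨min 1 (min (ρ / 4) (η / (t + 1))), by positivity, fun d S B hB => ?_⟩
  have hB1 : ‖B‖ ≤ 1 := hB.trans (min_le_left _ _)
  have hB2 : ‖B‖ ≤ ρ / 4 := hB.trans ((min_le_right _ _).trans (min_le_left _ _))
  have hB3 : ‖B‖ ≤ η / (t + 1) := hB.trans ((min_le_right _ _).trans (min_le_right _ _))
  have hX : ‖S.1 * metricDeviation B * S.1‖ ≤ 3 * ‖B‖ :=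
    (S.norm_mul_mul_le S _).trans (norm_metricDeviation_le hB1)
  have h1 := @hρs (S.1 * metricDeviation B * S.1) (by rw [dist_zero_right]; linarith)
  rw [sub_zero, sqrtDet_zero] at h1
  have h2 := (le_abs_self _).trans h1
  have h3 : traceCLM n (S.1 * metricDeviation B * S.1) =
      2 * traceCLM n (S.1 * B) + traceCLM n (S.1 * (star B * B)) := by
    rw [traceCLM_mul_comm, ← mul_assoc, S.mul_self, metricDeviation_eq, mul_add, mul_add, map_add,
      map_add, ← traceCLM_star (S.1 * star B), star_mul, star_star, S.2.1.isSelfAdjoint.star_eq,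
      traceCLM_mul_comm B]
    ring
  have h4 : traceCLM n (S.1 * (star B * B)) ≤ η * ‖B‖ := by
    have a1 := (le_abs_self _).trans ((traceCLM n).le_opNorm (S.1 * (star B * B)))
    have a2 : ‖S.1 * (star B * B)‖ ≤ 1 * (‖B‖ * ‖B‖) := by
      refine (norm_mul_le _ _).trans ?_
      gcongr
      · exact S.norm_le
      · exact (norm_mul_le _ _).trans (by rw [norm_star_clm])
    have a3 : t * ‖B‖ ≤ η := by
      have := (le_div_iff₀ (by positivity)).1 hB3
      nlinarith [norm_nonneg B]
    calc _ ≤ t * (1 * (‖B‖ * ‖B‖)) := a1.trans (by gcongr)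
      _ = (t * ‖B‖) * ‖B‖ := by ring
      _ ≤ _ := by gcongr
  rw [tangentialJacobian_one_add]
  simp only [smul_apply, smul_eq_mul, h3] at h2
  nlinarith

/-! ### The bounded Lipschitz distance. -/

/-- The test functions in the definition of the bounded Lipschitz distance, with bound and
Lipschitz constant `L`. -/
structure IsLipTest (L : ℝ) (φ : Euc n × Grassmannian d n → ℝ) : Prop where
  nonneg : ∀ p, 0 ≤ φ p
  le : ∀ p, φ p ≤ L
  lip : ∀ p q, |φ p - φ q| ≤ L * (‖p.1 - q.1‖ + ‖p.2.1 - q.2.1‖)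

lemma continuous_of_abs_sub_le {φ : Euc n × Grassmannian d n → ℝ} {L : ℝ}
    (h : ∀ p q, |φ p - φ q| ≤ L * (‖p.1 - q.1‖ + ‖p.2.1 - q.2.1‖)) : Continuous φ := by
  rw [continuous_iff_continuousAt]
  intro q
  rw [ContinuousAt, tendsto_iff_dist_tendsto_zero]
  refine squeeze_zero (fun _ => dist_nonneg) (fun p => h p q) ?_
  have : Continuous fun p : Euc n × Grassmannian d n =>
      L * (‖p.1 - q.1‖ + ‖p.2.1 - q.2.1‖) := by fun_prop
  simpa using this.tendsto q

lemma IsLipTest.continuous {L : ℝ} {φ : Euc n × Grassmannian d n → ℝ} (h : IsLipTest L φ) :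
    Continuous φ := continuous_of_abs_sub_le h.lip

lemma integrable_of_continuous_of_abs_le (V : VarifoldMeasure d n) [IsFiniteMeasure V]
    {E : Type*} [NormedAddCommGroup E] [SecondCountableTopology E]
    {φ : Euc n × Grassmannian d n → E} (hc : Continuous φ) {c : ℝ} (h : ∀ p, ‖φ p‖ ≤ c) :
    Integrable φ V :=
  Integrable.of_bound hc.aestronglyMeasurable c (Eventually.of_forall h)

lemma IsLipTest.integrable {L : ℝ} {φ : Euc n × Grassmannian d n → ℝ} (h : IsLipTest L φ)
    (V : VarifoldMeasure d n) [IsFiniteMeasure V] : Integrable φ V :=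
  integrable_of_continuous_of_abs_le V h.continuous (c := L) fun p => by
    rw [Real.norm_eq_abs, abs_of_nonneg (h.nonneg p)]; exact h.le p

lemma isLipTest_one : IsLipTest (d := d) (n := n) 1 fun _ => 1 :=
  ⟨fun _ => zero_le_one, fun _ => le_rfl, fun _ _ => by simp; positivity⟩

lemma bddLipDist_bddAbove (V W : VarifoldMeasure d n) [IsFiniteMeasure V] [IsFiniteMeasure W] :
    BddAbove {r : ℝ | ∃ φ : Euc n × Grassmannian d n → ℝ, Continuous φ ∧
      (∀ p, 0 ≤ φ p ∧ φ p ≤ 1) ∧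
      (∀ p q, |φ p - φ q| ≤ ‖p.1 - q.1‖ + ‖p.2.1 - q.2.1‖) ∧
      r = |∫ p, φ p ∂V - ∫ p, φ p ∂W|} := by
  refine ⟨V.real univ + W.real univ, ?_⟩
  rintro r ⟨φ, -, h01, -, rfl⟩
  have b : ∀ U : VarifoldMeasure d n, IsFiniteMeasure U → |∫ p, φ p ∂U| ≤ U.real univ := by
    intro U _
    simpa using norm_integral_le_of_norm_le_const (μ := U) (f := φ) (C := 1)
      (Eventually.of_forall fun p => by
        rw [Real.norm_eq_abs, abs_of_nonneg (h01 p).1]; exact (h01 p).2)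
  exact (abs_sub _ _).trans (add_le_add (b V ‹_›) (b W ‹_›))

lemma IsLipTest.abs_sub_le_bddLipDist {φ : Euc n × Grassmannian d n → ℝ} (h : IsLipTest 1 φ)
    (V W : VarifoldMeasure d n) [IsFiniteMeasure V] [IsFiniteMeasure W] :
    |∫ p, φ p ∂V - ∫ p, φ p ∂W| ≤ bddLipDist V W :=
  le_csSup (bddLipDist_bddAbove V W)
    ⟨φ, h.continuous, fun p => ⟨h.nonneg p, h.le p⟩, fun p q => by simpa using h.lip p q, rfl⟩

lemma bddLipDist_le {V W : VarifoldMeasure d n} {c : ℝ}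
    (h : ∀ φ : Euc n × Grassmannian d n → ℝ, IsLipTest 1 φ →
      |∫ p, φ p ∂V - ∫ p, φ p ∂W| ≤ c) : bddLipDist V W ≤ c := by
  refine csSup_le ⟨0, fun _ => 0, continuous_const, by simp, fun p q => by simp; positivity,
    by simp⟩ ?_
  rintro r ⟨φ, -, h01, hl, rfl⟩
  exact h φ ⟨fun p => (h01 p).1, fun p => (h01 p).2, fun p q => by simpa using hl p q⟩

lemma bddLipDist_nonneg (V W : VarifoldMeasure d n) : 0 ≤ bddLipDist V W := by
  refine Real.sSup_nonneg ?_
  rintro r ⟨φ, -, -, -, rfl⟩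
  exact abs_nonneg _

lemma bddLipDist_comm (V W : VarifoldMeasure d n) : bddLipDist V W = bddLipDist W V := by
  simp only [bddLipDist, abs_sub_comm]

lemma bddLipDist_self (V : VarifoldMeasure d n) : bddLipDist V V = 0 :=
  le_antisymm (bddLipDist_le fun φ _ => by simp) (bddLipDist_nonneg _ _)

lemma bddLipDist_triangle (U V W : VarifoldMeasure d n) [IsFiniteMeasure U] [IsFiniteMeasure V]
    [IsFiniteMeasure W] : bddLipDist U W ≤ bddLipDist U V + bddLipDist V W :=
  bddLipDist_le fun _ h => (abs_sub_le _ _ _).trans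
    (add_le_add (h.abs_sub_le_bddLipDist U V) (h.abs_sub_le_bddLipDist V W))

lemma IsLipTest.abs_sub_le {L : ℝ} (hL : 0 < L) {φ : Euc n × Grassmannian d n → ℝ}
    (h : IsLipTest L φ) (V W : VarifoldMeasure d n) [IsFiniteMeasure V] [IsFiniteMeasure W] :
    |∫ p, φ p ∂V - ∫ p, φ p ∂W| ≤ L * bddLipDist V W := by
  have h1 : IsLipTest 1 fun p => L⁻¹ * φ p := by
    refine ⟨fun p => by have := h.nonneg p; positivity, fun p => ?_, fun p q => ?_⟩
    · rw [inv_mul_le_iff₀ hL, mul_one]; exact h.le p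
    · rw [← mul_sub, abs_mul, abs_of_pos (inv_pos.2 hL), inv_mul_le_iff₀ hL, one_mul]
      exact h.lip p q
  have h2 := h1.abs_sub_le_bddLipDist V W
  rwa [integral_const_mul, integral_const_mul, ← mul_sub, abs_mul, abs_of_pos (inv_pos.2 hL),
    inv_mul_le_iff₀ hL] at h2

/-- The tests defining Δ are nonnegative, so a signed function is split into its positive and
negative parts; this is the factor 2. -/
lemma abs_integral_sub_le_two_mul {L : ℝ} (hL : 0 < L) {φ : Euc n × Grassmannian d n → ℝ}
    (hb : ∀ p, |φ p| ≤ L)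
    (hl : ∀ p q, |φ p - φ q| ≤ L * (‖p.1 - q.1‖ + ‖p.2.1 - q.2.1‖))
    (V W : VarifoldMeasure d n) [IsFiniteMeasure V] [IsFiniteMeasure W] :
    |∫ p, φ p ∂V - ∫ p, φ p ∂W| ≤ 2 * L * bddLipDist V W := by
  have hp : IsLipTest L fun p => max (φ p) 0 :=
    ⟨fun p => le_max_right _ _, fun p => max_le ((le_abs_self _).trans (hb p)) hL.le,
      fun p q => (abs_max_sub_max_le_abs _ _ _).trans (hl p q)⟩
  have hm : IsLipTest L fun p => max (-φ p) 0 :=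
    ⟨fun p => le_max_right _ _, fun p => max_le ((neg_le_abs _).trans (hb p)) hL.le,
      fun p q => (abs_max_sub_max_le_abs _ _ _).trans (by
        rw [neg_sub_neg, abs_sub_comm]; exact hl p q)⟩
  have e : ∀ U : VarifoldMeasure d n, IsFiniteMeasure U →
      ∫ p, φ p ∂U = ∫ p, max (φ p) 0 ∂U - ∫ p, max (-φ p) 0 ∂U := by
    intro U _
    rw [← integral_sub (hp.integrable U) (hm.integrable U)]
    congr 1
    ext p
    exact (max_zero_sub_max_neg_zero_eq_self (φ p)).symm
  rw [e V ‹_›, e W ‹_›]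
  have h1 := hp.abs_sub_le hL V W
  have h2 := hm.abs_sub_le hL V W
  rw [abs_le] at *
  constructor <;> linarith

/-! ### Compactness of the Grassmannian and limits of Cauchy sequences of varifolds. -/

/-- This expresses the rank of a projection by a continuous function, so that fixing the rank is a
closed condition. -/
lemma traceCLM_of_isIdempotentElem {S : Euc n →L[ℝ] Euc n} (h : IsIdempotentElem S) :
    traceCLM n S = Module.finrank ℝ S.range := by
  have h1 : LinearMap.IsProj S.range (S : Euc n →ₗ[ℝ] Euc n) :=
    ⟨fun x => ⟨x, rfl⟩, by
      rintro _ ⟨y, rfl⟩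
      exact congrArg (fun T : Euc n →L[ℝ] Euc n => T y) h.eq⟩
  rw [← h1.trace, LinearMap.trace_eq_matrix_trace ℝ (EuclideanSpace.basisFun (Fin n) ℝ).toBasis,
    traceCLM_apply]
  congr 1

instance : ProperSpace (Euc n →L[ℝ] Euc n) := FiniteDimensional.proper ℝ _

instance compactSpace_grassmannian : CompactSpace (Grassmannian d n) := by
  suffices h : IsCompact {S : Euc n →L[ℝ] Euc n | IsStarProjection S ∧
      Module.finrank ℝ S.range = d} from isCompact_iff_compactSpace.1 h
  have hb : {S : Euc n →L[ℝ] Euc n | IsStarProjection S ∧ Module.finrank ℝ S.range = d} ⊆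
      Metric.closedBall 0 1 := fun S hS => by
    simpa using IsStarProjection.norm_le S hS.1
  refine Metric.isCompact_of_isClosed_isBounded ?_ (Metric.isBounded_closedBall.subset hb)
  have e : {S : Euc n →L[ℝ] Euc n | IsStarProjection S ∧ Module.finrank ℝ S.range = d} =
      {S | S * S = S ∧ ContinuousLinearMap.adjoint S = S ∧ traceCLM n S = d} := by
    ext S
    constructor
    · rintro ⟨h1, h2⟩
      exact ⟨h1.isIdempotentElem.eq, h1.isSelfAdjoint.star_eq,
        (traceCLM_of_isIdempotentElem h1.isIdempotentElem).trans (congrArg _ h2)⟩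
    · rintro ⟨h1, h2, h3⟩
      refine ⟨⟨h1, h2⟩, ?_⟩
      rw [traceCLM_of_isIdempotentElem h1] at h3
      exact_mod_cast h3
  rw [e]
  refine (isClosed_eq (by fun_prop) continuous_id).inter ((isClosed_eq
    (LinearIsometryEquiv.continuous _) continuous_id).inter
    (isClosed_eq (traceCLM n).continuous continuous_const))

/-- A sequence of measures of bounded mass supported in a fixed compact set, which is Cauchy for
the bounded Lipschitz distance, converges. -/
lemma exists_tendsto_bddLipDist {V : ℕ → VarifoldMeasure d n} {N ρ : ℝ}
    (hfin : ∀ j, IsFiniteMeasure (V j))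
    (hN : ∀ j, (V j).real univ ≤ N) (hρ : ∀ j, V j (Metric.closedBall 0 ρ ×ˢ univ)ᶜ = 0)
    (hV : ∀ η : ℝ, 0 < η → ∃ k, ∀ i ≥ k, ∀ j ≥ k, bddLipDist (V i) (V j) ≤ η) :
    ∃ W : VarifoldMeasure d n, IsFiniteMeasure W ∧
      Tendsto (fun j => bddLipDist (V j) W) atTop (𝓝 0) := by
  set 𝒦 : Set (Euc n × Grassmannian d n) := Metric.closedBall 0 ρ ×ˢ univ
  have h𝒦 : IsCompact 𝒦 := (isCompact_closedBall 0 ρ).prod isCompact_univ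
  have hcomp := isCompact_setOfPred_finiteMeasure_le_of_isCompact (Real.toNNReal N) h𝒦
  set ν : ℕ → FiniteMeasure (Euc n × Grassmannian d n) := fun j => ⟨V j, hfin j⟩
  -- Convergence along a nonprincipal ultrafilter replaces the extraction of a subsequence; the
  -- Cauchy property then gives convergence of the whole sequence.
  set u : Ultrafilter ℕ := hyperfilter ℕ
  have hu : (u : Filter ℕ) ≤ atTop := Nat.hyperfilter_le_atTop
  obtain ⟨W, -, hW⟩ := hcomp.ultrafilter_le_nhds (u.map ν) (by
    rw [Ultrafilter.coe_map, le_principal_iff, mem_map]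
    refine univ_mem' fun j => ⟨?_, ?_⟩
    · have := hN j
      rw [← NNReal.coe_le_coe]
      exact this.trans (Real.le_coe_toNNReal N)
    · rw [FiniteMeasure.null_iff_toMeasure_null]
      exact hρ j)
  rw [Ultrafilter.coe_map] at hW
  have hW' : Tendsto ν u (𝓝 W) := hW
  rw [FiniteMeasure.tendsto_iff_forall_integral_tendsto] at hW'
  refine ⟨W, inferInstance, ?_⟩
  rw [Metric.tendsto_atTop]
  intro η hη
  obtain ⟨k, hk⟩ := hV (η / 2) (by positivity)
  refine ⟨k, fun j hj => ?_⟩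
  rw [Real.dist_eq, sub_zero, abs_of_nonneg (bddLipDist_nonneg _ _)]
  suffices bddLipDist (V j) W ≤ η / 2 by linarith
  refine bddLipDist_le fun φ hφ => ?_
  let f : BoundedContinuousFunction (Euc n × Grassmannian d n) ℝ :=
    BoundedContinuousFunction.ofNormedAddCommGroup φ hφ.continuous 1 fun p => by
      rw [Real.norm_eq_abs, abs_of_nonneg (hφ.nonneg p)]; exact hφ.le p
  -- With `φ` and j fixed, i goes to its limit. The Cauchy bound does not depend on `φ`, so the
  -- estimate is uniform over all tests.
  have h1 : Tendsto (fun i => |∫ p, φ p ∂(V j) - ∫ p, φ p ∂(V i)|) u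
      (𝓝 |∫ p, φ p ∂(V j) - ∫ p, φ p ∂(W : VarifoldMeasure d n)|) :=
    ((hW' f).const_sub _).abs
  refine le_of_tendsto h1 (hu ?_)
  filter_upwards [eventually_ge_atTop k] with i hi
  have := hfin i
  have := hfin j
  exact (hφ.abs_sub_le_bddLipDist (V j) (V i)).trans (hk j hj i hi)

/-! ### Push-forward by maps close to the identity. -/

/-- A radius below which the tangential Jacobian of `1 + B` is controlled. -/
def jacRadius (n : ℕ) : ℝ := (exists_tangentialJacobian_bounds n).choose

lemma jacRadius_pos (n : ℕ) : 0 < jacRadius n :=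
  (exists_tangentialJacobian_bounds n).choose_spec.1

lemma jacRadius_le (n : ℕ) : jacRadius n ≤ 1 / 2 :=
  (exists_tangentialJacobian_bounds n).choose_spec.2.1

/-- The Lipschitz constant of the tangential Jacobian near the identity. -/
def jacConst (n : ℕ) : ℝ := (exists_tangentialJacobian_bounds n).choose_spec.2.2.choose

lemma one_le_jacConst (n : ℕ) : 1 ≤ jacConst n :=
  (exists_tangentialJacobian_bounds n).choose_spec.2.2.choose_spec.1

lemma abs_tangentialJacobian_sub_le (S T : Grassmannian d n) {B B' : Euc n →L[ℝ] Euc n} {r : ℝ}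
    (hr : r ≤ jacRadius n) (hB : ‖B‖ ≤ r) (hB' : ‖B'‖ ≤ r) :
    |tangentialJacobian (1 + B) S - tangentialJacobian (1 + B') T| ≤
      jacConst n * (‖B - B'‖ + r * ‖S.1 - T.1‖) :=
  ((exists_tangentialJacobian_bounds n).choose_spec.2.2.choose_spec.2 d S T B B' r hr hB hB').1

lemma tangentialJacobian_le (S : Grassmannian d n) {B : Euc n →L[ℝ] Euc n} {r : ℝ}
    (hr : r ≤ jacRadius n) (hB : ‖B‖ ≤ r) :
    tangentialJacobian (1 + B) S ≤ 1 + jacConst n * r := by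
  have : |tangentialJacobian (1 + B) S - 1| ≤ jacConst n * r :=
    ((exists_tangentialJacobian_bounds n).choose_spec.2.2.choose_spec.2 d S S B B r hr hB hB).2
  linarith [(abs_le.1 this).2]

/-- Vector fields `u` such that `id + u` is `C^{1,1}`-close to the identity. -/
structure IsSmallField (r : ℝ) (u : Euc n → Euc n) : Prop where
  diff : Differentiable ℝ u
  le : ∀ x, ‖fderiv ℝ u x‖ ≤ r
  lip : ∀ x y, ‖fderiv ℝ u x - fderiv ℝ u y‖ ≤ r * ‖x - y‖

namespace IsSmallField

variable {r : ℝ} {u : Euc n → Euc n}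

lemma radius_nonneg (hu : IsSmallField r u) : 0 ≤ r := (norm_nonneg _).trans (hu.le 0)

lemma continuous_fderiv (hu : IsSmallField r u) : Continuous (fderiv ℝ u) := by
  have : LipschitzWith (Real.toNNReal r) (fderiv ℝ u) := LipschitzWith.of_dist_le_mul fun x y => by
    rw [dist_eq_norm, dist_eq_norm, Real.coe_toNNReal _ hu.radius_nonneg]
    exact hu.lip x y
  exact this.continuous

lemma fderiv_id_add (hu : IsSmallField r u) (x : Euc n) :
    fderiv ℝ (fun x => x + u x) x = 1 + fderiv ℝ u x := by
  rw [fderiv_fun_add differentiableAt_fun_id (hu.diff x), fderiv_fun_id]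
  rfl

lemma norm_sub_le (hu : IsSmallField r u) (x y : Euc n) : ‖u x - u y‖ ≤ r * ‖x - y‖ :=
  Convex.norm_image_sub_le_of_norm_fderiv_le (fun z _ => hu.diff z) (fun z _ => hu.le z)
    convex_univ (mem_univ y) (mem_univ x)

end IsSmallField

/-- The action of `id + u` on `ℝⁿ × G(d,n)`. -/
def liftMap (u : Euc n → Euc n) (p : Euc n × Grassmannian d n) : Euc n × Grassmannian d n :=
  (p.1 + u p.1, imagePlane (1 + fderiv ℝ u p.1) p.2)

/-- The tangential Jacobian of `id + u`. -/
def liftJac (u : Euc n → Euc n) (p : Euc n × Grassmannian d n) : ℝ :=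
  tangentialJacobian (1 + fderiv ℝ u p.1) p.2

lemma liftJac_nonneg (u : Euc n → Euc n) (p : Euc n × Grassmannian d n) : 0 ≤ liftJac u p :=
  tangentialJacobian_nonneg _ _

namespace IsSmallField

variable {r : ℝ} {u v : Euc n → Euc n}

lemma liftJac_le (hu : IsSmallField r u) (hr : r ≤ jacRadius n) (p : Euc n × Grassmannian d n) :
    liftJac u p ≤ 1 + jacConst n * r := tangentialJacobian_le _ hr (hu.le _)

lemma liftJac_le' (hu : IsSmallField r u) (hr : r ≤ jacRadius n) (p : Euc n × Grassmannian d n) :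
    liftJac u p ≤ 1 + jacConst n / 2 := by
  refine (hu.liftJac_le hr p).trans ?_
  nlinarith [one_le_jacConst n, hr.trans (jacRadius_le n)]

lemma continuous_liftJac (hu : IsSmallField r u) :
    Continuous (liftJac u : Euc n × Grassmannian d n → ℝ) := by
  have h0 : Continuous fun p : Euc n × Grassmannian d n => metricDeviation (fderiv ℝ u p.1) := by
    have h1 : Continuous fun p : Euc n × Grassmannian d n => fderiv ℝ u p.1 :=
      hu.continuous_fderiv.comp continuous_fst
    have h2 : Continuous fun p : Euc n × Grassmannian d n => star (fderiv ℝ u p.1) :=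
      (ContinuousLinearMap.adjoint (𝕜 := ℝ) (E := Euc n) (F := Euc n)).continuous.comp h1
    simp only [metricDeviation_eq]
    exact (h2.add h1).add (h2.mul h1)
  have h3 : Continuous fun p : Euc n × Grassmannian d n => p.2.1 :=
    continuous_subtype_val.comp continuous_snd
  have e : (liftJac u : Euc n × Grassmannian d n → ℝ) =
      fun p => sqrtDet (p.2.1 * metricDeviation (fderiv ℝ u p.1) * p.2.1) :=
    funext fun p => tangentialJacobian_one_add _ _
  rw [e]
  exact continuous_sqrtDet.comp ((h3.mul h0).mul h3)

/-- The position contributes 1 + r. The plane contributes 1 + 4r in ‖S - T‖ and, since it moves with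
the derivative of `u`, a further 2r in |x - y|; this is why `IsSmallField` asks for a Lipschitz
derivative. -/
lemma norm_liftMap_sub_le (hu : IsSmallField r u) (hr : r ≤ jacRadius n)
    (p q : Euc n × Grassmannian d n) :
    ‖(liftMap u p).1 - (liftMap u q).1‖ + ‖(liftMap u p).2.1 - (liftMap u q).2.1‖ ≤
      (1 + 4 * r) * (‖p.1 - q.1‖ + ‖p.2.1 - q.2.1‖) := by
  have hr0 := hu.radius_nonneg
  have h1 : ‖(liftMap u p).1 - (liftMap u q).1‖ ≤ ‖p.1 - q.1‖ + r * ‖p.1 - q.1‖ := by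
    have e : (liftMap u p).1 - (liftMap u q).1 = (p.1 - q.1) + (u p.1 - u q.1) := by
      simp only [liftMap]; abel
    rw [e]
    exact (norm_add_le _ _).trans (by gcongr; exact hu.norm_sub_le _ _)
  have h2 := norm_imagePlane_sub_le (hr.trans (jacRadius_le n)) (hu.le p.1) (hu.le q.1) p.2 q.2
  have h3 := hu.lip p.1 q.1
  have h4 := mul_nonneg hr0 (norm_nonneg (p.1 - q.1))
  simp only [liftMap] at h1 ⊢
  linarith

lemma continuous_liftMap (hu : IsSmallField r u) (hr : r ≤ jacRadius n) :
    Continuous (liftMap u : Euc n × Grassmannian d n → Euc n × Grassmannian d n) := by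
  refine (continuous_fst.add (hu.diff.continuous.comp continuous_fst)).prodMk ?_
  rw [continuous_iff_continuousAt]
  intro q
  rw [ContinuousAt, tendsto_iff_dist_tendsto_zero]
  refine squeeze_zero (g := fun p : Euc n × Grassmannian d n =>
    (1 + 4 * r) * (‖p.1 - q.1‖ + ‖p.2.1 - q.2.1‖)) (fun _ => dist_nonneg) (fun p => ?_) ?_
  · rw [Subtype.dist_eq, dist_eq_norm]
    exact (le_add_of_nonneg_left (norm_nonneg _)).trans (hu.norm_liftMap_sub_le hr p q)
  · have : Continuous fun p : Euc n × Grassmannian d n =>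
      (1 + 4 * r) * (‖p.1 - q.1‖ + ‖p.2.1 - q.2.1‖) := by fun_prop
    simpa using this.tendsto q

lemma pushForward_eq (hu : IsSmallField r u) (V : VarifoldMeasure d n) :
    pushForward (fun x => x + u x) V =
      (V.withDensity fun p => ENNReal.ofReal (liftJac u p)).map (liftMap u) := by
  simp only [pushForward, hu.fderiv_id_add]
  rfl

lemma isFiniteMeasure_pushForward (hu : IsSmallField r u) (hr : r ≤ jacRadius n)
    (V : VarifoldMeasure d n) [IsFiniteMeasure V] :
    IsFiniteMeasure (pushForward (fun x => x + u x) V) := by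
  rw [hu.pushForward_eq]
  have : IsFiniteMeasure (V.withDensity fun p => ENNReal.ofReal (liftJac u p)) :=
    isFiniteMeasure_withDensity_ofReal
      (integrable_of_continuous_of_abs_le V hu.continuous_liftJac (c := 1 + jacConst n / 2)
        fun p => by
          rw [Real.norm_eq_abs, abs_of_nonneg (liftJac_nonneg u p)]
          exact hu.liftJac_le' hr p).2
  infer_instance

lemma integral_pushForward (hu : IsSmallField r u) (hr : r ≤ jacRadius n)
    (V : VarifoldMeasure d n) {φ : Euc n × Grassmannian d n → ℝ} (hφ : Continuous φ) :
    ∫ p, φ p ∂(pushForward (fun x => x + u x) V) = ∫ p, liftJac u p * φ (liftMap u p) ∂V := by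
  rw [hu.pushForward_eq, integral_map (hu.continuous_liftMap hr).aemeasurable
    hφ.aestronglyMeasurable, integral_withDensity_eq_integral_toReal_smul
    hu.continuous_liftJac.measurable.ennreal_ofReal (Eventually.of_forall fun _ => ENNReal.ofReal_lt_top)]
  refine integral_congr_ae (Eventually.of_forall fun p => ?_)
  simp only [ENNReal.toReal_ofReal (liftJac_nonneg u p), smul_eq_mul]

lemma real_univ_pushForward (hu : IsSmallField r u) (hr : r ≤ jacRadius n)
    (V : VarifoldMeasure d n) :
    (pushForward (fun x => x + u x) V).real univ = ∫ p, liftJac u p ∂V := by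
  simpa using hu.integral_pushForward hr V (φ := fun _ => 1) continuous_const

lemma integrable_liftJac_mul (hu : IsSmallField r u) (hr : r ≤ jacRadius n)
    (V : VarifoldMeasure d n) [IsFiniteMeasure V] {φ : Euc n × Grassmannian d n → ℝ}
    (hφ : IsLipTest 1 φ) : Integrable (fun p => liftJac u p * φ (liftMap u p)) V := by
  refine integrable_of_continuous_of_abs_le V (hu.continuous_liftJac.mul
    (hφ.continuous.comp (hu.continuous_liftMap hr))) (c := (1 + jacConst n / 2) * 1) fun p => ?_
  rw [Real.norm_eq_abs, abs_of_nonneg (mul_nonneg (liftJac_nonneg u p) (hφ.nonneg _))]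
  exact mul_le_mul (hu.liftJac_le' hr p) (hφ.le _) (hφ.nonneg _)
    ((liftJac_nonneg u p).trans (hu.liftJac_le' hr p))

/-- The pulled-back integrand is again a test function, with constant (1 + Cr)(1 + 4r) + Cr, and
this is at most 1 + 8Cr because r ≤ 1/2 and C ≥ 1. -/
lemma isLipTest_lift (hu : IsSmallField r u) (hr : r ≤ jacRadius n)
    {φ : Euc n × Grassmannian d n → ℝ} (hφ : IsLipTest 1 φ) :
    IsLipTest (1 + 8 * jacConst n * r) fun p => liftJac u p * φ (liftMap u p) := by
  have hr0 := hu.radius_nonneg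
  have hr1 := hr.trans (jacRadius_le n)
  have hC := one_le_jacConst n
  refine ⟨fun p => mul_nonneg (liftJac_nonneg u p) (hφ.nonneg _), fun p => ?_, fun p q => ?_⟩
  · have h1 : liftJac u p * φ (liftMap u p) ≤ (1 + jacConst n * r) * 1 :=
      mul_le_mul (hu.liftJac_le hr p) (hφ.le _) (hφ.nonneg _) (by positivity)
    have : 0 ≤ jacConst n * r := by positivity
    linarith
  · set D := ‖p.1 - q.1‖ + ‖p.2.1 - q.2.1‖
    have hD : 0 ≤ D := by positivity
    have h1 : |φ (liftMap u p) - φ (liftMap u q)| ≤ (1 + 4 * r) * D :=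
      (hφ.lip _ _).trans (by rw [one_mul]; exact hu.norm_liftMap_sub_le hr p q)
    have h2 : |liftJac u p - liftJac u q| ≤ jacConst n * (r * D) := by
      refine (abs_tangentialJacobian_sub_le p.2 q.2 hr (hu.le p.1) (hu.le q.1)).trans ?_
      have := hu.lip p.1 q.1
      gcongr
      simp only [D]
      linarith
    have e : liftJac u p * φ (liftMap u p) - liftJac u q * φ (liftMap u q) =
        liftJac u p * (φ (liftMap u p) - φ (liftMap u q)) +
          (liftJac u p - liftJac u q) * φ (liftMap u q) := by ring
    rw [e]
    calc _ ≤ |liftJac u p * (φ (liftMap u p) - φ (liftMap u q))| +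
          |(liftJac u p - liftJac u q) * φ (liftMap u q)| := abs_add_le _ _
      _ = liftJac u p * |φ (liftMap u p) - φ (liftMap u q)| +
          |liftJac u p - liftJac u q| * φ (liftMap u q) := by
        rw [abs_mul, abs_mul, abs_of_nonneg (liftJac_nonneg u p), abs_of_nonneg (hφ.nonneg _)]
      _ ≤ (1 + jacConst n * r) * ((1 + 4 * r) * D) + jacConst n * (r * D) * 1 := by
        gcongr
        · exact hu.liftJac_le hr p
        · exact hφ.nonneg _
        · exact hφ.le _
      _ = ((1 + jacConst n * r) * (1 + 4 * r) + jacConst n * r) * D := by ring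
      _ ≤ _ := by
        refine mul_le_mul_of_nonneg_right ?_ hD
        nlinarith [mul_nonneg hr0 (sub_nonneg.2 hC), mul_nonneg (mul_nonneg hr0 (sub_nonneg.2 hr1))
          (zero_le_one.trans hC)]

/-- Push-forwards of two measures by the same map. -/
lemma bddLipDist_pushForward_le (hu : IsSmallField r u) (hr : r ≤ jacRadius n)
    (V W : VarifoldMeasure d n) [IsFiniteMeasure V] [IsFiniteMeasure W] :
    bddLipDist (pushForward (fun x => x + u x) V) (pushForward (fun x => x + u x) W) ≤
      (1 + 8 * jacConst n * r) * bddLipDist V W := by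
  have hr0 := hu.radius_nonneg
  have hC := one_le_jacConst n
  refine bddLipDist_le fun φ hφ => ?_
  rw [hu.integral_pushForward hr V hφ.continuous, hu.integral_pushForward hr W hφ.continuous]
  exact (hu.isLipTest_lift hr hφ).abs_sub_le (by positivity) V W

end IsSmallField

/-- Comparison of the integrands of two push-forwards. -/
lemma IsLipTest.abs_jac_mul_sub_le {φ : Euc n × Grassmannian d n → ℝ} (hφ : IsLipTest 1 φ)
    {B B' : Euc n →L[ℝ] Euc n} {r : ℝ} (hr : r ≤ jacRadius n) (hB : ‖B‖ ≤ r) (hB' : ‖B'‖ ≤ r)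
    (S : Grassmannian d n) (x x' : Euc n) :
    |tangentialJacobian (1 + B) S * φ (x, imagePlane (1 + B) S) -
      tangentialJacobian (1 + B') S * φ (x', imagePlane (1 + B') S)| ≤
      4 * jacConst n * (‖x - x'‖ + ‖B - B'‖) := by
  have hr0 : 0 ≤ r := (norm_nonneg _).trans hB
  have hr1 := hr.trans (jacRadius_le n)
  have hC := one_le_jacConst n
  set J := tangentialJacobian (1 + B) S
  set J' := tangentialJacobian (1 + B') S
  set a := φ (x, imagePlane (1 + B) S)
  set a' := φ (x', imagePlane (1 + B') S)
  have h1 : |a - a'| ≤ ‖x - x'‖ + 2 * ‖B - B'‖ := by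
    refine (hφ.lip _ _).trans ?_
    have := norm_imagePlane_sub_le hr1 hB hB' S S
    rw [sub_self, norm_zero, mul_zero, zero_add] at this
    simpa using this
  have h2 : |J - J'| ≤ jacConst n * ‖B - B'‖ := by
    have := abs_tangentialJacobian_sub_le S S hr hB hB'
    rwa [sub_self, norm_zero, mul_zero, add_zero] at this
  have h3 : J ≤ 1 + jacConst n / 2 := (tangentialJacobian_le S hr hB).trans (by nlinarith)
  have hJ : 0 ≤ J := tangentialJacobian_nonneg _ _
  have e : J * a - J' * a' = J * (a - a') + (J - J') * a' := by ring
  rw [e]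
  calc _ ≤ |J * (a - a')| + |(J - J') * a'| := abs_add_le _ _
    _ = J * |a - a'| + |J - J'| * a' := by
      rw [abs_mul, abs_mul, abs_of_nonneg hJ, abs_of_nonneg (hφ.nonneg _)]
    _ ≤ (1 + jacConst n / 2) * (‖x - x'‖ + 2 * ‖B - B'‖) + jacConst n * ‖B - B'‖ * 1 := by
      gcongr
      · exact hφ.nonneg _
      · exact hφ.le _
    _ ≤ _ := by nlinarith [norm_nonneg (x - x'), norm_nonneg (B - B'),
        mul_nonneg (sub_nonneg.2 hC) (norm_nonneg (x - x')),
        mul_nonneg (sub_nonneg.2 hC) (norm_nonneg (B - B'))]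

/-- Push-forwards of the same measure by two maps. -/
lemma bddLipDist_pushForward_pushForward_le {r e : ℝ} {u v : Euc n → Euc n}
    (hu : IsSmallField r u) (hv : IsSmallField r v) (hr : r ≤ jacRadius n)
    (h0 : ∀ x, ‖u x - v x‖ ≤ e) (h1 : ∀ x, ‖fderiv ℝ u x - fderiv ℝ v x‖ ≤ e)
    (V : VarifoldMeasure d n) [IsFiniteMeasure V] :
    bddLipDist (pushForward (fun x => x + u x) V) (pushForward (fun x => x + v x) V) ≤
      8 * jacConst n * e * V.real univ := by
  have hC := one_le_jacConst n
  refine bddLipDist_le fun φ hφ => ?_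
  rw [hu.integral_pushForward hr V hφ.continuous, hv.integral_pushForward hr V hφ.continuous,
    ← integral_sub (hu.integrable_liftJac_mul hr V hφ) (hv.integrable_liftJac_mul hr V hφ)]
  rw [← Real.norm_eq_abs]
  refine norm_integral_le_of_norm_le_const (Eventually.of_forall fun p => ?_)
  refine (hφ.abs_jac_mul_sub_le hr (hu.le p.1) (hv.le p.1) p.2 _ _).trans ?_
  rw [add_sub_add_left_eq_sub]
  have := h0 p.1
  have := h1 p.1
  calc _ ≤ 4 * jacConst n * (e + e) := by gcongr
    _ = _ := by ring

/-! ### One Euler step: mass, stability and consistency. -/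

lemma clm_smul_sub (c : ℝ) (A B : Euc n →L[ℝ] Euc n) : c • A - c • B = c • (A - B) :=
  (smul_sub c A B).symm

lemma clm_sub_smul (a b : ℝ) (A : Euc n →L[ℝ] Euc n) : a • A - b • A = (a - b) • A :=
  (sub_smul a b A).symm

lemma clm_add_smul (a b : ℝ) (A : Euc n →L[ℝ] Euc n) : (a + b) • A = a • A + b • A :=
  add_smul a b A

lemma clm_mul_smul (c : ℝ) (A B : Euc n →L[ℝ] Euc n) : A * c • B = c • (A * B) := by
  ext x : 1
  exact map_smul A c (B x)

lemma clm_smul_mul (c : ℝ) (A B : Euc n →L[ℝ] Euc n) : c • A * B = c • (A * B) := by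
  ext x : 1
  rfl

/-- The properties of the map `V ↦ h_ε(·, V)` on varifolds of mass at most `N` that drive the
analysis of the time-discrete flow. -/
structure VelocityLaw (d : ℕ) (ψ : Euc n → ℝ) (ε N R D : ℝ) : Prop where
  N_nonneg : 0 ≤ N
  R_pos : 0 < R
  D_nonneg : 0 ≤ D
  diff : ∀ (V : VarifoldMeasure d n) [IsFiniteMeasure V], V.real univ ≤ N →
    Differentiable ℝ (approxMeanCurvature ψ ε V)
  norm_le : ∀ (V : VarifoldMeasure d n) [IsFiniteMeasure V], V.real univ ≤ N →
    ∀ x, ‖approxMeanCurvature ψ ε V x‖ ≤ R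
  norm_fderiv_le : ∀ (V : VarifoldMeasure d n) [IsFiniteMeasure V], V.real univ ≤ N →
    ∀ x, ‖fderiv ℝ (approxMeanCurvature ψ ε V) x‖ ≤ R
  lip : ∀ (V : VarifoldMeasure d n) [IsFiniteMeasure V], V.real univ ≤ N →
    ∀ x y, ‖fderiv ℝ (approxMeanCurvature ψ ε V) x - fderiv ℝ (approxMeanCurvature ψ ε V) y‖ ≤
      R * ‖x - y‖
  norm_sub_le : ∀ (V W : VarifoldMeasure d n) [IsFiniteMeasure V] [IsFiniteMeasure W],
    V.real univ ≤ N → W.real univ ≤ N →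
    ∀ x, ‖approxMeanCurvature ψ ε V x - approxMeanCurvature ψ ε W x‖ ≤ D * bddLipDist V W
  norm_fderiv_sub_le : ∀ (V W : VarifoldMeasure d n) [IsFiniteMeasure V] [IsFiniteMeasure W],
    V.real univ ≤ N → W.real univ ≤ N →
    ∀ x, ‖fderiv ℝ (approxMeanCurvature ψ ε V) x - fderiv ℝ (approxMeanCurvature ψ ε W) x‖ ≤
      D * bddLipDist V W
  dissipation : ∀ (V : VarifoldMeasure d n) [IsFiniteMeasure V], V.real univ ≤ N →
    ∫ p, traceCLM n (p.2.1 * fderiv ℝ (approxMeanCurvature ψ ε V) p.1) ∂V ≤ 0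

/-- Right division by a small perturbation of the identity. -/
lemma exists_mul_one_add_eq {B : Euc n →L[ℝ] Euc n} (hB : ‖B‖ ≤ 1 / 2) (H : Euc n →L[ℝ] Euc n) :
    ∃ K : Euc n →L[ℝ] Euc n, K * (1 + B) = H ∧ ‖K‖ ≤ 2 * ‖H‖ ∧ ‖K - H‖ ≤ 2 * ‖H‖ * ‖B‖ := by
  have hB' : ‖-B‖ < 1 := by rw [norm_neg]; linarith
  set w := Units.oneSub (-B) hB'
  have hw : (w : Euc n →L[ℝ] Euc n) = 1 + B := by simp [w]
  set A' : Euc n →L[ℝ] Euc n := ↑w⁻¹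
  have h1 : A' * (1 + B) = 1 := by rw [← hw]; exact w.inv_mul
  have h2 : (1 + B) * A' = 1 := by rw [← hw]; exact w.mul_inv
  have h3 : ‖A'‖ ≤ 2 := by
    refine ContinuousLinearMap.opNorm_le_bound _ zero_le_two fun x => ?_
    have := norm_le_two_mul_norm_one_add_apply hB (A' x)
    rw [show (1 + B) (A' x) = x from congrArg (fun T : Euc n →L[ℝ] Euc n => T x) h2] at this
    refine this.trans ?_
    gcongr
    linarith
  refine ⟨H * A', by rw [mul_assoc, h1, mul_one], ?_, ?_⟩
  · exact (norm_mul_le _ _).trans (by rw [mul_comm]; gcongr)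
  · have e : H * A' - H = -(H * A' * B) := by
      have : A' * B = 1 - A' := by
        rw [← h1]; noncomm_ring
      rw [mul_assoc, this, mul_sub, mul_one, neg_sub]
    rw [e, norm_neg]
    refine norm_mul₃_le.trans ?_
    rw [mul_comm 2]
    gcongr

lemma pushForward_id (V : VarifoldMeasure d n) : pushForward (fun x => x) V = V := by
  have h1 : ∀ x : Euc n, fderiv ℝ (fun x : Euc n => x) x = 1 := fun x => fderiv_fun_id
  simp only [pushForward, h1, tangentialJacobian_one, imagePlane_one, ENNReal.ofReal_one]
  rw [show (fun _ : Euc n × Grassmannian d n => (1 : ENNReal)) = 1 from rfl, withDensity_one]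
  exact Measure.map_id

lemma eulerStep_zero (ψ : Euc n → ℝ) (ε : ℝ) (V : VarifoldMeasure d n) :
    eulerStep ψ ε 0 V = V := by
  simp only [eulerStep, zero_smul, add_zero]
  exact pushForward_id V

namespace VelocityLaw

variable {ψ : Euc n → ℝ} {ε N R D τ : ℝ} {V W : VarifoldMeasure d n}
  [IsFiniteMeasure V] [IsFiniteMeasure W]

lemma isSmallField (h : VelocityLaw d ψ ε N R D) (hτ : 0 ≤ τ) (hV : V.real univ ≤ N) :
    IsSmallField (τ * R) fun x => τ • approxMeanCurvature ψ ε V x := by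
  have e : ∀ x, fderiv ℝ (fun x => τ • approxMeanCurvature ψ ε V x) x =
      τ • fderiv ℝ (approxMeanCurvature ψ ε V) x :=
    fun x => fderiv_fun_const_smul (h.diff V hV x) τ
  refine ⟨(h.diff V hV).const_smul τ, fun x => ?_, fun x y => ?_⟩
  · rw [e, norm_smul, Real.norm_of_nonneg hτ]
    gcongr
    exact h.norm_fderiv_le V hV x
  · rw [e, e, clm_smul_sub, norm_smul, Real.norm_of_nonneg hτ, mul_assoc]
    gcongr
    exact h.lip V hV x y

lemma fderiv_smul (h : VelocityLaw d ψ ε N R D) (hV : V.real univ ≤ N) (τ : ℝ) (x : Euc n) :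
    fderiv ℝ (fun x => τ • approxMeanCurvature ψ ε V x) x =
      τ • fderiv ℝ (approxMeanCurvature ψ ε V) x :=
  fderiv_fun_const_smul (h.diff V hV x) τ

lemma isFiniteMeasure_eulerStep (h : VelocityLaw d ψ ε N R D) (hτ : 0 ≤ τ)
    (hr : τ * R ≤ jacRadius n) (hV : V.real univ ≤ N) : IsFiniteMeasure (eulerStep ψ ε τ V) :=
  (h.isSmallField hτ hV).isFiniteMeasure_pushForward hr V

/-- The mass is nonincreasing along the flow, up to errors of higher order in the time step. -/
lemma exists_mass_le (h : VelocityLaw d ψ ε N R D) {η : ℝ} (hη : 0 < η) :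
    ∃ τ₀ : ℝ, 0 < τ₀ ∧ ∀ (V : VarifoldMeasure d n) [IsFiniteMeasure V], V.real univ ≤ N →
      ∀ τ : ℝ, 0 ≤ τ → τ ≤ τ₀ → (eulerStep ψ ε τ V).real univ ≤ V.real univ + η * τ := by
  have hR := h.R_pos
  have hN := h.N_nonneg
  -- The pointwise error is this constant times τR; integrated against a mass of at most `N` it is
  -- at most ητ.
  obtain ⟨r, hr, hJ⟩ := exists_tangentialJacobian_le n (η := η / (R * N + 1)) (by positivity)
  have hj := jacRadius_pos n
  refine ⟨min (jacRadius n) r / R, by positivity, fun V _ hV τ hτ hτ0 => ?_⟩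
  have h1 : τ * R ≤ min (jacRadius n) r := (le_div_iff₀ hR).1 hτ0
  have hf := h.isSmallField hτ hV
  set X := approxMeanCurvature ψ ε V
  have hJint : Integrable (liftJac (d := d) fun x => τ • X x) V := by
    simpa using hf.integrable_liftJac_mul (h1.trans (min_le_left _ _)) V isLipTest_one
  have hXc : Continuous (fderiv ℝ X) := by
    have : LipschitzWith (Real.toNNReal R) (fderiv ℝ X) :=
      LipschitzWith.of_dist_le_mul fun x y => by
        rw [dist_eq_norm, dist_eq_norm, Real.coe_toNNReal _ hR.le]
        exact h.lip V hV x y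
    exact this.continuous
  have hTc : Continuous fun p : Euc n × Grassmannian d n =>
      traceCLM n (p.2.1 * fderiv ℝ X p.1) :=
    (traceCLM n).continuous.comp ((continuous_subtype_val.comp continuous_snd).mul
      (hXc.comp continuous_fst))
  have hTint : Integrable (fun p : Euc n × Grassmannian d n =>
      traceCLM n (p.2.1 * fderiv ℝ X p.1)) V := by
    refine integrable_of_continuous_of_abs_le V hTc (c := ‖traceCLM n‖ * (1 * R)) fun p => ?_
    refine ((traceCLM n).le_opNorm _).trans ?_
    gcongr
    refine (norm_mul_le _ _).trans ?_
    gcongr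
    · exact p.2.norm_le
    · exact h.norm_fderiv_le V hV p.1
  have e : (eulerStep ψ ε τ V).real univ = ∫ p, liftJac (fun x => τ • X x) p ∂V :=
    hf.real_univ_pushForward (h1.trans (min_le_left _ _)) V
  rw [e]
  have hpt : ∀ p : Euc n × Grassmannian d n, liftJac (fun x => τ • X x) p ≤
      (1 + η / (R * N + 1) * (τ * R)) + τ * traceCLM n (p.2.1 * fderiv ℝ X p.1) := by
    intro p
    have a := hJ d p.2 (fderiv ℝ (fun x => τ • X x) p.1)
      ((hf.le p.1).trans (h1.trans (min_le_right _ _)))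
    have b := hf.le p.1
    have c : traceCLM n (p.2.1 * fderiv ℝ (fun x => τ • X x) p.1) =
        τ * traceCLM n (p.2.1 * fderiv ℝ X p.1) := by
      rw [h.fderiv_smul hV, clm_mul_smul, map_smul, smul_eq_mul]
    rw [c] at a
    have : η / (R * N + 1) * ‖fderiv ℝ (fun x => τ • X x) p.1‖ ≤ η / (R * N + 1) * (τ * R) := by
      gcongr
    rw [liftJac]
    linarith
  calc ∫ p, liftJac (fun x => τ • X x) p ∂V
      ≤ ∫ p, ((1 + η / (R * N + 1) * (τ * R)) + τ * traceCLM n (p.2.1 * fderiv ℝ X p.1)) ∂V :=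
        integral_mono hJint ((integrable_const _).add (hTint.const_mul τ)) hpt
    _ = V.real univ * (1 + η / (R * N + 1) * (τ * R)) +
        τ * ∫ p, traceCLM n (p.2.1 * fderiv ℝ X p.1) ∂V := by
      rw [integral_add (integrable_const _) (hTint.const_mul τ), integral_const,
        integral_const_mul, smul_eq_mul]
    _ ≤ V.real univ * (1 + η / (R * N + 1) * (τ * R)) + 0 := by
      gcongr
      exact mul_nonpos_of_nonneg_of_nonpos hτ (h.dissipation V hV)
    _ = V.real univ + η / (R * N + 1) * (R * V.real univ) * τ := by ring
    _ ≤ V.real univ + η * τ := by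
      gcongr
      rw [div_mul_eq_mul_div, div_le_iff₀ (by positivity)]
      gcongr
      nlinarith

/-- The exponential rate in the stability estimate. -/
def rate (n : ℕ) (N R D : ℝ) : ℝ := 8 * jacConst n * (R + D * N)

/-- The intermediate measure is the push-forward of `W` by the map of `V`: one leg changes the
measure, the other only the map. -/
lemma bddLipDist_eulerStep_le (h : VelocityLaw d ψ ε N R D) (hτ : 0 ≤ τ)
    (hr : τ * R ≤ jacRadius n) (hV : V.real univ ≤ N) (hW : W.real univ ≤ N) :
    bddLipDist (eulerStep ψ ε τ V) (eulerStep ψ ε τ W) ≤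
      (1 + τ * rate n N R D) * bddLipDist V W := by
  have hC := one_le_jacConst n
  have hu := h.isSmallField hτ hV
  have hv := h.isSmallField hτ hW
  have f1 := hu.isFiniteMeasure_pushForward hr V
  have f2 := hu.isFiniteMeasure_pushForward hr W
  have f3 := hv.isFiniteMeasure_pushForward hr W
  have h1 := hu.bddLipDist_pushForward_le hr V W
  have h2 := bddLipDist_pushForward_pushForward_le hu hv hr (e := τ * (D * bddLipDist V W))
    (fun x => by
      rw [← smul_sub, norm_smul, Real.norm_of_nonneg hτ]
      gcongr
      exact h.norm_sub_le V W hV hW x)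
    (fun x => by
      rw [h.fderiv_smul hV, h.fderiv_smul hW, clm_smul_sub, norm_smul, Real.norm_of_nonneg hτ]
      gcongr
      exact h.norm_fderiv_sub_le V W hV hW x) W
  have h3 := bddLipDist_triangle _ _ _ |>.trans (add_le_add h1 h2)
  refine h3.trans ?_
  have hΔ := bddLipDist_nonneg V W
  have hD := h.D_nonneg
  have : 8 * jacConst n * (τ * (D * bddLipDist V W)) * W.real univ ≤
      8 * jacConst n * (τ * (D * bddLipDist V W)) * N := by gcongr
  rw [rate]
  linarith

lemma bddLipDist_eulerStep_eulerStep_le (h : VelocityLaw d ψ ε N R D) {a b : ℝ} (ha : 0 ≤ a)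
    (hb : 0 ≤ b) (har : a * R ≤ jacRadius n) (hbr : b * R ≤ jacRadius n) (hV : V.real univ ≤ N) :
    bddLipDist (eulerStep ψ ε a V) (eulerStep ψ ε b V) ≤ 8 * jacConst n * R * N * |a - b| := by
  have hC := one_le_jacConst n
  have hR := h.R_pos
  have key : ∀ a b : ℝ, 0 ≤ a → 0 ≤ b → a ≤ b → b * R ≤ jacRadius n →
      bddLipDist (eulerStep ψ ε a V) (eulerStep ψ ε b V) ≤ 8 * jacConst n * R * N * |a - b| := by
    intro a b ha hb hab hbr
    have hv := h.isSmallField hb hV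
    have hu' := h.isSmallField ha hV
    have hle : a * R ≤ b * R := by gcongr
    -- Two maps are compared at a common radius, and the larger one serves both.
    have hu : IsSmallField (b * R) fun x => a • approxMeanCurvature ψ ε V x :=
      ⟨hu'.diff, fun x => (hu'.le x).trans hle, fun x y => (hu'.lip x y).trans (by gcongr)⟩
    have := bddLipDist_pushForward_pushForward_le hu hv hbr (e := |a - b| * R)
      (fun x => by
        rw [← sub_smul, norm_smul, Real.norm_eq_abs]
        gcongr
        exact h.norm_le V hV x)
      (fun x => by
        rw [h.fderiv_smul hV, h.fderiv_smul hV, clm_sub_smul, norm_smul, Real.norm_eq_abs]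
        gcongr
        exact h.norm_fderiv_le V hV x) V
    refine this.trans ?_
    calc _ ≤ 8 * jacConst n * (|a - b| * R) * N := by gcongr
      _ = _ := by ring
  rcases le_total a b with hab | hab
  · exact key a b ha hb hab hbr
  · rw [bddLipDist_comm, abs_sub_comm]
    exact key b a hb ha hab har

/-- Points move by at most τR in a step. Over the whole flow the support thus stays in one compact
set, which the passage to the limit requires. -/
lemma eulerStep_compl_closedBall (h : VelocityLaw d ψ ε N R D) (hτ : 0 ≤ τ)
    (hr : τ * R ≤ jacRadius n) (hV : V.real univ ≤ N) {ρ : ℝ}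
    (hρ : V (Metric.closedBall 0 ρ ×ˢ univ)ᶜ = 0) :
    eulerStep ψ ε τ V (Metric.closedBall 0 (ρ + τ * R) ×ˢ univ)ᶜ = 0 := by
  have hu := h.isSmallField hτ hV
  rw [eulerStep, hu.pushForward_eq, Measure.map_apply (hu.continuous_liftMap hr).measurable
    (Metric.isClosed_closedBall.measurableSet.prod MeasurableSet.univ).compl]
  refine withDensity_absolutelyContinuous _ _ (measure_mono_null ?_ hρ)
  intro p hp hp'
  apply hp
  simp only [mem_prod, mem_univ, and_true, mem_closedBall_zero_iff, liftMap] at hp' ⊢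
  refine (norm_add_le _ _).trans (add_le_add hp' ?_)
  rw [norm_smul, Real.norm_of_nonneg hτ]
  gcongr
  exact h.norm_le V hV _

/-- The constant in the consistency estimate. -/
def defect (n : ℕ) (N R D : ℝ) : ℝ :=
  4 * jacConst n * (4 * R ^ 2 + 16 * jacConst n * D * R * N) * (1 + jacConst n / 2) * N

/-- Consistency: two successive steps compared with one step. -/
lemma bddLipDist_eulerStep_add_le (h : VelocityLaw d ψ ε N R D) {a σ : ℝ} (ha : 0 ≤ a)
    (hσ : 0 ≤ σ) (hr : 2 * (a + σ) * R ≤ jacRadius n) (hV : V.real univ ≤ N)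
    (hV' : (eulerStep ψ ε a V).real univ ≤ N) :
    bddLipDist (eulerStep ψ ε (a + σ) V) (eulerStep ψ ε σ (eulerStep ψ ε a V)) ≤
      defect n N R D * a * σ := by
  have hC := one_le_jacConst n
  have hR := h.R_pos
  have hN := h.N_nonneg
  have hD := h.D_nonneg
  have haR : 0 ≤ a * R := by positivity
  have hσR : 0 ≤ σ * R := by positivity
  have hra : a * R ≤ jacRadius n := by nlinarith
  have hrσ : σ * R ≤ jacRadius n := by nlinarith
  have hras : (a + σ) * R ≤ jacRadius n := by nlinarith
  have hj := jacRadius_le n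
  have hfin := h.isFiniteMeasure_eulerStep ha hra hV
  set V' := eulerStep ψ ε a V with hVdef
  have hua := h.isSmallField ha hV
  have huas := h.isSmallField (add_nonneg ha hσ) hV
  have huσ := h.isSmallField hσ hV'
  have hdist : bddLipDist V V' ≤ 8 * jacConst n * R * N * a := by
    have := h.bddLipDist_eulerStep_eulerStep_le (V := V) le_rfl ha
      (by rw [zero_mul]; exact (jacRadius_pos n).le) hra hV
    rwa [eulerStep_zero, zero_sub, abs_neg, abs_of_nonneg ha] at this
  set X := approxMeanCurvature ψ ε V
  set X' := approxMeanCurvature ψ ε V'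
  refine bddLipDist_le fun φ hφ => ?_
  have e1 : ∫ p, φ p ∂(eulerStep ψ ε (a + σ) V) =
      ∫ p, liftJac (fun x => (a + σ) • X x) p * φ (liftMap (fun x => (a + σ) • X x) p) ∂V :=
    huas.integral_pushForward hras V hφ.continuous
  have hGc : Continuous fun p : Euc n × Grassmannian d n =>
      liftJac (fun x => σ • X' x) p * φ (liftMap (fun x => σ • X' x) p) :=
    (huσ.isLipTest_lift hrσ hφ).continuous
  have e2 : ∫ p, φ p ∂(eulerStep ψ ε σ V') =
      ∫ p, liftJac (fun x => a • X x) p * (liftJac (fun x => σ • X' x) (liftMap (fun x => a • X x) p)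
        * φ (liftMap (fun x => σ • X' x) (liftMap (fun x => a • X x) p))) ∂V :=
    (huσ.integral_pushForward hrσ V' hφ.continuous).trans (hua.integral_pushForward hra V hGc)
  have hint2 : Integrable (fun p => liftJac (fun x => a • X x) p *
      (liftJac (fun x => σ • X' x) (liftMap (fun x => a • X x) p)
        * φ (liftMap (fun x => σ • X' x) (liftMap (fun x => a • X x) p)))) V := by
    refine integrable_of_continuous_of_abs_le V (hua.continuous_liftJac.mul
      (hGc.comp (hua.continuous_liftMap hra)))
      (c := (1 + jacConst n / 2) * (1 + 8 * jacConst n * (σ * R))) fun p => ?_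
    have t := huσ.isLipTest_lift hrσ hφ
    rw [Real.norm_eq_abs, abs_of_nonneg (mul_nonneg (liftJac_nonneg _ p) (t.nonneg _))]
    exact mul_le_mul (hua.liftJac_le' hra p) (t.le _) (t.nonneg _) (by positivity)
  rw [e1, e2, ← integral_sub (huas.integrable_liftJac_mul hras V hφ) hint2, ← Real.norm_eq_abs]
  have hpt : ∀ p : Euc n × Grassmannian d n,
      ‖liftJac (fun x => (a + σ) • X x) p * φ (liftMap (fun x => (a + σ) • X x) p) -
        liftJac (fun x => a • X x) p * (liftJac (fun x => σ • X' x) (liftMap (fun x => a • X x) p)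
        * φ (liftMap (fun x => σ • X' x) (liftMap (fun x => a • X x) p)))‖ ≤
      (1 + jacConst n / 2) * (4 * jacConst n *
        (4 * R ^ 2 + 16 * jacConst n * D * R * N) * a * σ) := by
    rintro ⟨x, S⟩
    set H := fderiv ℝ X x
    have hH : ‖H‖ ≤ R := h.norm_fderiv_le V hV x
    have haH : ‖a • H‖ ≤ a * R := by
      rw [norm_smul, Real.norm_of_nonneg ha]; gcongr
    have hA : fderiv ℝ (fun x => a • X x) x = a • H := h.fderiv_smul hV a x
    -- As K(1 + aH) = H, one has 1 + (a + σ)H = (1 + σK)(1 + aH). The single step thus factors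
    -- through the first of the two steps, and only σK has to be compared with σB.
    obtain ⟨K, hK1, hK2, hK3⟩ := exists_mul_one_add_eq (haH.trans (hra.trans hj)) H
    set x' := x + a • X x
    set S' := imagePlane (1 + a • H) S
    set B := fderiv ℝ X' x'
    have hinjA := injective_one_add (haH.trans (hra.trans hj))
    -- Here ‖K‖ ≤ 2R uses up the factor 2 in the hypothesis `hr`.
    have hσK : ‖σ • K‖ ≤ jacRadius n := by
      rw [norm_smul, Real.norm_of_nonneg hσ]
      have : σ * ‖K‖ ≤ σ * (2 * R) := by gcongr; linarith
      nlinarith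
    have hσB : ‖σ • B‖ ≤ jacRadius n := by
      rw [norm_smul, Real.norm_of_nonneg hσ]
      exact (mul_le_mul_of_nonneg_left (h.norm_fderiv_le V' hV' x') hσ).trans hrσ
    have hmul : 1 + fderiv ℝ (fun x => (a + σ) • X x) x = (1 + σ • K) * (1 + a • H) := by
      rw [h.fderiv_smul hV, add_mul, one_mul, clm_smul_mul, hK1, clm_add_smul, add_assoc]
    have E1 : liftJac (fun x => (a + σ) • X x) (x, S) * φ (liftMap (fun x => (a + σ) • X x) (x, S)) =
        tangentialJacobian (1 + a • H) S * (tangentialJacobian (1 + σ • K) S' *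
          φ (x + (a + σ) • X x, imagePlane (1 + σ • K) S')) := by
      simp only [liftJac, liftMap]
      rw [hmul, tangentialJacobian_mul hinjA, imagePlane_mul hinjA
        (injective_one_add (hσK.trans hj))]
      ring
    have E2 : liftJac (fun x => a • X x) (x, S) *
        (liftJac (fun x => σ • X' x) (liftMap (fun x => a • X x) (x, S))
        * φ (liftMap (fun x => σ • X' x) (liftMap (fun x => a • X x) (x, S)))) =
        tangentialJacobian (1 + a • H) S * (tangentialJacobian (1 + σ • B) S' *
          φ (x' + σ • X' x', imagePlane (1 + σ • B) S')) := by
      simp only [liftJac, liftMap]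
      rw [hA, h.fderiv_smul hV']
    rw [E1, E2, ← mul_sub, norm_mul, Real.norm_of_nonneg (tangentialJacobian_nonneg _ _),
      Real.norm_eq_abs]
    have hJ : tangentialJacobian (1 + a • H) S ≤ 1 + jacConst n / 2 := by
      have := hua.liftJac_le' hra (x, S)
      rwa [liftJac, hA] at this
    have hxx' : ‖x - x'‖ ≤ a * R := by
      rw [sub_add_cancel_left, norm_neg, norm_smul, Real.norm_of_nonneg ha]
      gcongr
      exact h.norm_le V hV x
    -- The velocities differ by O(a) for two reasons: the point has moved by at most aR, and the
    -- varifold has moved by O(a) in Δ. Multiplied by σ in `b3`, this gives the order aσ.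
    have b1 : ‖X x - X' x'‖ ≤ R * (a * R) + D * (8 * jacConst n * R * N * a) := by
      have c1 : ‖X x - X x'‖ ≤ R * ‖x - x'‖ :=
        Convex.norm_image_sub_le_of_norm_fderiv_le (fun z _ => h.diff V hV z)
          (fun z _ => h.norm_fderiv_le V hV z) convex_univ (mem_univ x') (mem_univ x)
      have c2 : ‖X x' - X' x'‖ ≤ D * bddLipDist V V' := h.norm_sub_le V V' hV hV' x'
      refine (norm_sub_le_norm_sub_add_norm_sub _ (X x') _).trans (add_le_add (c1.trans ?_)
        (c2.trans ?_)) <;> gcongr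
    have b2 : ‖K - B‖ ≤ 2 * R * (a * R) + (R * (a * R) + D * (8 * jacConst n * R * N * a)) := by
      have c0 : ‖K - H‖ ≤ 2 * R * (a * R) := hK3.trans (by gcongr)
      have c1 : ‖H - fderiv ℝ X x'‖ ≤ R * ‖x - x'‖ := h.lip V hV x x'
      have c2 : ‖fderiv ℝ X x' - B‖ ≤ D * bddLipDist V V' := h.norm_fderiv_sub_le V V' hV hV' x'
      refine (norm_sub_le_norm_sub_add_norm_sub _ H _).trans (add_le_add c0 ?_)
      refine (norm_sub_le_norm_sub_add_norm_sub _ (fderiv ℝ X x') _).trans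
        (add_le_add (c1.trans ?_) (c2.trans ?_)) <;> gcongr
    have b3 := hφ.abs_jac_mul_sub_le le_rfl hσK hσB S' (x + (a + σ) • X x) (x' + σ • X' x')
    have b4 : ‖(x + (a + σ) • X x) - (x' + σ • X' x')‖ = σ * ‖X x - X' x'‖ := by
      have : (x + (a + σ) • X x) - (x' + σ • X' x') = σ • (X x - X' x') := by
        simp only [x', add_smul, smul_sub]; abel
      rw [this, norm_smul, Real.norm_of_nonneg hσ]
    rw [b4, clm_smul_sub, norm_smul, Real.norm_of_nonneg hσ, ← mul_add] at b3
    refine mul_le_mul hJ (b3.trans ?_) (abs_nonneg _) (by positivity)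
    calc 4 * jacConst n * (σ * (‖X x - X' x'‖ + ‖K - B‖))
        ≤ 4 * jacConst n * (σ * ((R * (a * R) + D * (8 * jacConst n * R * N * a)) +
          (2 * R * (a * R) + (R * (a * R) + D * (8 * jacConst n * R * N * a))))) := by gcongr
      _ = _ := by ring
  refine (norm_integral_le_of_norm_le_const (Eventually.of_forall hpt)).trans ?_
  have hnn : 0 ≤ (1 + jacConst n / 2) * (4 * jacConst n *
        (4 * R ^ 2 + 16 * jacConst n * D * R * N) * a * σ) := by positivity
  refine (mul_le_mul_of_nonneg_left hV hnn).trans (le_of_eq ?_)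
  rw [defect]
  ring

end VelocityLaw

/-! ### Subdivisions of the unit interval. -/

namespace Subdivision

variable (T : Subdivision)

lemma m_pos : 0 < T.m := by
  rcases Nat.eq_zero_or_pos T.m with h | h
  · have h1 := T.last_eq
    rw [h, T.zero_eq] at h1
    exact absurd h1 zero_ne_one
  · exact h

variable {T}

lemma t_le {i j : ℕ} (hij : i ≤ j) (hj : j ≤ T.m) : T.t i ≤ T.t j :=
  T.strictMonoOn.monotoneOn (hij.trans hj) hj hij

lemma t_lt {i j : ℕ} (hij : i < j) (hj : j ≤ T.m) : T.t i < T.t j :=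
  T.strictMonoOn (hij.le.trans hj) hj hij

lemma t_nonneg {i : ℕ} (hi : i ≤ T.m) : 0 ≤ T.t i := by
  rw [← T.zero_eq]; exact t_le (Nat.zero_le _) hi

lemma t_le_one {i : ℕ} (hi : i ≤ T.m) : T.t i ≤ 1 := by
  rw [← T.last_eq]; exact t_le hi le_rfl

lemma sub_le_mesh {i : ℕ} (hi : i < T.m) : T.t (i + 1) - T.t i ≤ T.mesh :=
  le_ciSup (f := fun i : Fin T.m => T.t (i + 1) - T.t i) (finite_range _).bddAbove ⟨i, hi⟩

lemma mesh_nonneg (T : Subdivision) : 0 ≤ T.mesh :=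
  (sub_nonneg.2 (t_le (Nat.le_succ 0) T.m_pos)).trans (sub_le_mesh T.m_pos)

lemma exists_mem_Ico {s : ℝ} (h0 : 0 ≤ s) (h1 : s < 1) :
    ∃ i < T.m, T.t i ≤ s ∧ s < T.t (i + 1) := by
  classical
  set i := Nat.findGreatest (fun i => T.t i ≤ s) T.m
  have hi : T.t i ≤ s := Nat.findGreatest_spec (P := fun i => T.t i ≤ s) (Nat.zero_le _)
    (by rw [T.zero_eq]; exact h0)
  have him : i ≤ T.m := Nat.findGreatest_le _
  have hlt : i < T.m := by
    refine lt_of_le_of_ne him fun h => ?_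
    rw [h, T.last_eq] at hi
    linarith
  refine ⟨i, hlt, hi, ?_⟩
  by_contra! hc
  exact Nat.findGreatest_is_greatest (P := fun i => T.t i ≤ s) (Nat.lt_succ_self i) hlt hc

lemma exists_mem_Icc {s : ℝ} (h0 : 0 ≤ s) (h1 : s ≤ 1) :
    ∃ i < T.m, T.t i ≤ s ∧ s ≤ T.t (i + 1) := by
  rcases h1.eq_or_lt with rfl | h1
  · have hm := T.m_pos
    refine ⟨T.m - 1, by omega, t_le_one (by omega), ?_⟩
    rw [Nat.sub_add_cancel hm, T.last_eq]
  · obtain ⟨i, hi, h2, h3⟩ := exists_mem_Ico (T := T) h0 h1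
    exact ⟨i, hi, h2, h3.le⟩

/-- The subdivision of `[0,1]` into `k + 1` intervals of equal length. -/
def uniform (k : ℕ) : Subdivision where
  m := k + 1
  t i := i / (k + 1)
  zero_eq := by simp
  last_eq := by
    push_cast
    exact div_self (by positivity)
  strictMonoOn := fun i _ j _ hij => by
    have : (i : ℝ) < j := by exact_mod_cast hij
    exact div_lt_div_of_pos_right this (by positivity)

lemma tendsto_mesh_uniform : Tendsto (fun k => (uniform k).mesh) atTop (𝓝 0) := by
  have h : ∀ k, (uniform k).mesh = 1 / ((k : ℝ) + 1) := by
    intro k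
    have : ∀ i : Fin (uniform k).m, (uniform k).t (i + 1) - (uniform k).t i = 1 / ((k : ℝ) + 1) := by
      intro i
      simp only [uniform]
      push_cast
      ring
    have : Nonempty (Fin (uniform k).m) := ⟨⟨0, (uniform k).m_pos⟩⟩
    simp only [mesh, ‹∀ _, _›, ciSup_const]
  simp only [h]
  exact tendsto_one_div_add_atTop_nhds_zero_nat

end Subdivision

/-- The formula holds on the closed interval: at the right node, the full step from the left node
agrees with a step of length zero from the right node. -/
lemma discreteFlow_eq (ψ : Euc n → ℝ) (ε : ℝ) (T : Subdivision) (V₀ : VarifoldMeasure d n) {i : ℕ}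
    (hi : i < T.m) {t : ℝ} (h1 : T.t i ≤ t) (h2 : t ≤ T.t (i + 1)) :
    discreteFlow ψ ε T V₀ t = eulerStep ψ ε (t - T.t i) (nodeFlow ψ ε T V₀ i) := by
  classical
  have key : ∀ j, j ≤ T.m - 1 → T.t j ≤ t → (∀ k, j < k → k ≤ T.m - 1 → ¬ T.t k ≤ t) →
      discreteFlow ψ ε T V₀ t = eulerStep ψ ε (t - T.t j) (nodeFlow ψ ε T V₀ j) := by
    intro j hj hjt hk
    have : Nat.findGreatest (fun i => T.t i ≤ t) (T.m - 1) = j :=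
      (Nat.findGreatest_eq_iff).2 ⟨hj, fun _ => hjt, fun k hk1 hk2 => hk k hk1 hk2⟩
    rw [discreteFlow]
    convert! rfl
    · exact this.symm
    · exact this.symm
  rcases h2.lt_or_eq with h2 | h2
  · refine key i (by omega) h1 fun k hk1 hk2 => ?_
    rw [not_le]
    exact h2.trans_le (Subdivision.t_le hk1 (by omega))
  -- At t = t_(i+1) the search returns i + 1, except when i + 1 = m: it is capped at m - 1, so the
  -- last node is reached from the last interval.
  · rcases (Nat.succ_le_of_lt hi).lt_or_eq with h3 | h3
    · rw [key (i + 1) (by omega) h2.ge fun k hk1 hk2 => ?_, h2, sub_self, eulerStep_zero]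
      · rfl
      · rw [not_le, h2]
        exact Subdivision.t_lt hk1 (by omega)
    · exact key i (by omega) h1 fun k hk1 hk2 => by omega

/-! ### A priori bounds and comparison of time-discrete flows. -/

/-- Time steps so small that the mass increases by at most `η τ` in a step of size `τ`. -/
structure IsFineScale (d : ℕ) (ψ : Euc n → ℝ) (ε N R η τ₀ : ℝ) : Prop where
  pos : 0 < τ₀
  small : 2 * τ₀ * R ≤ jacRadius n
  mass : ∀ (V : VarifoldMeasure d n) [IsFiniteMeasure V], V.real univ ≤ N →
      ∀ τ : ℝ, 0 ≤ τ → τ ≤ τ₀ → (eulerStep ψ ε τ V).real univ ≤ V.real univ + η * τ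

namespace VelocityLaw

variable {ψ : Euc n → ℝ} {ε N R D : ℝ}

lemma exists_isFineScale (h : VelocityLaw d ψ ε N R D) {η : ℝ} (hη : 0 < η) :
    ∃ τ₀, IsFineScale d ψ ε N R η τ₀ := by
  obtain ⟨τ₁, h1, h2⟩ := h.exists_mass_le hη
  have hR := h.R_pos
  have hj := jacRadius_pos n
  refine ⟨min τ₁ (jacRadius n / (2 * R)), by positivity, ?_, fun V _ hV τ ha hb =>
    h2 V hV τ ha (hb.trans (min_le_left _ _))⟩
  have := (le_div_iff₀ (by positivity : 0 < 2 * R)).1 (min_le_right τ₁ (jacRadius n / (2 * R)))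
  linarith

end VelocityLaw

section Flow

variable {ψ : Euc n → ℝ} {ε N R D M τ₀ ρ : ℝ} {T T' : Subdivision} {V₀ W₀ : VarifoldMeasure d n}
  [IsFiniteMeasure V₀] [IsFiniteMeasure W₀]

lemma IsFineScale.mul_le (hτ : IsFineScale d ψ ε N R (N - M) τ₀) (h : VelocityLaw d ψ ε N R D)
    {τ : ℝ} (h2 : τ ≤ τ₀) : τ * R ≤ jacRadius n := by
  have := hτ.small
  have := mul_le_mul_of_nonneg_right h2 h.R_pos.le
  have := mul_pos hτ.pos h.R_pos
  linarith

/-- With η = N - M, the mass budget M + (N - M)t reaches `N` only at time 1. The induction carries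
the bound by `N` because every step needs it in order to apply the velocity law. -/
lemma nodeFlow_bounds (h : VelocityLaw d ψ ε N R D) (hτ : IsFineScale d ψ ε N R (N - M) τ₀)
    (hMN : M ≤ N) (hT : T.mesh ≤ τ₀) (hV : V₀.real univ ≤ M) :
    ∀ i ≤ T.m, IsFiniteMeasure (nodeFlow ψ ε T V₀ i) ∧
      (nodeFlow ψ ε T V₀ i).real univ ≤ M + (N - M) * T.t i ∧
      (nodeFlow ψ ε T V₀ i).real univ ≤ N := by
  intro i
  induction i with
  | zero => exact fun _ => ⟨‹_›, by rw [T.zero_eq, mul_zero, add_zero]; exact hV, hV.trans hMN⟩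
  | succ i ih =>
    intro hi
    obtain ⟨h1, h2, h3⟩ := ih (by omega)
    have hstep := (Subdivision.sub_le_mesh (T := T) (i := i) (by omega)).trans hT
    have h0 : 0 ≤ T.t (i + 1) - T.t i := sub_nonneg.2 (Subdivision.t_le (Nat.le_succ i) hi)
    have hm := hτ.mass (nodeFlow ψ ε T V₀ i) h3 _ h0 hstep
    have h4 : (nodeFlow ψ ε T V₀ (i + 1)).real univ ≤ M + (N - M) * T.t (i + 1) := by
      refine hm.trans ?_
      linarith
    refine ⟨h.isFiniteMeasure_eulerStep h0 (hτ.mul_le h hstep) h3, h4, h4.trans ?_⟩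
    have := Subdivision.t_le_one hi
    nlinarith

lemma discreteFlow_bounds (h : VelocityLaw d ψ ε N R D)
    (hτ : IsFineScale d ψ ε N R (N - M) τ₀)
    (hMN : M ≤ N) (hT : T.mesh ≤ τ₀) (hV : V₀.real univ ≤ M) {t : ℝ} (h0 : 0 ≤ t) (h1 : t ≤ 1) :
    IsFiniteMeasure (discreteFlow ψ ε T V₀ t) ∧ (discreteFlow ψ ε T V₀ t).real univ ≤ N := by
  obtain ⟨i, hi, hit, hti⟩ := Subdivision.exists_mem_Icc (T := T) h0 h1
  obtain ⟨a1, a2, a3⟩ := nodeFlow_bounds h hτ hMN hT hV i hi.le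
  have hs := Subdivision.sub_le_mesh hi
  have hstep : t - T.t i ≤ τ₀ := by linarith
  rw [discreteFlow_eq ψ ε T V₀ hi hit hti]
  refine ⟨h.isFiniteMeasure_eulerStep (sub_nonneg.2 hit) (hτ.mul_le h hstep) a3, ?_⟩
  refine (hτ.mass _ a3 _ (sub_nonneg.2 hit) hstep).trans ?_
  nlinarith

lemma nodeFlow_support (h : VelocityLaw d ψ ε N R D) (hτ : IsFineScale d ψ ε N R (N - M) τ₀)
    (hMN : M ≤ N) (hT : T.mesh ≤ τ₀) (hV : V₀.real univ ≤ M)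
    (hρ : V₀ (Metric.closedBall 0 ρ ×ˢ univ)ᶜ = 0) :
    ∀ i ≤ T.m, nodeFlow ψ ε T V₀ i (Metric.closedBall 0 (ρ + T.t i * R) ×ˢ univ)ᶜ = 0 := by
  intro i
  induction i with
  | zero => intro _; rw [T.zero_eq, zero_mul, add_zero]; exact hρ
  | succ i ih =>
    intro hi
    obtain ⟨h1, -, h3⟩ := nodeFlow_bounds h hτ hMN hT hV i (by omega)
    have hstep := (Subdivision.sub_le_mesh (T := T) (i := i) (by omega)).trans hT
    have h0 : 0 ≤ T.t (i + 1) - T.t i := sub_nonneg.2 (Subdivision.t_le (Nat.le_succ i) hi)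
    have := h.eulerStep_compl_closedBall h0 (hτ.mul_le h hstep) h3 (ih (by omega))
    rwa [show ρ + T.t i * R + (T.t (i + 1) - T.t i) * R = ρ + T.t (i + 1) * R by ring] at this

lemma discreteFlow_support (h : VelocityLaw d ψ ε N R D)
    (hτ : IsFineScale d ψ ε N R (N - M) τ₀)
    (hMN : M ≤ N) (hT : T.mesh ≤ τ₀) (hV : V₀.real univ ≤ M)
    (hρ : V₀ (Metric.closedBall 0 ρ ×ˢ univ)ᶜ = 0) {t : ℝ} (h0 : 0 ≤ t) (h1 : t ≤ 1) :
    discreteFlow ψ ε T V₀ t (Metric.closedBall 0 (ρ + R) ×ˢ univ)ᶜ = 0 := by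
  obtain ⟨i, hi, hit, hti⟩ := Subdivision.exists_mem_Icc (T := T) h0 h1
  obtain ⟨a1, a2, a3⟩ := nodeFlow_bounds h hτ hMN hT hV i hi.le
  have hs := Subdivision.sub_le_mesh hi
  have hstep : t - T.t i ≤ τ₀ := by linarith
  rw [discreteFlow_eq ψ ε T V₀ hi hit hti]
  have := h.eulerStep_compl_closedBall (sub_nonneg.2 hit) (hτ.mul_le h hstep) a3
    (nodeFlow_support h hτ hMN hT hV hρ i hi.le)
  refine measure_mono_null (compl_subset_compl.2 (prod_mono_left
    (Metric.closedBall_subset_closedBall ?_))) this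
  have := h.R_pos
  nlinarith

/-- Within one interval this is the Lipschitz dependence of a step on its length; intervals are
chained by the triangle inequality. It supplies the continuity required by Grönwall's lemma. -/
lemma bddLipDist_discreteFlow_le (h : VelocityLaw d ψ ε N R D)
    (hτ : IsFineScale d ψ ε N R (N - M) τ₀)
    (hMN : M ≤ N) (hT : T.mesh ≤ τ₀) (hV : V₀.real univ ≤ M) {s t : ℝ} (h0 : 0 ≤ s) (hst : s ≤ t)
    (h1 : t ≤ 1) :
    bddLipDist (discreteFlow ψ ε T V₀ s) (discreteFlow ψ ε T V₀ t) ≤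
      8 * jacConst n * R * N * (t - s) := by
  have loc : ∀ i < T.m, ∀ s t, T.t i ≤ s → s ≤ t → t ≤ T.t (i + 1) →
      bddLipDist (discreteFlow ψ ε T V₀ s) (discreteFlow ψ ε T V₀ t) ≤
      8 * jacConst n * R * N * (t - s) := by
    intro i hi s t his hst hti
    obtain ⟨a1, a2, a3⟩ := nodeFlow_bounds h hτ hMN hT hV i hi.le
    have hs := Subdivision.sub_le_mesh hi
    rw [discreteFlow_eq ψ ε T V₀ hi his (hst.trans hti),
      discreteFlow_eq ψ ε T V₀ hi (his.trans hst) hti]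
    have := h.bddLipDist_eulerStep_eulerStep_le (V := nodeFlow ψ ε T V₀ i)
      (sub_nonneg.2 his) (sub_nonneg.2 (his.trans hst)) (hτ.mul_le h (by linarith))
      (hτ.mul_le h (by linarith)) a3
    rwa [sub_sub_sub_cancel_right, abs_sub_comm, abs_of_nonneg (sub_nonneg.2 hst)] at this
  have glob : ∀ k ≤ T.m, ∀ s t, 0 ≤ s → s ≤ t → t ≤ T.t k →
      bddLipDist (discreteFlow ψ ε T V₀ s) (discreteFlow ψ ε T V₀ t) ≤
      8 * jacConst n * R * N * (t - s) := by
    intro k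
    induction k with
    | zero =>
      intro _ s t hs hst ht
      rw [T.zero_eq] at ht
      obtain rfl : s = t := by linarith
      rw [bddLipDist_self, sub_self, mul_zero]
    | succ k ih =>
      intro hk s t hs hst ht
      rcases le_total t (T.t k) with h2 | h2
      · exact ih (by omega) s t hs hst h2
      rcases le_total (T.t k) s with h3 | h3
      · exact loc k (by omega) s t h3 hst ht
      · have b1 := ih (by omega) s (T.t k) hs h3 le_rfl
        have b2 := loc k (by omega) (T.t k) t le_rfl h2 ht
        have ht1 := ht.trans (Subdivision.t_le_one hk)
        have f1 := (discreteFlow_bounds h hτ hMN hT hV hs (hst.trans ht1)).1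
        have f2 := (discreteFlow_bounds h hτ hMN hT hV (hs.trans h3) (h2.trans ht1)).1
        have f3 := (discreteFlow_bounds h hτ hMN hT hV (hs.trans hst) ht1).1
        have := bddLipDist_triangle (discreteFlow ψ ε T V₀ s) (discreteFlow ψ ε T V₀ (T.t k))
          (discreteFlow ψ ε T V₀ t)
        linarith
  exact glob T.m le_rfl s t h0 hst (by rw [T.last_eq]; exact h1)

/-- After time s the flow keeps the velocity of the last node, while the Euler step uses the
velocity at s. Consistency bounds the difference by (s - t_i)(t - s), and s - t_i is at most the
mesh. Since every s is allowed, not only nodes, no common refinement of two subdivisions is ever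
needed. -/
lemma eventually_bddLipDist_discreteFlow_eulerStep_le (h : VelocityLaw d ψ ε N R D)
    (hτ : IsFineScale d ψ ε N R (N - M) τ₀)
    (hMN : M ≤ N) (hT : T.mesh ≤ τ₀) (hV : V₀.real univ ≤ M) {s : ℝ} (h0 : 0 ≤ s) (h1 : s < 1) :
    ∀ᶠ t in 𝓝[>] s, t ≤ 1 ∧ t - s ≤ τ₀ ∧
      bddLipDist (discreteFlow ψ ε T V₀ t)
        (eulerStep ψ ε (t - s) (discreteFlow ψ ε T V₀ s)) ≤
      VelocityLaw.defect n N R D * T.mesh * (t - s) := by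
  obtain ⟨i, hi, his, hsi⟩ := Subdivision.exists_mem_Ico (T := T) h0 h1
  obtain ⟨a1, a2, a3⟩ := nodeFlow_bounds h hτ hMN hT hV i hi.le
  have hm := Subdivision.sub_le_mesh hi
  filter_upwards [Ioc_mem_nhdsGT hsi] with t ht
  refine ⟨ht.2.trans (Subdivision.t_le_one hi), by linarith [ht.2], ?_⟩
  have hV' := (discreteFlow_bounds h hτ hMN hT hV h0 h1.le).2
  have hσ : 0 ≤ t - s := sub_nonneg.2 ht.1.le
  rw [discreteFlow_eq ψ ε T V₀ hi his hsi.le] at hV' ⊢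
  rw [discreteFlow_eq ψ ε T V₀ hi (his.trans ht.1.le) ht.2]
  have hR := h.R_pos
  have hr : 2 * ((s - T.t i) + (t - s)) * R ≤ jacRadius n := by
    refine le_trans ?_ hτ.small
    gcongr
    linarith [ht.2]
  have := h.bddLipDist_eulerStep_add_le (sub_nonneg.2 his) hσ hr a3 hV'
  rw [show s - T.t i + (t - s) = t - T.t i by ring] at this
  refine this.trans ?_
  have hN := h.N_nonneg
  have hD := h.D_nonneg
  have hC := one_le_jacConst n
  have : 0 ≤ VelocityLaw.defect n N R D := by rw [VelocityLaw.defect]; positivity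
  gcongr
  linarith

lemma discreteFlow_zero (ψ : Euc n → ℝ) (ε : ℝ) (T : Subdivision) (V₀ : VarifoldMeasure d n) :
    discreteFlow ψ ε T V₀ 0 = V₀ := by
  rw [discreteFlow_eq ψ ε T V₀ T.m_pos T.zero_eq.le (Subdivision.t_nonneg T.m_pos), T.zero_eq,
    sub_zero, eulerStep_zero]
  rfl

/-- Two time-discrete flows compared through the Grönwall inequality. -/
lemma bddLipDist_discreteFlow_le_gronwallBound (h : VelocityLaw d ψ ε N R D)
    (hτ : IsFineScale d ψ ε N R (N - M) τ₀) (hMN : M ≤ N) (hT : T.mesh ≤ τ₀) (hT' : T'.mesh ≤ τ₀)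
    (hV : V₀.real univ ≤ M) (hW : W₀.real univ ≤ M) {t : ℝ} (ht0 : 0 ≤ t) (ht1 : t ≤ 1) :
    bddLipDist (discreteFlow ψ ε T V₀ t) (discreteFlow ψ ε T' W₀ t) ≤
      gronwallBound (bddLipDist V₀ W₀) (VelocityLaw.rate n N R D)
        (VelocityLaw.defect n N R D * (T.mesh + T'.mesh)) t := by
  set F := discreteFlow ψ ε T V₀ with hF
  set G := discreteFlow ψ ε T' W₀ with hG
  have bF : ∀ s, 0 ≤ s → s ≤ 1 → IsFiniteMeasure (F s) ∧ (F s).real univ ≤ N :=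
    fun s h0 h1 => discreteFlow_bounds h hτ hMN hT hV h0 h1
  have bG : ∀ s, 0 ≤ s → s ≤ 1 → IsFiniteMeasure (G s) ∧ (G s).real univ ≤ N :=
    fun s h0 h1 => discreteFlow_bounds h hτ hMN hT' hW h0 h1
  have hC := one_le_jacConst n
  have hR := h.R_pos
  have hN := h.N_nonneg
  have hlip : ∀ s ∈ Icc (0 : ℝ) 1, ∀ s' ∈ Icc (0 : ℝ) 1,
      |bddLipDist (F s) (G s) - bddLipDist (F s') (G s')| ≤ 16 * jacConst n * R * N * |s - s'| := by
    have one : ∀ s ∈ Icc (0 : ℝ) 1, ∀ s' ∈ Icc (0 : ℝ) 1, s ≤ s' →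
      |bddLipDist (F s) (G s) - bddLipDist (F s') (G s')| ≤ 16 * jacConst n * R * N * |s - s'| := by
      intro s hs s' hs' hss
      have f1 := (bF s hs.1 hs.2).1
      have f2 := (bF s' hs'.1 hs'.2).1
      have f3 := (bG s hs.1 hs.2).1
      have f4 := (bG s' hs'.1 hs'.2).1
      have a1 := bddLipDist_discreteFlow_le h hτ hMN hT hV hs.1 hss hs'.2
      have a2 := bddLipDist_discreteFlow_le h hτ hMN hT' hW hs.1 hss hs'.2
      rw [← hF] at a1
      rw [← hG] at a2
      have c1 := bddLipDist_triangle (F s) (F s') (G s)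
      have c2 := bddLipDist_triangle (F s') (G s') (G s)
      have c3 := bddLipDist_triangle (F s') (F s) (G s')
      have c4 := bddLipDist_triangle (F s) (G s) (G s')
      rw [bddLipDist_comm (G s') (G s)] at c2
      rw [bddLipDist_comm (F s') (F s)] at c3
      rw [abs_sub_comm s, abs_of_nonneg (sub_nonneg.2 hss), abs_le]
      constructor <;> linarith
    intro s hs s' hs'
    rcases le_total s s' with hss | hss
    · exact one s hs s' hs' hss
    · rw [abs_sub_comm, abs_sub_comm s]
      exact one s' hs' s hs hss
  have hcont : ContinuousOn (fun s => bddLipDist (F s) (G s)) (Icc 0 1) := by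
    have : LipschitzOnWith (Real.toNNReal (16 * jacConst n * R * N))
        (fun s => bddLipDist (F s) (G s)) (Icc 0 1) :=
      LipschitzOnWith.of_dist_le_mul fun s hs s' hs' => by
        rw [Real.dist_eq, Real.dist_eq, Real.coe_toNNReal _ (by positivity)]
        exact hlip s hs s' hs'
    exact this.continuousOn
  have := le_gronwallBound_of_liminf_deriv_right_le (f := fun s => bddLipDist (F s) (G s))
    (f' := fun s => VelocityLaw.rate n N R D * bddLipDist (F s) (G s) +
      VelocityLaw.defect n N R D * (T.mesh + T'.mesh))
    (δ := bddLipDist V₀ W₀) (K := VelocityLaw.rate n N R D) (ε := VelocityLaw.defect n N R D * (T.mesh + T'.mesh))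
    (a := 0) (b := 1) hcont ?_ ?_ (fun _ _ => le_rfl) t ⟨ht0, ht1⟩
  · rwa [sub_zero] at this
  · intro s hs r hr
    apply Eventually.frequently
    filter_upwards [eventually_bddLipDist_discreteFlow_eulerStep_le h hτ hMN hT hV hs.1 hs.2,
      eventually_bddLipDist_discreteFlow_eulerStep_le h hτ hMN hT' hW hs.1 hs.2,
      self_mem_nhdsWithin] with z hz hz' hsz
    obtain ⟨hz1, hzs, hz2⟩ := hz
    obtain ⟨-, -, hz2'⟩ := hz'
    rw [← hF] at hz2
    rw [← hG] at hz2'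
    have hpos : 0 < z - s := sub_pos.2 hsz
    obtain ⟨f1, m1⟩ := bF s hs.1 hs.2.le
    obtain ⟨f2, m2⟩ := bG s hs.1 hs.2.le
    have f3 := (bF z (hs.1.trans (le_of_lt hsz)) hz1).1
    have f4 := (bG z (hs.1.trans (le_of_lt hsz)) hz1).1
    have hzr := hτ.mul_le h hzs
    have f5 := h.isFiniteMeasure_eulerStep hpos.le hzr m1
    have f6 := h.isFiniteMeasure_eulerStep hpos.le hzr m2
    -- The chain runs from F z to the Euler step of F s, to the Euler step of G s, to G z: two
    -- consistency errors and one application of stability.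
    have c1 := bddLipDist_triangle (F z) (eulerStep ψ ε (z - s) (F s)) (G z)
    have c2 := bddLipDist_triangle (eulerStep ψ ε (z - s) (F s)) (eulerStep ψ ε (z - s) (G s)) (G z)
    have c3 := h.bddLipDist_eulerStep_le hpos.le hzr m1 m2
    rw [bddLipDist_comm (eulerStep ψ ε (z - s) (G s)) (G z)] at c2
    refine lt_of_le_of_lt ?_ hr
    rw [inv_mul_le_iff₀ hpos]
    linarith
  · simp only [hF, hG, discreteFlow_zero]
    exact le_rfl

end Flow

/-! ### Existence and stability of the limit flows. -/

section Flow

variable {ψ : Euc n → ℝ} {ε N R D M ρ : ℝ} {V₀ W₀ : VarifoldMeasure d n}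
  [IsFiniteMeasure V₀] [IsFiniteMeasure W₀]

lemma VelocityLaw.rate_pos (h : VelocityLaw d ψ ε N R D) : 0 < rate n N R D := by
  have hC := one_le_jacConst n
  have := h.R_pos
  have := mul_nonneg h.D_nonneg h.N_nonneg
  rw [rate]
  positivity

lemma VelocityLaw.defect_nonneg (h : VelocityLaw d ψ ε N R D) : 0 ≤ defect n N R D := by
  have hC := one_le_jacConst n
  have := h.R_pos
  have := h.D_nonneg
  have := h.N_nonneg
  rw [defect]
  positivity

/-- Approximate mean curvature flows exist. -/
theorem VelocityLaw.exists_isApproxMCF (h : VelocityLaw d ψ ε N R D) (hMN : M < N)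
    (hV : V₀.real univ ≤ M) (hρ : V₀ (Metric.closedBall 0 ρ ×ˢ univ)ᶜ = 0) :
    ∃ V, IsApproxMCF ψ ε V₀ V := by
  obtain ⟨τ₀, hτ⟩ := h.exists_isFineScale (sub_pos.2 hMN)
  -- This is the Grönwall bound at time 1 for zero initial distance, per unit of mesh.
  set c := defect n N R D / rate n N R D * (Real.exp (rate n N R D * 1) - 1) with hc
  have hL := h.rate_pos
  have hK := h.defect_nonneg
  have hc0 : 0 ≤ c := by
    have : 0 ≤ Real.exp (rate n N R D * 1) - 1 := sub_nonneg.2 (Real.one_le_exp (by linarith))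
    positivity
  have key : ∀ T T' : Subdivision, T.mesh ≤ τ₀ → T'.mesh ≤ τ₀ → ∀ t : unitInterval,
      bddLipDist (discreteFlow ψ ε T V₀ t) (discreteFlow ψ ε T' V₀ t) ≤
        c * (T.mesh + T'.mesh) := by
    intro T T' hT hT' t
    have h1 := bddLipDist_discreteFlow_le_gronwallBound h hτ hMN.le hT hT' hV hV t.2.1 t.2.2
    refine h1.trans ?_
    rw [bddLipDist_self, gronwallBound_of_K_ne_0 hL.ne']
    have hm := T.mesh_nonneg
    have hm' := T'.mesh_nonneg
    calc _ = defect n N R D * (T.mesh + T'.mesh) / rate n N R D *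
          (Real.exp (rate n N R D * t) - 1) := by ring
      _ ≤ defect n N R D * (T.mesh + T'.mesh) / rate n N R D *
          (Real.exp (rate n N R D * 1) - 1) := by
        gcongr
        exact t.2.2
      _ = _ := by rw [hc]; ring
  -- The limit is constructed along uniform subdivisions, shifted so that all meshes are admissible.
  obtain ⟨k₀, hk₀⟩ := eventually_atTop.1
    (Subdivision.tendsto_mesh_uniform.eventually_le_const hτ.pos)
  have hlim : ∀ t : unitInterval, ∃ W : VarifoldMeasure d n, IsFiniteMeasure W ∧
      Tendsto (fun j => bddLipDist (discreteFlow ψ ε (Subdivision.uniform (j + k₀)) V₀ t) W)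
        atTop (𝓝 0) := by
    intro t
    have hm : ∀ j, (Subdivision.uniform (j + k₀)).mesh ≤ τ₀ := fun j => hk₀ _ (by omega)
    refine exists_tendsto_bddLipDist (N := N) (ρ := ρ + R)
      (fun j => (discreteFlow_bounds h hτ hMN.le (hm j) hV t.2.1 t.2.2).1)
      (fun j => (discreteFlow_bounds h hτ hMN.le (hm j) hV t.2.1 t.2.2).2)
      (fun j => discreteFlow_support h hτ hMN.le (hm j) hV hρ t.2.1 t.2.2) fun η hη => ?_
    obtain ⟨k, hk⟩ := eventually_atTop.1 (Subdivision.tendsto_mesh_uniform.eventually_le_const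
      (show 0 < η / (2 * (c + 1)) by positivity))
    refine ⟨k, fun i hi j hj => (key _ _ (hm i) (hm j) t).trans ?_⟩
    have h1 := hk (i + k₀) (by omega)
    have h2 := hk (j + k₀) (by omega)
    calc _ ≤ c * (η / (2 * (c + 1)) + η / (2 * (c + 1))) := by gcongr
      _ = η * (c / (c + 1)) := by field_simp; ring
      _ ≤ η * 1 := by
        gcongr
        rw [div_le_one (by positivity)]
        linarith
      _ = η := mul_one η
  choose V hVfin hVlim using hlim
  refine ⟨V, hVfin, fun T hT t => ?_⟩
  -- An arbitrary sequence of subdivisions is compared with the uniform one, so the limit does not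
  -- depend on the choice made.
  have htend : Tendsto (fun j => c * ((T j).mesh + (Subdivision.uniform (j + k₀)).mesh) +
      bddLipDist (discreteFlow ψ ε (Subdivision.uniform (j + k₀)) V₀ t) (V t)) atTop (𝓝 0) := by
    have h2 := (tendsto_add_atTop_iff_nat k₀).2 Subdivision.tendsto_mesh_uniform
    simpa using ((hT.add h2).const_mul c).add (hVlim t)
  refine squeeze_zero' (Eventually.of_forall fun j => bddLipDist_nonneg _ _) ?_ htend
  filter_upwards [hT.eventually_le_const hτ.pos] with j hj
  have hm : (Subdivision.uniform (j + k₀)).mesh ≤ τ₀ := hk₀ _ (by omega)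
  have f1 := (discreteFlow_bounds h hτ hMN.le hj hV t.2.1 t.2.2).1
  have f2 := (discreteFlow_bounds h hτ hMN.le hm hV t.2.1 t.2.2).1
  have f3 := hVfin t
  exact (bddLipDist_triangle _ (discreteFlow ψ ε (Subdivision.uniform (j + k₀)) V₀ t) _).trans
    (add_le_add (key _ _ hj hm t) le_rfl)

/-- Stability of approximate mean curvature flows. -/
theorem VelocityLaw.bddLipDist_le_mul_exp (h : VelocityLaw d ψ ε N R D) (hMN : M < N)
    (hV₀ : V₀.real univ ≤ M) (hW₀ : W₀.real univ ≤ M) {V W : unitInterval → VarifoldMeasure d n}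
    (hV : IsApproxMCF ψ ε V₀ V) (hW : IsApproxMCF ψ ε W₀ W) (t : unitInterval) :
    bddLipDist (V t) (W t) ≤ bddLipDist V₀ W₀ * Real.exp (rate n N R D * t) := by
  obtain ⟨τ₀, hτ⟩ := h.exists_isFineScale (sub_pos.2 hMN)
  have hmesh := Subdivision.tendsto_mesh_uniform
  have l1 := hV.tendsto _ hmesh t
  have l2 := hW.tendsto _ hmesh t
  -- The inhomogeneous term of the Grönwall bound vanishes with the mesh, and only the exponential
  -- remains.
  have l3 : Tendsto (fun k => gronwallBound (bddLipDist V₀ W₀) (rate n N R D)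
      (defect n N R D * ((Subdivision.uniform k).mesh + (Subdivision.uniform k).mesh)) t) atTop
      (𝓝 (gronwallBound (bddLipDist V₀ W₀) (rate n N R D) 0 t)) := by
    refine ((gronwallBound_continuous_ε _ _ _).tendsto 0).comp ?_
    simpa using (hmesh.add hmesh).const_mul (defect n N R D)
  rw [gronwallBound_ε0] at l3
  have l4 := (l1.add l3).add l2
  rw [zero_add, add_zero] at l4
  refine ge_of_tendsto l4 ?_
  filter_upwards [hmesh.eventually_le_const hτ.pos] with k hk
  have f1 := (discreteFlow_bounds h hτ hMN.le hk hV₀ t.2.1 t.2.2).1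
  have f2 := (discreteFlow_bounds h hτ hMN.le hk hW₀ t.2.1 t.2.2).1
  have f3 := hV.finite t
  have f4 := hW.finite t
  have c1 := bddLipDist_triangle (V t) (discreteFlow ψ ε (Subdivision.uniform k) V₀ t) (W t)
  have c2 := bddLipDist_triangle (discreteFlow ψ ε (Subdivision.uniform k) V₀ t)
    (discreteFlow ψ ε (Subdivision.uniform k) W₀ t) (W t)
  have c3 := bddLipDist_discreteFlow_le_gronwallBound h hτ hMN.le hk hk hV₀ hW₀ t.2.1 t.2.2
  rw [bddLipDist_comm (V t) (discreteFlow ψ ε (Subdivision.uniform k) V₀ t)] at c1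
  linarith

end Flow

/-! ### Convolution with a smoothing kernel. -/

/-- Quantitative properties of a smoothing kernel supported in the unit ball. -/
structure KernelBounds (Φ : Euc n → ℝ) (a C B₁ B₂ B₃ : ℝ) : Prop where
  smooth : ContDiff ℝ 1 Φ
  support : tsupport Φ ⊆ Metric.closedBall 0 1
  nonneg : ∀ x, 0 ≤ Φ x
  integral_eq : ∫ x, Φ x = 1
  le : ∀ x, Φ x ≤ B₁
  norm_fderiv_le : ∀ x, ‖fderiv ℝ Φ x‖ ≤ B₁
  lip : ∀ x y, ‖fderiv ℝ Φ x - fderiv ℝ Φ y‖ ≤ B₂ * ‖x - y‖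
  norm_fderiv_le_add : ∀ x, ‖fderiv ℝ Φ x‖ ≤ a * Φ x + C
  integral_norm_fderiv_le : ∫ x, ‖fderiv ℝ Φ x‖ ≤ B₃
  one_le : 1 ≤ B₃
  le_of : B₁ ≤ B₂
  pos : 0 < a
  const_nonneg : 0 ≤ C

/-- The volume of the unit ball. -/
def unitBallVolume (n : ℕ) : ℝ := volume.real (Metric.closedBall (0 : Euc n) 1)

lemma unitBallVolume_nonneg (n : ℕ) : 0 ≤ unitBallVolume n := measureReal_nonneg

namespace KernelBounds

variable {Φ : Euc n → ℝ} {a C B₁ B₂ B₃ b : ℝ} {g g' : Euc n → Euc n}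

lemma hasCompactSupport (h : KernelBounds Φ a C B₁ B₂ B₃) : HasCompactSupport Φ :=
  HasCompactSupport.of_support_subset_isCompact (isCompact_closedBall 0 1)
    ((subset_tsupport Φ).trans h.support)

lemma continuous_fderiv (h : KernelBounds Φ a C B₁ B₂ B₃) : Continuous (fderiv ℝ Φ) :=
  h.smooth.continuous_fderiv one_ne_zero

lemma fderiv_eq_zero (h : KernelBounds Φ a C B₁ B₂ B₃) {x : Euc n} (hx : 1 < ‖x‖) :
    fderiv ℝ Φ x = 0 := by
  by_contra hne
  have := h.support (support_fderiv_subset ℝ hne)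
  rw [mem_closedBall_zero_iff] at this
  linarith

lemma nonneg₁ (h : KernelBounds Φ a C B₁ B₂ B₃) : 0 ≤ B₁ := (norm_nonneg _).trans (h.norm_fderiv_le 0)

lemma nonneg₂ (h : KernelBounds Φ a C B₁ B₂ B₃) : 0 ≤ B₂ := h.nonneg₁.trans h.le_of

lemma nonneg₃ (h : KernelBounds Φ a C B₁ B₂ B₃) : 0 ≤ B₃ := zero_le_one.trans h.one_le

lemma integrable (h : KernelBounds Φ a C B₁ B₂ B₃) : Integrable Φ :=
  h.smooth.continuous.integrable_of_hasCompactSupport h.hasCompactSupport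

lemma integrable_fderiv (h : KernelBounds Φ a C B₁ B₂ B₃) : Integrable (fderiv ℝ Φ) :=
  h.continuous_fderiv.integrable_of_hasCompactSupport (h.hasCompactSupport.fderiv ℝ)

lemma integrable_smul (h : KernelBounds Φ a C B₁ B₂ B₃) (hg : Continuous g) (hb : ∀ y, ‖g y‖ ≤ b)
    (x : Euc n) : Integrable fun y => Φ (x - y) • g y := by
  refine (h.integrable.comp_sub_left x).smul_of_top_left ?_
  exact memLp_top_of_bound hg.aestronglyMeasurable b (Eventually.of_forall hb)

lemma integrable_smulRight (h : KernelBounds Φ a C B₁ B₂ B₃) (hg : Continuous g)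
    (hb : ∀ y, ‖g y‖ ≤ b) (x : Euc n) :
    Integrable fun y => (fderiv ℝ Φ (x - y)).smulRight (g y) := by
  refine ((h.integrable_fderiv.comp_sub_left x).norm.mul_const b).mono' ?_
    (Eventually.of_forall fun y => ?_)
  · have h1 : Continuous fun y => fderiv ℝ Φ (x - y) :=
      h.continuous_fderiv.comp (continuous_const.sub continuous_id)
    exact (((ContinuousLinearMap.smulRightL ℝ (Euc n) (Euc n)).continuous.comp h1).clm_apply
      hg).aestronglyMeasurable
  · rw [ContinuousLinearMap.norm_smulRight_apply]
    exact mul_le_mul_of_nonneg_left (hb y) (norm_nonneg _)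

/-- All derivatives fall on the kernel, since `g` is only continuous. -/
lemma hasFDerivAt_conv (h : KernelBounds Φ a C B₁ B₂ B₃) (hg : Continuous g) (x : Euc n) :
    HasFDerivAt (fun x => ∫ y, Φ (x - y) • g y)
      (∫ y, (fderiv ℝ Φ (x - y)).smulRight (g y)) x := by
  have h1 := h.hasCompactSupport.hasFDerivAt_convolution_left
    (ContinuousLinearMap.lsmul ℝ ℝ : ℝ →L[ℝ] Euc n →L[ℝ] Euc n) h.smooth
    (μ := volume) hg.locallyIntegrable x
  have e : convolution Φ g (ContinuousLinearMap.lsmul ℝ ℝ : ℝ →L[ℝ] Euc n →L[ℝ] Euc n) volume =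
      fun x => ∫ y, Φ (x - y) • g y := by
    ext1 z
    rw [convolution_eq_swap]
    rfl
  rw [e, convolution_eq_swap] at h1
  exact h1

lemma norm_conv_le (h : KernelBounds Φ a C B₁ B₂ B₃) (hb : ∀ y, ‖g y‖ ≤ b) (x : Euc n) :
    ‖∫ y, Φ (x - y) • g y‖ ≤ b := by
  calc _ ≤ ∫ y, Φ (x - y) * b := by
        refine norm_integral_le_of_norm_le ((h.integrable.comp_sub_left x).mul_const b)
          (Eventually.of_forall fun y => ?_)
        rw [norm_smul, Real.norm_of_nonneg (h.nonneg _)]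
        exact mul_le_mul_of_nonneg_left (hb y) (h.nonneg _)
    _ = b := by
      rw [integral_mul_const, integral_sub_left_eq_self Φ volume x, h.integral_eq, one_mul]

lemma norm_fderiv_conv_le (h : KernelBounds Φ a C B₁ B₂ B₃) (hb : ∀ y, ‖g y‖ ≤ b) (x : Euc n) :
    ‖∫ y, (fderiv ℝ Φ (x - y)).smulRight (g y)‖ ≤ B₃ * b := by
  have hb0 : 0 ≤ b := (norm_nonneg _).trans (hb 0)
  calc _ ≤ ∫ y, ‖fderiv ℝ Φ (x - y)‖ * b := by
        refine norm_integral_le_of_norm_le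
          ((h.integrable_fderiv.comp_sub_left x).norm.mul_const b)
          (Eventually.of_forall fun y => ?_)
        rw [ContinuousLinearMap.norm_smulRight_apply]
        exact mul_le_mul_of_nonneg_left (hb y) (norm_nonneg _)
    _ = (∫ y, ‖fderiv ℝ Φ y‖) * b := by
      rw [integral_mul_const, integral_sub_left_eq_self (fun y => ‖fderiv ℝ Φ y‖) volume x]
    _ ≤ _ := by
      gcongr
      exact h.integral_norm_fderiv_le

/-- The integrand vanishes outside the two unit balls around x and x', which gives twice the volume
of the unit ball; there the derivative of `Φ` is Lipschitz with constant `B₂`. -/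
lemma norm_fderiv_conv_sub_le (h : KernelBounds Φ a C B₁ B₂ B₃) (hg : Continuous g)
    (hb : ∀ y, ‖g y‖ ≤ b) (x x' : Euc n) :
    ‖(∫ y, (fderiv ℝ Φ (x - y)).smulRight (g y)) - ∫ y, (fderiv ℝ Φ (x' - y)).smulRight (g y)‖ ≤
      2 * unitBallVolume n * B₂ * b * ‖x - x'‖ := by
  have hb0 : 0 ≤ b := (norm_nonneg _).trans (hb 0)
  have hB := h.nonneg₂
  rw [← integral_sub (h.integrable_smulRight hg hb x) (h.integrable_smulRight hg hb x')]
  set U : Set (Euc n) := Metric.closedBall x 1 ∪ Metric.closedBall x' 1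
  have hfin : ∀ z : Euc n, volume (Metric.closedBall z 1) < ⊤ := fun z => measure_closedBall_lt_top
  have hU : volume U < ⊤ := (measure_union_le _ _).trans_lt (ENNReal.add_lt_top.2 ⟨hfin x, hfin x'⟩)
  have hvol : volume.real U ≤ 2 * unitBallVolume n := by
    have hz : ∀ z : Euc n, volume.real (Metric.closedBall z 1) = unitBallVolume n := by
      intro z
      rw [unitBallVolume, measureReal_def, measureReal_def,
        Measure.addHaar_closedBall_center volume z]
    have := measureReal_union_le (μ := volume) (Metric.closedBall x 1) (Metric.closedBall x' 1)
    rw [hz, hz] at this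
    linarith
  have hout : ∀ y, y ∉ U →
      (fderiv ℝ Φ (x - y)).smulRight (g y) - (fderiv ℝ Φ (x' - y)).smulRight (g y) = 0 := by
    intro y hy
    simp only [U, mem_union, not_or, Metric.mem_closedBall, not_le, dist_comm y, dist_eq_norm] at hy
    rw [h.fderiv_eq_zero hy.1, h.fderiv_eq_zero hy.2, sub_self]
  rw [← setIntegral_eq_integral_of_forall_compl_eq_zero (s := U) hout]
  have := norm_setIntegral_le_of_norm_le_const (μ := volume) (s := U) (C := B₂ * ‖x - x'‖ * b)
    (f := fun y => (fderiv ℝ Φ (x - y)).smulRight (g y) - (fderiv ℝ Φ (x' - y)).smulRight (g y))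
    hU (fun y _ => by
      have e : (fderiv ℝ Φ (x - y)).smulRight (g y) - (fderiv ℝ Φ (x' - y)).smulRight (g y) =
          (fderiv ℝ Φ (x - y) - fderiv ℝ Φ (x' - y)).smulRight (g y) := by
        ext v i
        simp [sub_mul]
      rw [e, ContinuousLinearMap.norm_smulRight_apply]
      have := h.lip (x - y) (x' - y)
      rw [sub_sub_sub_cancel_right] at this
      exact mul_le_mul this (hb y) (norm_nonneg _) (by positivity))
  refine this.trans ?_
  calc B₂ * ‖x - x'‖ * b * volume.real U ≤ B₂ * ‖x - x'‖ * b * (2 * unitBallVolume n) := by gcongr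
    _ = _ := by ring

end KernelBounds

/-! ### The approximate mean curvature obeys the velocity law. -/

lemma norm_gradient (f : Euc n → ℝ) (x : Euc n) : ‖gradient f x‖ = ‖fderiv ℝ f x‖ :=
  (InnerProductSpace.toDual ℝ (Euc n)).symm.norm_map _

lemma norm_gradient_sub (f : Euc n → ℝ) (x y : Euc n) :
    ‖gradient f x - gradient f y‖ = ‖fderiv ℝ f x - fderiv ℝ f y‖ := by
  rw [gradient, gradient, ← map_sub]
  exact (InnerProductSpace.toDual ℝ (Euc n)).symm.norm_map _

lemma traceCLM_smulRight (l : Euc n →L[ℝ] ℝ) (w : Euc n) : traceCLM n (l.smulRight w) = l w := by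
  have hw : w = ∑ i, w i • EuclideanSpace.single i (1 : ℝ) := by
    ext i
    simp [Pi.single_apply]
  conv_rhs => rw [hw, map_sum]
  simp [traceCLM_apply, Matrix.trace, stdMatrix_apply, mul_comm]

lemma mul_smulRight (S : Euc n →L[ℝ] Euc n) (l : Euc n →L[ℝ] ℝ) (w : Euc n) :
    S * l.smulRight w = l.smulRight (S w) := by
  ext v : 1
  exact map_smul S (l v) w

section Curvature

variable {ψ : Euc n → ℝ} {ε a C B₁ B₂ B₃ N : ℝ} {V W : VarifoldMeasure d n}

lemma smoothedMass_eq (h : KernelBounds (truncKernel ψ ε) a C B₁ B₂ B₃)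
    (V : VarifoldMeasure d n) (y : Euc n) :
    smoothedMass ψ ε V y = ∫ p, truncKernel ψ ε (p.1 - y) ∂V := by
  rw [smoothedMass, massMeasure, integral_map measurable_fst.aemeasurable]
  exact (h.smooth.continuous.comp (continuous_id.sub continuous_const)).aestronglyMeasurable

lemma smoothedMass_nonneg (h : KernelBounds (truncKernel ψ ε) a C B₁ B₂ B₃)
    (V : VarifoldMeasure d n) (y : Euc n) : 0 ≤ smoothedMass ψ ε V y :=
  integral_nonneg fun _ => h.nonneg _

lemma continuous_gradient (h : KernelBounds (truncKernel ψ ε) a C B₁ B₂ B₃) :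
    Continuous (gradient (truncKernel ψ ε)) :=
  (InnerProductSpace.toDual ℝ (Euc n)).symm.continuous.comp h.continuous_fderiv

lemma continuous_apply_gradient (h : KernelBounds (truncKernel ψ ε) a C B₁ B₂ B₃) :
    Continuous fun q : (Euc n × Grassmannian d n) × Euc n =>
      q.1.2.1 (gradient (truncKernel ψ ε) (q.1.1 - q.2)) := by
  have h1 : Continuous fun q : (Euc n × Grassmannian d n) × Euc n => q.1.2.1 :=
    continuous_subtype_val.comp (continuous_snd.comp continuous_fst)
  have h2 : Continuous fun q : (Euc n × Grassmannian d n) × Euc n =>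
      gradient (truncKernel ψ ε) (q.1.1 - q.2) :=
    (continuous_gradient h).comp ((continuous_fst.comp continuous_fst).sub continuous_snd)
  exact h1.clm_apply h2

lemma norm_apply_gradient_le (p : Euc n × Grassmannian d n) (y : Euc n) :
    ‖p.2.1 (gradient (truncKernel ψ ε) (p.1 - y))‖ ≤ ‖fderiv ℝ (truncKernel ψ ε) (p.1 - y)‖ :=
  (p.2.norm_apply_le _).trans (norm_gradient _ _).le

lemma integrable_apply_gradient (h : KernelBounds (truncKernel ψ ε) a C B₁ B₂ B₃)
    (V : VarifoldMeasure d n) [IsFiniteMeasure V] (y : Euc n) :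
    Integrable (fun p : Euc n × Grassmannian d n =>
      p.2.1 (gradient (truncKernel ψ ε) (p.1 - y))) V :=
  integrable_of_continuous_of_abs_le V
    ((continuous_apply_gradient h).comp (continuous_id.prodMk continuous_const)) (c := B₁)
    fun p => (norm_apply_gradient_le p y).trans (h.norm_fderiv_le _)

lemma integrable_truncKernel (h : KernelBounds (truncKernel ψ ε) a C B₁ B₂ B₃)
    (V : VarifoldMeasure d n) [IsFiniteMeasure V] (y : Euc n) :
    Integrable (fun p : Euc n × Grassmannian d n => truncKernel ψ ε (p.1 - y)) V :=
  integrable_of_continuous_of_abs_le V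
    (h.smooth.continuous.comp (continuous_fst.sub continuous_const)) (c := B₁)
    fun p => by rw [Real.norm_of_nonneg (h.nonneg _)]; exact h.le _

lemma continuous_smoothedMass (h : KernelBounds (truncKernel ψ ε) a C B₁ B₂ B₃)
    (V : VarifoldMeasure d n) [IsFiniteMeasure V] : Continuous (smoothedMass ψ ε V) := by
  rw [funext (smoothedMass_eq h V)]
  refine continuous_of_dominated (bound := fun _ => B₁)
    (fun y => (integrable_truncKernel h V y).1) (fun y => Eventually.of_forall fun p => ?_)
    (integrable_const _) (Eventually.of_forall fun p => ?_)
  · rw [Real.norm_of_nonneg (h.nonneg _)]; exact h.le _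
  · exact h.smooth.continuous.comp (continuous_const.sub continuous_id)

lemma continuous_smoothedFirstVariation (h : KernelBounds (truncKernel ψ ε) a C B₁ B₂ B₃)
    (V : VarifoldMeasure d n) [IsFiniteMeasure V] : Continuous (smoothedFirstVariation ψ ε V) := by
  refine continuous_of_dominated (bound := fun _ => B₁)
    (fun y => (integrable_apply_gradient h V y).1) (fun y => Eventually.of_forall fun p => ?_)
    (integrable_const _) (Eventually.of_forall fun p => ?_)
  · exact (norm_apply_gradient_le p y).trans (h.norm_fderiv_le _)
  · exact (continuous_apply_gradient h).comp (continuous_const.prodMk continuous_id)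

lemma continuous_preMeanCurvature (h : KernelBounds (truncKernel ψ ε) a C B₁ B₂ B₃) (hε : 0 < ε)
    (V : VarifoldMeasure d n) [IsFiniteMeasure V] : Continuous (preMeanCurvature ψ ε V) := by
  have h1 := continuous_smoothedMass h V
  refine (Continuous.smul (Continuous.inv₀ (h1.add continuous_const) fun y => ?_)
    (continuous_smoothedFirstVariation h V)).neg
  have := smoothedMass_nonneg h V y
  exact (by positivity : smoothedMass ψ ε V y + ε ≠ 0)

/-- The bound |∇Φ| ≤ aΦ + C is kept additive so that the first term is absorbed by the denominator
of h̃_ε and only the second is divided by ε. The supremum bound `B₁` alone would give `B₁ * N / ε`.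
-/
lemma norm_smoothedFirstVariation_le (h : KernelBounds (truncKernel ψ ε) a C B₁ B₂ B₃)
    (V : VarifoldMeasure d n) [IsFiniteMeasure V] (y : Euc n) :
    ‖smoothedFirstVariation ψ ε V y‖ ≤ a * smoothedMass ψ ε V y + C * V.real univ := by
  rw [smoothedMass_eq h, smoothedFirstVariation]
  refine (norm_integral_le_of_norm_le
    (g := fun p : Euc n × Grassmannian d n => a * truncKernel ψ ε (p.1 - y) + C)
    (((integrable_truncKernel h V y).const_mul a).add (integrable_const C))
    (Eventually.of_forall fun p => ?_)).trans (le_of_eq ?_)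
  · exact (norm_apply_gradient_le p y).trans (h.norm_fderiv_le_add _)
  · rw [integral_add ((integrable_truncKernel h V y).const_mul a) (integrable_const C),
      integral_const_mul, integral_const, smul_eq_mul, mul_comm C]

/-- The bound for `h̃_ε`. -/
def curvatureBound (a C ε N : ℝ) : ℝ := a + C * N / ε

lemma norm_preMeanCurvature_le (h : KernelBounds (truncKernel ψ ε) a C B₁ B₂ B₃) (hε : 0 < ε)
    (V : VarifoldMeasure d n) [IsFiniteMeasure V] (hV : V.real univ ≤ N) (y : Euc n) :
    ‖preMeanCurvature ψ ε V y‖ ≤ curvatureBound a C ε N := by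
  have h1 := smoothedMass_nonneg h V y
  have h2 := norm_smoothedFirstVariation_le h V y
  have hC := h.const_nonneg
  have hN : 0 ≤ N := measureReal_nonneg.trans hV
  have ha := h.pos
  rw [preMeanCurvature, norm_neg, norm_smul, norm_inv, Real.norm_of_nonneg (by positivity),
    inv_mul_le_iff₀ (by positivity), curvatureBound]
  have h3 : C * V.real univ ≤ C * N := by gcongr
  have h4 : C * N / ε * ε = C * N := by field_simp
  have h5 : 0 ≤ C * N / ε * smoothedMass ψ ε V y := by positivity
  nlinarith [mul_pos ha hε]

lemma abs_smoothedMass_sub_le (h : KernelBounds (truncKernel ψ ε) a C B₁ B₂ B₃) (hB : 0 < B₁)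
    (V W : VarifoldMeasure d n) [IsFiniteMeasure V] [IsFiniteMeasure W] (y : Euc n) :
    |smoothedMass ψ ε V y - smoothedMass ψ ε W y| ≤ B₁ * bddLipDist V W := by
  rw [smoothedMass_eq h, smoothedMass_eq h]
  have ht : IsLipTest (d := d) B₁ fun p => truncKernel ψ ε (p.1 - y) := by
    refine ⟨fun p => h.nonneg _, fun p => h.le _, fun p q => ?_⟩
    have := Convex.norm_image_sub_le_of_norm_fderiv_le (f := truncKernel ψ ε) (𝕜 := ℝ)
      (fun z _ => h.smooth.differentiable one_ne_zero z) (fun z _ => h.norm_fderiv_le z)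
      convex_univ (mem_univ (q.1 - y)) (mem_univ (p.1 - y))
    rw [sub_sub_sub_cancel_right] at this
    refine this.trans ?_
    gcongr
    exact le_add_of_nonneg_right (norm_nonneg _)
  exact ht.abs_sub_le hB V W

/-- A vector-valued integral is tested in the direction of the difference itself. The resulting
scalar test is signed, hence the factor 2. -/
lemma norm_smoothedFirstVariation_sub_le (h : KernelBounds (truncKernel ψ ε) a C B₁ B₂ B₃)
    (hB : 0 < B₁) (V W : VarifoldMeasure d n) [IsFiniteMeasure V] [IsFiniteMeasure W] (y : Euc n) :
    ‖smoothedFirstVariation ψ ε V y - smoothedFirstVariation ψ ε W y‖ ≤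
      2 * B₂ * bddLipDist V W := by
  set D := smoothedFirstVariation ψ ε V y - smoothedFirstVariation ψ ε W y with hD
  rcases (norm_nonneg D).eq_or_lt with h0 | h0
  · rw [← h0]
    have := h.nonneg₂
    have := bddLipDist_nonneg V W
    positivity
  set e := ‖D‖⁻¹ • D with he
  have hne : ‖e‖ = 1 := by
    rw [he, norm_smul, norm_inv, norm_norm, inv_mul_cancel₀ h0.ne']
  have hint : ∀ U : VarifoldMeasure d n, IsFiniteMeasure U →
      inner ℝ e (smoothedFirstVariation ψ ε U y) =
        ∫ p, inner ℝ e (p.2.1 (gradient (truncKernel ψ ε) (p.1 - y))) ∂U := fun U _ =>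
    (integral_inner (integrable_apply_gradient h U y) e).symm
  have h1 : ‖D‖ = inner ℝ e (smoothedFirstVariation ψ ε V y) -
      inner ℝ e (smoothedFirstVariation ψ ε W y) := by
    rw [← inner_sub_right, ← hD, he, real_inner_smul_left, real_inner_self_eq_norm_sq]
    field_simp
  rw [h1, hint V ‹_›, hint W ‹_›]
  refine (le_abs_self _).trans (abs_integral_sub_le_two_mul (hB.trans_le h.le_of) (fun p => ?_)
    (fun p q => ?_) V W)
  · refine (abs_real_inner_le_norm _ _).trans ?_
    rw [hne, one_mul]
    exact (norm_apply_gradient_le p y).trans ((h.norm_fderiv_le _).trans h.le_of)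
  · rw [← inner_sub_right]
    refine (abs_real_inner_le_norm _ _).trans ?_
    rw [hne, one_mul]
    set u := gradient (truncKernel ψ ε) (p.1 - y)
    set v := gradient (truncKernel ψ ε) (q.1 - y)
    have e1 : p.2.1 u - q.2.1 v = p.2.1 (u - v) + (p.2.1 - q.2.1) v := by
      rw [map_sub, sub_apply]; abel
    rw [e1]
    have a1 : ‖p.2.1 (u - v)‖ ≤ B₂ * ‖p.1 - q.1‖ := by
      refine (p.2.norm_apply_le _).trans ?_
      rw [norm_gradient_sub]
      have := h.lip (p.1 - y) (q.1 - y)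
      rwa [sub_sub_sub_cancel_right] at this
    have a2 : ‖(p.2.1 - q.2.1) v‖ ≤ ‖p.2.1 - q.2.1‖ * B₂ := by
      refine ((p.2.1 - q.2.1).le_opNorm v).trans ?_
      gcongr
      rw [norm_gradient]
      exact (h.norm_fderiv_le _).trans h.le_of
    refine (norm_add_le _ _).trans ?_
    linarith

lemma norm_preMeanCurvature_sub_le (h : KernelBounds (truncKernel ψ ε) a C B₁ B₂ B₃) (hε : 0 < ε)
    (hB : 0 < B₁) (V W : VarifoldMeasure d n) [IsFiniteMeasure V] [IsFiniteMeasure W]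
    (hV : V.real univ ≤ N) (y : Euc n) :
    ‖preMeanCurvature ψ ε V y - preMeanCurvature ψ ε W y‖ ≤
      (2 * B₂ + curvatureBound a C ε N * B₁) / ε * bddLipDist V W := by
  have m1 := smoothedMass_nonneg h V y
  have m2 := smoothedMass_nonneg h W y
  have b1 := norm_preMeanCurvature_le h hε V hV y
  have b2 := abs_smoothedMass_sub_le h hB V W y
  have b3 := norm_smoothedFirstVariation_sub_le h hB V W y
  set mV := smoothedMass ψ ε V y
  set mW := smoothedMass ψ ε W y
  set AV := smoothedFirstVariation ψ ε V y
  set AW := smoothedFirstVariation ψ ε W y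
  -- The quotient is differenced so that one factor stays whole as h̃_ε(V), which has the good bound
  -- `curvatureBound`; only one inverse of ε is lost.
  have e : preMeanCurvature ψ ε V y - preMeanCurvature ψ ε W y =
      (mW + ε)⁻¹ • (-(AV - AW) + (mW - mV) • preMeanCurvature ψ ε V y) := by
    have hV0 : mV + ε ≠ 0 := by positivity
    have hW0 : mW + ε ≠ 0 := by positivity
    simp only [preMeanCurvature]
    change -((mV + ε)⁻¹ • AV) - -((mW + ε)⁻¹ • AW) = (mW + ε)⁻¹ • (-(AV - AW) +
      (mW - mV) • -((mV + ε)⁻¹ • AV))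
    have : (mV + ε)⁻¹ = (mW + ε)⁻¹ * (1 + (mW - mV) * (mV + ε)⁻¹) := by
      field_simp
      ring
    conv_lhs => rw [this]
    module
  rw [e, norm_smul, norm_inv, Real.norm_of_nonneg (by positivity : 0 ≤ mW + ε)]
  have c1 : ‖-(AV - AW) + (mW - mV) • preMeanCurvature ψ ε V y‖ ≤
      (2 * B₂ + curvatureBound a C ε N * B₁) * bddLipDist V W := by
    refine (norm_add_le _ _).trans ?_
    rw [norm_neg, norm_smul, Real.norm_eq_abs, abs_sub_comm]
    have : |mV - mW| * ‖preMeanCurvature ψ ε V y‖ ≤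
        B₁ * bddLipDist V W * curvatureBound a C ε N :=
      mul_le_mul b2 b1 (norm_nonneg _) ((abs_nonneg _).trans b2)
    linarith
  calc (mW + ε)⁻¹ * ‖-(AV - AW) + (mW - mV) • preMeanCurvature ψ ε V y‖
      ≤ ε⁻¹ * ((2 * B₂ + curvatureBound a C ε N * B₁) * bddLipDist V W) := by
        gcongr
        linarith
    _ = _ := by ring

lemma fderiv_approxMeanCurvature (h : KernelBounds (truncKernel ψ ε) a C B₁ B₂ B₃) (hε : 0 < ε)
    (V : VarifoldMeasure d n) [IsFiniteMeasure V] (x : Euc n) :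
    fderiv ℝ (approxMeanCurvature ψ ε V) x =
      ∫ y, (fderiv ℝ (truncKernel ψ ε) (x - y)).smulRight (preMeanCurvature ψ ε V y) :=
  (h.hasFDerivAt_conv (continuous_preMeanCurvature h hε V) x).fderiv

/-- The first variation in the direction of the approximate mean curvature is nonpositive. -/
lemma integral_trace_fderiv_nonpos (h : KernelBounds (truncKernel ψ ε) a C B₁ B₂ B₃) (hε : 0 < ε)
    (V : VarifoldMeasure d n) [IsFiniteMeasure V] :
    ∫ p, traceCLM n (p.2.1 * fderiv ℝ (approxMeanCurvature ψ ε V) p.1) ∂V ≤ 0 := by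
  set H := preMeanCurvature ψ ε V with hH
  have hHc : Continuous H := continuous_preMeanCurvature h hε V
  have hHb : ∀ y, ‖H y‖ ≤ curvatureBound a C ε (V.real univ) :=
    norm_preMeanCurvature_le h hε V le_rfl
  set b := curvatureBound a C ε (V.real univ)
  have hb0 : 0 ≤ b := (norm_nonneg _).trans (hHb 0)
  set F : Euc n × Grassmannian d n → Euc n → ℝ := fun p y =>
    inner ℝ (p.2.1 (gradient (truncKernel ψ ε) (p.1 - y))) (H y) with hF
  have e1 : ∀ p : Euc n × Grassmannian d n,
      traceCLM n (p.2.1 * fderiv ℝ (approxMeanCurvature ψ ε V) p.1) = ∫ y, F p y := by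
    intro p
    rw [fderiv_approxMeanCurvature h hε V]
    -- The trace and the left multiplication by S are linear and commute with the integral. Then
    -- tr(S(dΦ ⊗ H)) = dΦ(SH) = ⟨S∇Φ, H⟩ by symmetry of S.
    have := (LinearMap.toContinuousLinearMap ((traceCLM n).toLinearMap.comp
      ({ toFun := fun A => p.2.1 * A
         map_add' := mul_add p.2.1
         map_smul' := fun c A => clm_mul_smul c p.2.1 A } :
        (Euc n →L[ℝ] Euc n) →ₗ[ℝ] (Euc n →L[ℝ] Euc n)))).integral_comp_comm
      (h.integrable_smulRight hHc hHb p.1)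
    refine Eq.trans this.symm (integral_congr_ae (Eventually.of_forall fun y => ?_))
    change traceCLM n (p.2.1 * (fderiv ℝ (truncKernel ψ ε) (p.1 - y)).smulRight (H y)) = F p y
    rw [mul_smulRight, traceCLM_smulRight, hF]
    change _ = inner ℝ (p.2.1 (gradient (truncKernel ψ ε) (p.1 - y))) (H y)
    rw [p.2.inner_apply, inner_gradient_left]
  have hFc : Continuous (Function.uncurry F) :=
    (continuous_apply_gradient h).inner (hHc.comp continuous_snd)
  have hFb : ∀ p y, ‖F p y‖ ≤ ‖fderiv ℝ (truncKernel ψ ε) (p.1 - y)‖ * b := fun p y =>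
    (norm_inner_le_norm _ _).trans
      (mul_le_mul (norm_apply_gradient_le p y) (hHb y) (norm_nonneg _) (norm_nonneg _))
  -- The majorant has a y-integral independent of p, by translation invariance, and V is finite;
  -- this justifies Fubini.
  have hGint : Integrable (fun q : (Euc n × Grassmannian d n) × Euc n =>
      ‖fderiv ℝ (truncKernel ψ ε) (q.1.1 - q.2)‖ * b) (V.prod volume) := by
    have hGc : Continuous fun q : (Euc n × Grassmannian d n) × Euc n =>
        ‖fderiv ℝ (truncKernel ψ ε) (q.1.1 - q.2)‖ * b :=
      ((h.continuous_fderiv.comp ((continuous_fst.comp continuous_fst).sub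
        continuous_snd)).norm).mul continuous_const
    rw [integrable_prod_iff hGc.aestronglyMeasurable]
    refine ⟨Eventually.of_forall fun p =>
      (h.integrable_fderiv.comp_sub_left p.1).norm.mul_const b, ?_⟩
    have : ∀ p : Euc n × Grassmannian d n,
        ∫ y, ‖‖fderiv ℝ (truncKernel ψ ε) (p.1 - y)‖ * b‖ =
          ∫ y, ‖‖fderiv ℝ (truncKernel ψ ε) y‖ * b‖ := fun p =>
      integral_sub_left_eq_self (fun y => ‖‖fderiv ℝ (truncKernel ψ ε) y‖ * b‖) volume p.1
    simp only [this]
    exact integrable_const _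
  have hFint : Integrable (Function.uncurry F) (V.prod volume) :=
    hGint.mono' hFc.aestronglyMeasurable (Eventually.of_forall fun q => hFb q.1 q.2)
  simp only [e1]
  rw [integral_integral_swap hFint]
  refine integral_nonpos fun y => ?_
  -- The outer convolution in h_ε pairs with V through the same kernel as δV ∗ Φ_ε. Integration over
  -- V therefore reproduces δV ∗ Φ_ε, and the integrand is minus a square over a positive
  -- denominator.
  have e2 : ∫ p, F p y ∂V = inner ℝ (H y) (smoothedFirstVariation ψ ε V y) := by
    rw [smoothedFirstVariation, ← integral_inner (integrable_apply_gradient h V y)]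
    exact integral_congr_ae (Eventually.of_forall fun p => real_inner_comm _ _)
  change ∫ p, F p y ∂V ≤ 0
  rw [e2, hH, preMeanCurvature, inner_neg_left, real_inner_smul_left, neg_nonpos]
  have := smoothedMass_nonneg h V y
  exact mul_nonneg (inv_nonneg.2 (by positivity)) real_inner_self_nonneg

/-- In the first constant, `B₃` controls the derivative of the convolution, and also its values
because `B₃` is at least 1; the term with `B₂` controls the Lipschitz constant of the derivative. -/
theorem KernelBounds.velocityLaw (h : KernelBounds (truncKernel ψ ε) a C B₁ B₂ B₃) (hε : 0 < ε)
    (hB : 0 < B₁) (hN : 0 ≤ N) (d : ℕ) :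
    VelocityLaw d ψ ε N (curvatureBound a C ε N * (B₃ + 2 * unitBallVolume n * B₂))
      (B₃ * ((2 * B₂ + curvatureBound a C ε N * B₁) / ε)) := by
  have ha := h.pos
  have hC := h.const_nonneg
  have h2 := h.nonneg₂
  have h3 := h.one_le
  have h30 := h.nonneg₃
  have hv := unitBallVolume_nonneg n
  have hH : 0 < curvatureBound a C ε N := by rw [curvatureBound]; positivity
  have hvB : 0 ≤ 2 * unitBallVolume n * B₂ := by positivity
  have hE : 0 ≤ (2 * B₂ + curvatureBound a C ε N * B₁) / ε := by positivity
  have hfd := fun (V : VarifoldMeasure d n) (_ : IsFiniteMeasure V) =>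
    fderiv_approxMeanCurvature h hε V
  have hc := fun (V : VarifoldMeasure d n) (_ : IsFiniteMeasure V) =>
    continuous_preMeanCurvature h hε V
  have hb := fun (V : VarifoldMeasure d n) (_ : IsFiniteMeasure V) (hV : V.real univ ≤ N) =>
    norm_preMeanCurvature_le h hε V hV
  refine ⟨hN, by positivity, by positivity, ?_, ?_, ?_, ?_, ?_, ?_, ?_⟩
  · intro V _ hV x
    exact (h.hasFDerivAt_conv (hc V ‹_›) x).differentiableAt
  · intro V _ hV x
    refine (h.norm_conv_le (hb V ‹_› hV) x).trans ?_
    nlinarith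
  · intro V _ hV x
    rw [hfd V ‹_›]
    refine (h.norm_fderiv_conv_le (hb V ‹_› hV) x).trans ?_
    nlinarith
  · intro V _ hV x y
    rw [hfd V ‹_›, hfd V ‹_›]
    refine (h.norm_fderiv_conv_sub_le (hc V ‹_›) (hb V ‹_› hV) x y).trans ?_
    refine mul_le_mul_of_nonneg_right ?_ (norm_nonneg _)
    nlinarith
  · intro V W _ _ hV hW x
    have e : approxMeanCurvature ψ ε V x - approxMeanCurvature ψ ε W x =
        ∫ y, truncKernel ψ ε (x - y) • (preMeanCurvature ψ ε V y - preMeanCurvature ψ ε W y) := by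
      simp only [smul_sub]
      exact (integral_sub (h.integrable_smul (hc V ‹_›) (hb V ‹_› hV) x)
        (h.integrable_smul (hc W ‹_›) (hb W ‹_› hW) x)).symm
    rw [e]
    refine (h.norm_conv_le (norm_preMeanCurvature_sub_le h hε hB V W hV) x).trans ?_
    gcongr
    · exact bddLipDist_nonneg V W
    · exact le_mul_of_one_le_left hE h3
  · intro V W _ _ hV hW x
    have e : fderiv ℝ (approxMeanCurvature ψ ε V) x - fderiv ℝ (approxMeanCurvature ψ ε W) x =
        ∫ y, (fderiv ℝ (truncKernel ψ ε) (x - y)).smulRight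
          (preMeanCurvature ψ ε V y - preMeanCurvature ψ ε W y) := by
      rw [hfd V ‹_›, hfd W ‹_›, ← integral_sub (h.integrable_smulRight (hc V ‹_›) (hb V ‹_› hV) x)
        (h.integrable_smulRight (hc W ‹_›) (hb W ‹_› hW) x)]
      refine integral_congr_ae (Eventually.of_forall fun y => ?_)
      ext v i
      simp [mul_sub]
    rw [e]
    refine (h.norm_fderiv_conv_le (norm_preMeanCurvature_sub_le h hε hB V W hV) x).trans ?_
    rw [mul_assoc]
  · intro V _ _
    exact integral_trace_fderiv_nonpos h hε V

end Curvature

/-! ### Bounds for the truncated Gaussian. -/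

/-- The unnormalized Gaussian `exp (-s|x|²/2)`. -/
def expKernel (s : ℝ) (x : Euc n) : ℝ := Real.exp (-(s / 2 * ‖x‖ ^ 2))

section expKernel

variable {s : ℝ}

lemma expKernel_pos (s : ℝ) (x : Euc n) : 0 < expKernel s x := Real.exp_pos _

lemma expKernel_le_one (hs : 0 ≤ s) (x : Euc n) : expKernel s x ≤ 1 :=
  Real.exp_le_one_iff.2 (neg_nonpos.2 (by positivity))

lemma contDiff_expKernel (s : ℝ) : ContDiff ℝ ∞ (expKernel s : Euc n → ℝ) :=
  (contDiff_const.mul (contDiff_norm_sq ℝ)).neg.exp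

lemma hasFDerivAt_expKernel (s : ℝ) (x : Euc n) :
    HasFDerivAt (expKernel s) (-(s * expKernel s x) • innerSL ℝ x) x := by
  have h := (((hasStrictFDerivAt_norm_sq x).hasFDerivAt.const_mul (s / 2)).neg).exp
  refine h.congr_fderiv ?_
  ext y
  change expKernel s x * -(s / 2 * (2 • innerSL ℝ x y)) = -(s * expKernel s x) * innerSL ℝ x y
  rw [nsmul_eq_mul]
  push_cast
  ring

/-- For s ≥ 1 one has |x| ≤ 1 + s|x|²/2 ≤ exp(s|x|²/2). -/
lemma norm_mul_expKernel_le (hs : 1 ≤ s) (x : Euc n) : ‖x‖ * expKernel s x ≤ 1 := by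
  have h1 : s / 2 * ‖x‖ ^ 2 + 1 ≤ Real.exp (s / 2 * ‖x‖ ^ 2) := Real.add_one_le_exp _
  have h2 : ‖x‖ ≤ Real.exp (s / 2 * ‖x‖ ^ 2) := by
    nlinarith [sq_nonneg (‖x‖ - 1), mul_nonneg (sub_nonneg.2 hs) (sq_nonneg ‖x‖)]
  rw [expKernel, Real.exp_neg, ← div_eq_mul_inv]
  exact (div_le_one (Real.exp_pos _)).2 h2

lemma abs_expKernel_sub_le (hs : 1 ≤ s) (x y : Euc n) :
    |expKernel s x - expKernel s y| ≤ s * ‖x - y‖ := by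
  refine convex_univ.norm_image_sub_le_of_norm_hasFDerivWithin_le (𝕜 := ℝ) (f := expKernel s)
    (fun z _ => (hasFDerivAt_expKernel s z).hasFDerivWithinAt) (fun z _ => ?_)
    (mem_univ y) (mem_univ x)
  rw [norm_smul, innerSL_apply_norm, norm_neg, Real.norm_of_nonneg
    (mul_nonneg (by linarith) (expKernel_pos s z).le)]
  nlinarith [norm_mul_expKernel_le hs z]

end expKernel

namespace IsCutoff

variable {K : ℝ} {ψ : Euc n → ℝ}

lemma differentiable (h : IsCutoff K ψ) : Differentiable ℝ ψ :=
  h.smooth.differentiable (by simp)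

lemma norm_fderiv_le (h : IsCutoff K ψ) (x : Euc n) : ‖fderiv ℝ ψ x‖ ≤ K := by
  rw [← norm_gradient]; exact h.gradient_le x

lemma const_nonneg (h : IsCutoff K ψ) : 0 ≤ K := (norm_nonneg _).trans (h.norm_fderiv_le 0)

/-- The cutoff attains its minimum at such points, which covers the sphere |x| = 1 as well. The next
lemma does the same with the maximum. -/
lemma fderiv_eq_zero_of_one_le (h : IsCutoff K ψ) {x : Euc n} (hx : 1 ≤ ‖x‖) :
    fderiv ℝ ψ x = 0 :=
  IsLocalMin.fderiv_eq_zero (Eventually.of_forall fun y => (h.eq_zero x hx).trans_le (h.nonneg y))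

lemma fderiv_eq_zero_of_le_half (h : IsCutoff K ψ) {x : Euc n} (hx : ‖x‖ ≤ 1 / 2) :
    fderiv ℝ ψ x = 0 :=
  IsLocalMax.fderiv_eq_zero
    (Eventually.of_forall fun y => (h.le_one y).trans_eq (h.eq_one x hx).symm)

lemma norm_smul_le (h : IsCutoff K ψ) (x : Euc n) : ‖ψ x • x‖ ≤ ψ x := by
  rw [norm_smul, Real.norm_of_nonneg (h.nonneg x)]
  rcases le_total ‖x‖ 1 with hx | hx
  · exact mul_le_of_le_one_right (h.nonneg x) hx
  · rw [h.eq_zero x hx, zero_mul]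

/-- The derivative of the truncated Gaussian contains x only through ψ(x)x, which is globally
bounded and Lipschitz. -/
lemma norm_smul_sub_le (h : IsCutoff K ψ) (x y : Euc n) :
    ‖ψ x • x - ψ y • y‖ ≤ (K + 1) * ‖x - y‖ := by
  refine convex_univ.norm_image_sub_le_of_norm_hasFDerivWithin_le (𝕜 := ℝ)
    (f := fun z : Euc n => ψ z • z)
    (fun z _ => ((h.differentiable z).hasFDerivAt.smul (hasFDerivAt_id z)).hasFDerivWithinAt)
    (fun z _ => ?_) (mem_univ y) (mem_univ x)
  refine (norm_add_le _ _).trans ?_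
  rw [norm_smul, ContinuousLinearMap.norm_smulRight_apply, Real.norm_of_nonneg (h.nonneg z)]
  have h1 : ψ z * ‖ContinuousLinearMap.id ℝ (Euc n)‖ ≤ 1 :=
    mul_le_one₀ (h.le_one z) (norm_nonneg _) ContinuousLinearMap.norm_id_le
  have h2 : ‖fderiv ℝ ψ z‖ * ‖z‖ ≤ K := by
    rcases le_total ‖z‖ 1 with hz | hz
    · exact (mul_le_of_le_one_right (norm_nonneg _) hz).trans (h.norm_fderiv_le z)
    · rw [h.fderiv_eq_zero_of_one_le hz, norm_zero, zero_mul]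
      exact h.const_nonneg
  exact (add_le_add h1 h2).trans_eq (add_comm _ _)

lemma norm_fderiv_sub_le (h : IsCutoff K ψ) (x y : Euc n) :
    ‖fderiv ℝ ψ x - fderiv ℝ ψ y‖ ≤ K * ‖x - y‖ :=
  convex_univ.norm_image_sub_le_of_norm_fderiv_le (𝕜 := ℝ)
    (fun z _ => (h.smooth.fderiv_right (m := 1) (by norm_cast)).differentiable one_ne_zero z)
    (fun z _ => h.hessian_le z) (mem_univ y) (mem_univ x)

end IsCutoff

/-- The logarithmic part of the derivative of `ψ · exp (-s|x|²/2)`. -/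
def cutoffField (ψ : Euc n → ℝ) (s : ℝ) (x : Euc n) : Euc n →L[ℝ] ℝ :=
  fderiv ℝ ψ x - s • innerSL ℝ (ψ x • x)

namespace IsCutoff

variable {K s : ℝ} {ψ : Euc n → ℝ}

lemma fderiv_mul_expKernel (h : IsCutoff K ψ) (s : ℝ) (x : Euc n) :
    fderiv ℝ (fun z => ψ z * expKernel s z) x = expKernel s x • cutoffField ψ s x := by
  refine ((h.differentiable x).hasFDerivAt.mul (hasFDerivAt_expKernel s x)).fderiv.trans ?_
  ext y
  change ψ x * (-(s * expKernel s x) * inner ℝ x y) + expKernel s x * fderiv ℝ ψ x y =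
    expKernel s x * (fderiv ℝ ψ x y - s * inner ℝ (ψ x • x) y)
  rw [real_inner_smul_left]
  ring

lemma norm_cutoffField_le (h : IsCutoff K ψ) (hs : 0 ≤ s) (x : Euc n) :
    ‖cutoffField ψ s x‖ ≤ ‖fderiv ℝ ψ x‖ + s * ψ x := by
  refine (norm_sub_le _ _).trans (add_le_add le_rfl ?_)
  rw [norm_smul, innerSL_apply_norm, Real.norm_of_nonneg hs]
  exact mul_le_mul_of_nonneg_left (h.norm_smul_le x) hs

lemma norm_cutoffField_le_const (h : IsCutoff K ψ) (hs : 0 ≤ s) (x : Euc n) :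
    ‖cutoffField ψ s x‖ ≤ K + s :=
  (h.norm_cutoffField_le hs x).trans
    (add_le_add (h.norm_fderiv_le x) (mul_le_of_le_one_right hs (h.le_one x)))

lemma norm_cutoffField_sub_le (h : IsCutoff K ψ) (hs : 0 ≤ s) (x y : Euc n) :
    ‖cutoffField ψ s x - cutoffField ψ s y‖ ≤ (K + s * (K + 1)) * ‖x - y‖ := by
  have e : cutoffField ψ s x - cutoffField ψ s y =
      (fderiv ℝ ψ x - fderiv ℝ ψ y) - s • innerSL ℝ (ψ x • x - ψ y • y) := by
    rw [cutoffField, cutoffField, map_sub, smul_sub]; abel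
  rw [e]
  refine (norm_sub_le _ _).trans ?_
  rw [norm_smul, innerSL_apply_norm, Real.norm_of_nonneg hs, add_mul, mul_assoc]
  exact add_le_add (h.norm_fderiv_sub_le x y)
    (mul_le_mul_of_nonneg_left (h.norm_smul_sub_le x y) hs)

lemma norm_smul_cutoffField_sub_le (h : IsCutoff K ψ) (hs : 1 ≤ s) (x y : Euc n) :
    ‖expKernel s x • cutoffField ψ s x - expKernel s y • cutoffField ψ s y‖ ≤
      3 * (K + 1) * s ^ 2 * ‖x - y‖ := by
  have hK := h.const_nonneg
  have hs0 : 0 ≤ s := by linarith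
  have e : expKernel s x • cutoffField ψ s x - expKernel s y • cutoffField ψ s y =
      expKernel s x • (cutoffField ψ s x - cutoffField ψ s y) +
        (expKernel s x - expKernel s y) • cutoffField ψ s y := by
    ext z
    change expKernel s x * cutoffField ψ s x z - expKernel s y * cutoffField ψ s y z =
      expKernel s x * (cutoffField ψ s x z - cutoffField ψ s y z) +
        (expKernel s x - expKernel s y) * cutoffField ψ s y z
    ring
  rw [e]
  refine (norm_add_le _ _).trans ?_
  rw [norm_smul, norm_smul, Real.norm_of_nonneg (expKernel_pos s x).le, Real.norm_eq_abs]
  have h1 : expKernel s x * ‖cutoffField ψ s x - cutoffField ψ s y‖ ≤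
      (K + s * (K + 1)) * ‖x - y‖ :=
    (mul_le_of_le_one_left (norm_nonneg _) (expKernel_le_one hs0 x)).trans
      (h.norm_cutoffField_sub_le hs0 x y)
  have h2 : |expKernel s x - expKernel s y| * ‖cutoffField ψ s y‖ ≤ s * ‖x - y‖ * (K + s) :=
    mul_le_mul (abs_expKernel_sub_le hs x y) (h.norm_cutoffField_le_const hs0 y)
      (norm_nonneg _) (by positivity)
  have h3 : K + s * (K + 1) + s * (K + s) ≤ 3 * (K + 1) * s ^ 2 := by
    have : s ≤ s ^ 2 := by nlinarith
    nlinarith [mul_nonneg hK (sub_nonneg.2 this), mul_nonneg hK (sub_nonneg.2 hs)]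
  calc _ ≤ (K + s * (K + 1)) * ‖x - y‖ + s * ‖x - y‖ * (K + s) := add_le_add h1 h2
    _ = (K + s * (K + 1) + s * (K + s)) * ‖x - y‖ := by ring
    _ ≤ _ := mul_le_mul_of_nonneg_right h3 (norm_nonneg _)

lemma continuous_mul_expKernel (h : IsCutoff K ψ) (s : ℝ) :
    Continuous fun x => ψ x * expKernel s x :=
  h.smooth.continuous.mul (contDiff_expKernel s).continuous

lemma support_mul_expKernel_subset (h : IsCutoff K ψ) (s : ℝ) :
    Function.support (fun x => ψ x * expKernel s x) ⊆ Metric.closedBall 0 1 := by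
  intro x hx
  rw [mem_closedBall_zero_iff]
  by_contra! hlt
  exact hx (by simp only [h.eq_zero x hlt.le, zero_mul])

lemma integrable_mul_expKernel (h : IsCutoff K ψ) (s : ℝ) :
    Integrable fun x => ψ x * expKernel s x :=
  (h.continuous_mul_expKernel s).integrable_of_hasCompactSupport
    (HasCompactSupport.of_support_subset_isCompact (isCompact_closedBall 0 1)
      (h.support_mul_expKernel_subset s))

end IsCutoff

lemma unitBallVolume_pos (n : ℕ) : 0 < unitBallVolume n :=
  ENNReal.toReal_pos (Metric.measure_closedBall_pos _ _ one_pos).ne'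
    (isCompact_closedBall _ _).measure_lt_top.ne

/-- The constant in the bound of the normalizing factor of the truncated Gaussian. -/
def normalizerConst (n : ℕ) : ℝ := Real.exp (1 / 8) * 2 ^ n / unitBallVolume n

lemma normalizerConst_pos (n : ℕ) : 0 < normalizerConst n :=
  div_pos (by positivity) (unitBallVolume_pos n)

namespace IsCutoff

variable {K q : ℝ} {ψ : Euc n → ℝ}

/-- On the ball of radius 1/(2q) the cutoff equals 1 and the exponent is at least -1/8. With q = ε⁻¹
this bounds the normalizing factor by a multiple of ε^(-n). -/
lemma le_integral_mul_expKernel (h : IsCutoff K ψ) (hq : 1 ≤ q) :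
    (normalizerConst n * q ^ n)⁻¹ ≤ ∫ x, ψ x * expKernel (q ^ 2) x := by
  have hq0 : 0 < q := by linarith
  set r : ℝ := (2 * q)⁻¹ with hr
  have hr0 : 0 ≤ r := by positivity
  have hr2 : r ≤ 1 / 2 := by
    rw [hr, mul_inv, one_div]
    exact mul_le_of_le_one_right (by norm_num) (inv_le_one_of_one_le₀ hq)
  have key : Real.exp (-(1 / 8)) * volume.real (Metric.closedBall (0 : Euc n) r) ≤
      ∫ x in Metric.closedBall (0 : Euc n) r, ψ x * expKernel (q ^ 2) x := by
    refine setIntegral_ge_of_const_le_real Metric.isClosed_closedBall.measurableSet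
      (isCompact_closedBall _ _).measure_lt_top.ne (fun x hx => ?_)
      (h.integrable_mul_expKernel _).integrableOn
    rw [mem_closedBall_zero_iff] at hx
    rw [h.eq_one x (hx.trans hr2), one_mul, expKernel]
    refine Real.exp_le_exp.2 (neg_le_neg ?_)
    calc q ^ 2 / 2 * ‖x‖ ^ 2 ≤ q ^ 2 / 2 * r ^ 2 := by gcongr
      _ = 1 / 8 := by rw [hr]; field_simp; norm_num
  have hv : volume.real (Metric.closedBall (0 : Euc n) r) = r ^ n * unitBallVolume n := by
    rw [Measure.addHaar_real_closedBall' _ _ hr0, finrank_euclideanSpace_fin, unitBallVolume]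
  have hω := unitBallVolume_pos n
  have e : (normalizerConst n * q ^ n)⁻¹ =
      Real.exp (-(1 / 8)) * volume.real (Metric.closedBall (0 : Euc n) r) := by
    rw [hv, Real.exp_neg, normalizerConst, hr, inv_pow, mul_pow]
    field_simp
  rw [e]
  exact key.trans (setIntegral_le_integral (h.integrable_mul_expKernel _)
    (Eventually.of_forall fun x => mul_nonneg (h.nonneg x) (expKernel_pos _ x).le))

end IsCutoff

lemma gaussKernel_eq {ε : ℝ} (hε : 0 < ε) (x : Euc n) :
    gaussKernel ε x = 1 / (2 * Real.pi * ε ^ 2) ^ ((n : ℝ) / 2) * expKernel (ε⁻¹ ^ 2) x := by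
  rw [gaussKernel, expKernel]
  congr 2
  field_simp

/-- The Gaussian prefactor cancels in the normalization, so real powers of ε disappear from all
later estimates. -/
lemma truncKernel_eq {ε : ℝ} (hε : 0 < ε) (ψ : Euc n → ℝ) (x : Euc n) :
    truncKernel ψ ε x =
      (∫ y, ψ y * expKernel (ε⁻¹ ^ 2) y)⁻¹ * (ψ x * expKernel (ε⁻¹ ^ 2) x) := by
  have hc : 0 < 1 / (2 * Real.pi * ε ^ 2) ^ ((n : ℝ) / 2) := by positivity
  rw [truncKernel]
  simp only [gaussKernel_eq hε, mul_left_comm _ (1 / (2 * Real.pi * ε ^ 2) ^ ((n : ℝ) / 2))]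
  rw [integral_const_mul, one_div (_ * _), mul_inv]
  field_simp

/-- The constant bounding the derivative of the cutoff against the Gaussian tail. -/
def tailConst (n : ℕ) (K : ℝ) : ℝ := normalizerConst n * K * (8 ^ n * n.factorial)

/-- The common constant in the bounds of the truncated Gaussian. -/
def kernelConst (n : ℕ) (K : ℝ) : ℝ :=
  1 + 3 * normalizerConst n * (K + 1) + tailConst n K * (1 + unitBallVolume n)

/-- It follows from t^n / n! ≤ exp t at t = q²/8, together with q^n ≤ q^(2n). -/
lemma pow_mul_exp_neg_le {q : ℝ} (hq : 1 ≤ q) (n : ℕ) :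
    q ^ n * Real.exp (-(q ^ 2 / 8)) ≤ 8 ^ n * n.factorial := by
  have h1 := Real.pow_div_factorial_le_exp (q ^ 2 / 8) (by positivity) n
  rw [div_le_iff₀ (by positivity), div_pow, div_le_iff₀ (by positivity)] at h1
  have h2 : q ^ n ≤ (q ^ 2) ^ n := pow_le_pow_left₀ (by linarith) (by nlinarith) n
  rw [Real.exp_neg, ← div_eq_mul_inv, div_le_iff₀ (Real.exp_pos _)]
  linarith

/-- With q = ε⁻¹, the normalizing factor costs q^n, and each derivative of the Gaussian is bounded
at a cost of q². The sharper bounds come from separating the term with ∇ψ: it is supported in 1/2 ≤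
|x| ≤ 1, where the Gaussian is at most exp(-q²/8) and outweighs q^n. What remains is at most q²Φ_ε,
whose integral is q². -/
theorem IsCutoff.kernelBounds {K ε : ℝ} {ψ : Euc n → ℝ} (h : IsCutoff K ψ) (hε : 0 < ε)
    (hε1 : ε < 1) :
    KernelBounds (truncKernel ψ ε) (ε⁻¹ ^ 2) (kernelConst n K) (kernelConst n K * ε⁻¹ ^ (n + 2))
      (kernelConst n K * ε⁻¹ ^ (n + 4)) (kernelConst n K * ε⁻¹ ^ 2) := by
  have hK := h.const_nonneg
  obtain ⟨q, hqε⟩ : ∃ q, q = ε⁻¹ := ⟨_, rfl⟩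
  have hq : 1 ≤ q := hqε ▸ (one_le_inv₀ hε).2 hε1.le
  have hq0 : 0 < q := by linarith
  have hs : 1 ≤ q ^ 2 := one_le_pow₀ hq
  obtain ⟨c, hc⟩ : ∃ c, c = (∫ y, ψ y * expKernel (q ^ 2) y)⁻¹ := ⟨_, rfl⟩
  have hν := normalizerConst_pos n
  have hω := unitBallVolume_pos n
  have hZ := h.le_integral_mul_expKernel hq
  have hZ0 : 0 < ∫ y, ψ y * expKernel (q ^ 2) y :=
    (inv_pos.2 (by positivity)).trans_le hZ
  have hc0 : 0 < c := hc ▸ inv_pos.2 hZ0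
  have hcν : c ≤ normalizerConst n * q ^ n := by
    rw [hc]; exact inv_le_of_inv_le₀ (by positivity) hZ
  have hT : 0 ≤ tailConst n K := by unfold tailConst; positivity
  have hTA : tailConst n K ≤ kernelConst n K := by
    unfold kernelConst
    nlinarith [mul_pos hν hω, mul_nonneg hν.le hK, mul_nonneg hT hω.le]
  have hνA : 3 * normalizerConst n * (K + 1) ≤ kernelConst n K := by
    have := mul_nonneg hT (by linarith : 0 ≤ 1 + unitBallVolume n)
    unfold kernelConst; linarith
  have hA1 : 1 + tailConst n K * unitBallVolume n ≤ kernelConst n K := by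
    have : 0 ≤ 3 * normalizerConst n * (K + 1) := by positivity
    unfold kernelConst; linarith
  have hA0 : 1 ≤ kernelConst n K := by nlinarith [mul_nonneg hT hω.le]
  have hΦ : truncKernel ψ ε = fun x => c * (ψ x * expKernel (q ^ 2) x) := by
    funext x; rw [truncKernel_eq hε, ← hqε, ← hc]
  rw [← hqε, hΦ]
  set s := q ^ 2 with hs_def
  have hs0 : 0 ≤ s := by linarith
  have hsm : ContDiff ℝ 1 fun x => c * (ψ x * expKernel s x) :=
    contDiff_const.mul ((h.smooth.mul (contDiff_expKernel s)).of_le (by norm_cast))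
  have hd : ∀ x, fderiv ℝ (fun x => c * (ψ x * expKernel s x)) x =
      c • expKernel s x • cutoffField ψ s x := by
    intro x
    rw [← h.fderiv_mul_expKernel s x]
    exact fderiv_const_mul ((h.differentiable x).mul (hasFDerivAt_expKernel s x).differentiableAt) c
  have hsupp : tsupport (fun x => c * (ψ x * expKernel s x)) ⊆ Metric.closedBall 0 1 :=
    closure_minimal (fun x hx => h.support_mul_expKernel_subset s (right_ne_zero_of_mul hx))
      Metric.isClosed_closedBall
  have hnn : ∀ x, 0 ≤ c * (ψ x * expKernel s x) := fun x =>
    mul_nonneg hc0.le (mul_nonneg (h.nonneg x) (expKernel_pos s x).le)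
  have hnd : ∀ x, ‖fderiv ℝ (fun x => c * (ψ x * expKernel s x)) x‖ =
      c * (expKernel s x * ‖cutoffField ψ s x‖) := fun x => by
    rw [hd, norm_smul, norm_smul, Real.norm_of_nonneg hc0.le,
      Real.norm_of_nonneg (expKernel_pos s x).le]
  have hcA : c * (K + s) ≤ kernelConst n K * q ^ (n + 2) := by
    calc c * (K + s) ≤ (normalizerConst n * q ^ n) * ((K + 1) * s) := by
          gcongr; nlinarith
      _ = normalizerConst n * (K + 1) * q ^ (n + 2) := by rw [hs_def]; ring
      _ ≤ _ := by
        refine mul_le_mul_of_nonneg_right ?_ (by positivity)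
        nlinarith [mul_nonneg hν.le (by linarith : 0 ≤ K + 1)]
  have htail : ∀ x, c * (expKernel s x * ‖fderiv ℝ ψ x‖) ≤ tailConst n K := by
    intro x
    rcases le_total ‖x‖ (1 / 2) with hx | hx
    · rw [h.fderiv_eq_zero_of_le_half hx, norm_zero, mul_zero, mul_zero]
      exact hT
    · have hE : expKernel s x ≤ Real.exp (-(q ^ 2 / 8)) := by
        refine Real.exp_le_exp.2 (neg_le_neg ?_)
        have : (1 / 2 : ℝ) ^ 2 ≤ ‖x‖ ^ 2 := by gcongr
        nlinarith
      calc c * (expKernel s x * ‖fderiv ℝ ψ x‖)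
          ≤ (normalizerConst n * q ^ n) * (Real.exp (-(q ^ 2 / 8)) * K) := by
            have := h.norm_fderiv_le x
            have := expKernel_pos s x
            gcongr
        _ = normalizerConst n * K * (q ^ n * Real.exp (-(q ^ 2 / 8))) := by ring
        _ ≤ _ := mul_le_mul_of_nonneg_left (pow_mul_exp_neg_le hq n) (by positivity)
  have hlog : ∀ x, ‖fderiv ℝ (fun x => c * (ψ x * expKernel s x)) x‖ ≤
      s * (c * (ψ x * expKernel s x)) + c * (expKernel s x * ‖fderiv ℝ ψ x‖) := by
    intro x
    rw [hnd]
    have := mul_le_mul_of_nonneg_left (h.norm_cutoffField_le hs0 x)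
      (mul_nonneg hc0.le (expKernel_pos s x).le)
    nlinarith
  have hint : Integrable fun x => c * (ψ x * expKernel s x) :=
    (h.integrable_mul_expKernel s).const_mul c
  have hI : ∫ x, c * (ψ x * expKernel s x) = 1 := by
    rw [integral_const_mul, hc, inv_mul_cancel₀ hZ0.ne']
  refine ⟨hsm, hsupp, hnn, hI, fun x => ?_, fun x => ?_, fun x y => ?_, fun x => ?_, ?_, ?_, ?_,
    by positivity, by linarith⟩
  · refine le_trans ?_ hcA
    refine mul_le_mul_of_nonneg_left ?_ hc0.le
    exact (mul_le_one₀ (h.le_one x) (expKernel_pos s x).le (expKernel_le_one hs0 x)).trans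
      (by linarith)
  · rw [hnd]
    refine le_trans ?_ hcA
    refine mul_le_mul_of_nonneg_left ?_ hc0.le
    exact (mul_le_of_le_one_left (norm_nonneg _) (expKernel_le_one hs0 x)).trans
      (h.norm_cutoffField_le_const hs0 x)
  · rw [hd, hd, ← smul_sub, norm_smul, Real.norm_of_nonneg hc0.le]
    calc _ ≤ c * (3 * (K + 1) * s ^ 2 * ‖x - y‖) :=
          mul_le_mul_of_nonneg_left (h.norm_smul_cutoffField_sub_le hs x y) hc0.le
      _ ≤ (normalizerConst n * q ^ n) * (3 * (K + 1) * s ^ 2 * ‖x - y‖) := by gcongr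
      _ = 3 * normalizerConst n * (K + 1) * (q ^ (n + 4) * ‖x - y‖) := by rw [hs_def]; ring
      _ ≤ kernelConst n K * (q ^ (n + 4) * ‖x - y‖) := by gcongr
      _ = _ := by ring
  · exact (hlog x).trans (add_le_add le_rfl ((htail x).trans hTA))
  · have hbd : ∀ x, ‖fderiv ℝ (fun x => c * (ψ x * expKernel s x)) x‖ ≤
        s * (c * (ψ x * expKernel s x)) +
          (Metric.closedBall (0 : Euc n) 1).indicator (fun _ => tailConst n K) x := by
      intro x
      refine (hlog x).trans (add_le_add le_rfl ?_)
      by_cases hx : x ∈ Metric.closedBall (0 : Euc n) 1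
      · rw [indicator_of_mem hx]; exact htail x
      · rw [indicator_of_notMem hx, h.fderiv_eq_zero_of_one_le, norm_zero, mul_zero, mul_zero]
        rw [mem_closedBall_zero_iff] at hx
        linarith
    have hi : Integrable ((Metric.closedBall (0 : Euc n) 1).indicator fun _ => tailConst n K) :=
      (integrable_indicator_iff Metric.isClosed_closedBall.measurableSet).2
        (integrableOn_const (isCompact_closedBall _ _).measure_lt_top.ne)
    have hfi : Integrable fun x => ‖fderiv ℝ (fun x => c * (ψ x * expKernel s x)) x‖ :=
      ((hsm.continuous_fderiv one_ne_zero).integrable_of_hasCompactSupport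
        ((HasCompactSupport.of_support_subset_isCompact (isCompact_closedBall 0 1)
          ((subset_tsupport _).trans hsupp)).fderiv ℝ)).norm
    calc _ ≤ ∫ x, (s * (c * (ψ x * expKernel s x)) +
          (Metric.closedBall (0 : Euc n) 1).indicator (fun _ => tailConst n K) x) :=
          integral_mono hfi ((hint.const_mul s).add hi) hbd
      _ = s + tailConst n K * unitBallVolume n := by
        rw [integral_add (hint.const_mul s) hi, integral_const_mul, hI, mul_one,
          integral_indicator Metric.isClosed_closedBall.measurableSet, setIntegral_const,
          smul_eq_mul, unitBallVolume, mul_comm (volume.real _)]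
      _ ≤ kernelConst n K * s := by
        nlinarith [mul_nonneg hT hω.le, mul_nonneg (mul_nonneg hT hω.le) (sub_nonneg.2 hs)]
  · nlinarith
  · gcongr
    norm_num

/-! ### The exponent of ε and the conclusion. -/

lemma one_le_kernelConst {K : ℝ} (hK : 0 ≤ K) (n : ℕ) : 1 ≤ kernelConst n K := by
  have := normalizerConst_pos n
  have := unitBallVolume_pos n
  have : 0 ≤ tailConst n K * (1 + unitBallVolume n) := by unfold tailConst; positivity
  have : 0 ≤ 3 * normalizerConst n * (K + 1) := by positivity
  unfold kernelConst
  linarith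

/-- The constant in the stability estimate. -/
def stabilityConst (n : ℕ) (A : ℝ) : ℝ :=
  8 * jacConst n * (2 * A ^ 2 * (1 + 2 * unitBallVolume n) + 4 * A ^ 3)

/-- Power counting with q = ε⁻¹: h̃_ε is of order N q², so the velocity constant is of order N
q^(n+6). The dependence constant is of order N q^(n+7), and multiplied by the mass `N` it dominates.
-/
lemma rate_le {A N ε : ℝ} (hA : 1 ≤ A) (hN : 1 ≤ N) (hε : 0 < ε) (hε1 : ε < 1) (n : ℕ) :
    VelocityLaw.rate n N
      (curvatureBound (ε⁻¹ ^ 2) A ε N *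
        (A * ε⁻¹ ^ 2 + 2 * unitBallVolume n * (A * ε⁻¹ ^ (n + 4))))
      (A * ε⁻¹ ^ 2 * ((2 * (A * ε⁻¹ ^ (n + 4)) +
        curvatureBound (ε⁻¹ ^ 2) A ε N * (A * ε⁻¹ ^ (n + 2))) / ε)) ≤
      stabilityConst n A * N ^ 2 * ε⁻¹ ^ (n + 7) := by
  rw [curvatureBound, div_eq_mul_inv, div_eq_mul_inv]
  obtain ⟨q, hq⟩ : ∃ q, q = ε⁻¹ := ⟨_, rfl⟩
  have hq1 : 1 ≤ q := hq ▸ (one_le_inv₀ hε).2 hε1.le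
  rw [← hq]
  have hq0 : 0 ≤ q := by linarith
  have hω := unitBallVolume_nonneg n
  have hJ := zero_le_one.trans (one_le_jacConst n)
  have hAN : 1 ≤ A * N := one_le_mul_of_one_le_of_one_le hA hN
  have hA0 : 0 ≤ A := by linarith
  have hN0 : 0 ≤ N := by linarith
  have hqq : q ≤ q ^ 2 := le_self_pow₀ hq1 two_ne_zero
  have hH : q ^ 2 + A * N * q ≤ 2 * (A * N) * q ^ 2 := by
    nlinarith [mul_le_mul_of_nonneg_left hqq (by positivity : 0 ≤ A * N),
      mul_le_mul_of_nonneg_right hAN (sq_nonneg q)]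
  have hR : (q ^ 2 + A * N * q) * (A * q ^ 2 + 2 * unitBallVolume n * (A * q ^ (n + 4))) ≤
      2 * A ^ 2 * (1 + 2 * unitBallVolume n) * (N ^ 2 * q ^ (n + 7)) := by
    have h1 : q ^ 2 ≤ q ^ (n + 4) := pow_le_pow_right₀ hq1 (by omega)
    have h2 : q ^ (n + 6) ≤ q ^ (n + 7) := pow_le_pow_right₀ hq1 (by omega)
    have h3 : N ≤ N ^ 2 := le_self_pow₀ hN two_ne_zero
    calc _ ≤ (2 * (A * N) * q ^ 2) *
          (A * q ^ (n + 4) + 2 * unitBallVolume n * (A * q ^ (n + 4))) := by gcongr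
      _ = 2 * A ^ 2 * (1 + 2 * unitBallVolume n) * (N * q ^ (n + 6)) := by ring
      _ ≤ _ := by gcongr
  have hD : A * q ^ 2 * ((2 * (A * q ^ (n + 4)) +
      (q ^ 2 + A * N * q) * (A * q ^ (n + 2))) * q) * N ≤ 4 * A ^ 3 * (N ^ 2 * q ^ (n + 7)) := by
    have h1 : 2 * A ≤ 2 * (A ^ 2 * N) := by nlinarith
    calc _ ≤ A * q ^ 2 * ((2 * (A * q ^ (n + 4)) +
          (2 * (A * N) * q ^ 2) * (A * q ^ (n + 2))) * q) * N := by gcongr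
      _ = A * N * q ^ (n + 7) * (2 * A) + A * N * q ^ (n + 7) * (2 * (A ^ 2 * N)) := by ring
      _ ≤ A * N * q ^ (n + 7) * (2 * (A ^ 2 * N)) + A * N * q ^ (n + 7) * (2 * (A ^ 2 * N)) := by
          gcongr
      _ = _ := by ring
  rw [VelocityLaw.rate, stabilityConst]
  calc _ ≤ 8 * jacConst n * (2 * A ^ 2 * (1 + 2 * unitBallVolume n) * (N ^ 2 * q ^ (n + 7)) +
        4 * A ^ 3 * (N ^ 2 * q ^ (n + 7))) := by gcongr
    _ = _ := by ring

lemma isFiniteMeasure_of_massMeasure_le {V : VarifoldMeasure d n} {M : ℝ}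
    (h : massMeasure V univ ≤ ENNReal.ofReal M) : IsFiniteMeasure V := by
  rw [massMeasure, Measure.map_apply measurable_fst MeasurableSet.univ, preimage_univ] at h
  exact ⟨h.trans_lt ENNReal.ofReal_lt_top⟩

lemma measureReal_univ_le_of_massMeasure_le {V : VarifoldMeasure d n} {M : ℝ} (hM : 0 ≤ M)
    (h : massMeasure V univ ≤ ENNReal.ofReal M) : V.real univ ≤ M := by
  rw [massMeasure, Measure.map_apply measurable_fst MeasurableSet.univ, preimage_univ] at h
  exact ENNReal.toReal_le_of_le_ofReal hM h

lemma exists_measure_compl_closedBall_eq_zero {V : VarifoldMeasure d n}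
    (h : IsCompact V.support) : ∃ ρ : ℝ, V (Metric.closedBall 0 ρ ×ˢ univ)ᶜ = 0 := by
  obtain ⟨ρ, hρ⟩ := (h.image continuous_fst).isBounded.subset_closedBall 0
  refine ⟨ρ, measure_mono_null (compl_subset_compl.2 fun p hp => ?_) Measure.measure_compl_support⟩
  exact ⟨hρ (mem_image_of_mem _ hp), mem_univ _⟩

end

theorem proposition4p3 (n : ℕ) (hn : 2 ≤ n) (K : ℝ) :
    ∃ c₅ : ℝ, 0 < c₅ ∧
      ∀ d : ℕ, 1 ≤ d → d ≤ n →
      ∀ ψ : Euc n → ℝ, IsCutoff K ψ →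
      ∀ ε : ℝ, 0 < ε → ε < 1 →
      ∀ M : ℝ, 1 ≤ M →
      ∀ V₀ W₀ : VarifoldMeasure d n,
        IsLocallyFiniteMeasure V₀ → IsLocallyFiniteMeasure W₀ →
        IsCompact V₀.support → IsCompact W₀.support →
        massMeasure V₀ univ ≤ ENNReal.ofReal M → massMeasure W₀ univ ≤ ENNReal.ofReal M →
        -- the approximate mean curvature flows starting from `V₀` and `W₀` exist,
        (∃ V, IsApproxMCF ψ ε V₀ V) ∧ (∃ W, IsApproxMCF ψ ε W₀ W) ∧
        -- and they satisfy the stability estimate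
        ∀ V W : unitInterval → VarifoldMeasure d n,
          IsApproxMCF ψ ε V₀ V → IsApproxMCF ψ ε W₀ W →
          ∀ t : unitInterval,
            bddLipDist (V t) (W t) ≤
              bddLipDist V₀ W₀ *
                Real.exp (c₅ * (M + 1) ^ 2 * (t : ℝ) * ε ^ (-(n : ℤ) - 7)) := by
  -- The constant must be positive before a cutoff is given, and only the existence of a cutoff
  -- forces `K` to be nonnegative; hence the absolute value.
  refine ⟨1 + |stabilityConst n (kernelConst n K)|, by positivity, ?_⟩
  intro d _ _ ψ hψ ε hε hε1 M hM V₀ W₀ _ _ hVc hWc hVM hWM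
  have hA := one_le_kernelConst hψ.const_nonneg n
  have hM0 : 0 ≤ M := by linarith
  -- The mass ceiling M + 1 leaves room 1 for the growth of the mass caused by the discretization
  -- over unit time.
  have hlaw := (hψ.kernelBounds hε hε1).velocityLaw (N := M + 1) hε (by positivity)
    (by linarith) d
  have hr := rate_le hA (by linarith : 1 ≤ M + 1) hε hε1 n
  have := isFiniteMeasure_of_massMeasure_le hVM
  have := isFiniteMeasure_of_massMeasure_le hWM
  have hV := measureReal_univ_le_of_massMeasure_le hM0 hVM
  have hW := measureReal_univ_le_of_massMeasure_le hM0 hWM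
  obtain ⟨ρ, hρ⟩ := exists_measure_compl_closedBall_eq_zero hVc
  obtain ⟨σ, hσ⟩ := exists_measure_compl_closedBall_eq_zero hWc
  refine ⟨hlaw.exists_isApproxMCF (lt_add_one M) hV hρ,
    hlaw.exists_isApproxMCF (lt_add_one M) hW hσ, fun V W hVf hWf t => ?_⟩
  refine (hlaw.bddLipDist_le_mul_exp (lt_add_one M) hV hW hVf hWf t).trans ?_
  refine mul_le_mul_of_nonneg_left (Real.exp_le_exp.2 ?_) (bddLipDist_nonneg _ _)
  have ht : (0 : ℝ) ≤ t := t.2.1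
  have hz : ε ^ (-(n : ℤ) - 7) = ε⁻¹ ^ (n + 7) := by
    rw [show -(n : ℤ) - 7 = -((n + 7 : ℕ) : ℤ) by push_cast; ring, zpow_neg, zpow_natCast, inv_pow]
  have hc : stabilityConst n (kernelConst n K) ≤ 1 + |stabilityConst n (kernelConst n K)| := by
    linarith [le_abs_self (stabilityConst n (kernelConst n K))]
  calc _ ≤ stabilityConst n (kernelConst n K) * (M + 1) ^ 2 * ε⁻¹ ^ (n + 7) * (t : ℝ) :=
        mul_le_mul_of_nonneg_right hr ht
    _ ≤ (1 + |stabilityConst n (kernelConst n K)|) * (M + 1) ^ 2 * ε⁻¹ ^ (n + 7) * (t : ℝ) := by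
        gcongr
    _ = _ := by rw [hz]; ring
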